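/- **Notation.** For $z\in\mathbb C$, $n\in\mathbb N_0$ let $(z)_n=z(z+1)\cdots(z+n-1)$. The Gegenbauer polynomials are $C_n^\mu(x)=\frac{(2\mu)_n}{n!}\,{}_2F_1\big(-n,2\mu+n;\mu+\tfrac12;\tfrac{1-x}2\big)$. For $x\in(-1,1)$ the Ferrers functions of the first and second kind are $$\mathsf P_\nu^\mu(x)=\Big(\frac{1+x}{1-x}\Big)^{\mu/2}\frac{1}{\Gamma(1-\mu)}\,{}_2F_1\Big(-\nu,\nu+1;1-\mu;\frac{1-x}2\Big),$$ where $\frac1{\Gamma(c)}{}_2F_1(a,b;c;z)$ is understood as the regularized hypergeometric function, entire in $c$, and $$\mathsf Q_\nu^\mu(x)=\sqrt\pi\,2^\mu\frac{\Gamma(\frac{\nu+\mu+2}2)}{\Gamma(\frac{\nu-\mu+1}2)}\frac{x\cos[\frac\pi2(\nu+\mu)]}{(1-x^2)^{\mu/2}}\,{}_2F_1\Big(\frac{1-\nu-\mu}2,\frac{\nu-\mu+2}2;\frac32;x^2\Big)-\sqrt\pi\,2^{\mu-1}\frac{\Gamma(\frac{\nu+\mu+1}2)}{\Gamma(\frac{\nu-\mu+2}2)}\frac{\sin[\frac\pi2(\nu+\mu)]}{(1-x^2)^{\mu/2}}\,{}_2F_1\Big(\frac{-\nu-\mu}2,\frac{\nu-\mu+1}2;\frac12;x^2\Big).$$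 The function $\mathsf Q_\nu^\mu$ is defined if $\nu+\mu\notin\{-1,-2,\dots\}$, and also in the anomalous cases $\nu\in\{-\frac32,-\frac52,\dots\}$, $\nu+\mu,\nu-\mu\in\{-1,-2,\dots\}$, where the formula is taken as its limit with respect to the order $\mu$ at fixed $\nu$. Powers of positive real numbers are principal. For $\theta,\theta'\in\mathbb R$ put $\theta_<=\min\{\theta,\theta'\}$ and $\theta_>=\max\{\theta,\theta'\}$. **Theorem.** Let $\mu\in\mathbb C$ with $\Re\mu>-\tfrac12$, $\mu\ne0$; let $\nu\in\mathbb C\setminus\{-1,-2,\dots\}$, $\gamma\in\mathbb R$, and $\theta,\theta'\in(0,\pi)$ with $\tan(\tfrac12\theta_<)\tan(\tfrac12\theta_>)<1$. Let $\Theta\in[0,\pi]$ be given by $\cos\Theta=\cos\theta\cos\theta'+\sin\theta\sin\theta'\cos\gamma$, and put $K=\dfrac{2^\mu\Gamma(\mu)}{(\sin\theta\sin\theta')^\mu}$. Then the following hold, each series being absolutely convergent; in (2), (4) and (6) it is assumed that all the functions $\mathsf Q$ that occur are defined; in all but (3) it is assumed that $\theta\ne\theta'$, and in (3) that $\Theta\ne0$.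 $$\begin{aligned} (1)\quad&\frac{\mathsf P_\nu^{\mu}(\cos\Theta)}{\sin^\mu\Theta}=K\sum_{n=0}^\infty(-1)^n(n+\mu)\,\mathsf P_\nu^{-(\mu+n)}(\cos\theta_<)\,\mathsf P_\nu^{\mu+n}(\cos\theta_>)\,C_n^\mu(\cos\gamma),\\ (2)\quad&\frac{\mathsf Q_\nu^{\mu}(\cos\Theta)}{\sin^\mu\Theta}=K\sum_{n=0}^\infty(-1)^n(n+\mu)\,\mathsf P_\nu^{-(\mu+n)}(\cos\theta_<)\,\mathsf Q_\nu^{\mu+n}(\cos\theta_>)\,C_n^\mu(\cos\gamma),\\ (3)\quad&\frac{\mathsf P_\nu^{-\mu}(\cos\Theta)}{\sin^\mu\Theta}=K\sum_{n=0}^\infty(-1)^n(n+\mu)(\nu+\mu+1)_n(\mu-\nu)_n\,\mathsf P_\nu^{-(\mu+n)}(\cos\theta)\,\mathsf P_\nu^{-(\mu+n)}(\cos\theta')\,C_n^\mu(\cos\gamma),\\ (4)\quad&\frac{\mathsf Q_\nu^{-\mu}(\cos\Theta)}{\sin^\mu\Theta}=K\sum_{n=0}^\infty(-1)^n(n+\mu)(\nu+\mu+1)_n(\mu-\nu)_n\,\mathsf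 P_\nu^{-(\mu+n)}(\cos\theta_<)\,\mathsf Q_\nu^{-(\mu+n)}(\cos\theta_>)\,C_n^\mu(\cos\gamma),\\ (5)\quad&\frac{\mathsf P_\nu^{-\mu}(-\cos\Theta)}{\sin^\mu\Theta}=K\sum_{n=0}^\infty(n+\mu)(\nu+\mu+1)_n(\mu-\nu)_n\,\mathsf P_\nu^{-(\mu+n)}(\cos\theta_<)\,\mathsf P_\nu^{-(\mu+n)}(-\cos\theta_>)\,C_n^\mu(\cos\gamma),\\ (6)\quad&\frac{\mathsf Q_\nu^{-\mu}(-\cos\Theta)}{\sin^\mu\Theta}=K\sum_{n=0}^\infty(n+\mu)(\nu+\mu+1)_n(\mu-\nu)_n\,\mathsf P_\nu^{-(\mu+n)}(\cos\theta_<)\,\mathsf Q_\nu^{-(\mu+n)}(-\cos\theta_>)\,C_n^\mu(\cos\gamma). \end{aligned}$$ -/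

import Mathlib

/-- The Pochhammer symbol `(z)_n = z (z + 1) ⋯ (z + n - 1)`. -/
noncomputable def pochhammerSymbol (z : ℂ) (n : ℕ) : ℂ :=
  (ascPochhammer ℂ n).eval z

/-- The Gegenbauer polynomial
`C_n^μ(x) = ((2μ)_n / n!) ₂F₁(-n, 2μ + n; μ + 1/2; (1 - x)/2)`. -/
noncomputable def gegenbauerC (n : ℕ) (μ : ℂ) (x : ℝ) : ℂ :=
  pochhammerSymbol (2 * μ) n / (n.factorial : ℂ) *
    ordinaryHypergeometric (-(n : ℂ)) (2 * μ + n) (μ + 1 / 2) ((1 - (x : ℂ)) / 2)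

/-- The Ferrers function of the first kind `𝖯_ν^μ` on `(-1, 1)`,
`((1 + x)/(1 - x))^(μ/2) · (1/Γ(1 - μ)) ₂F₁(-ν, ν + 1; 1 - μ; (1 - x)/2)`.
The quotient `₂F₁(a, b; c; z) / Γ(c)` is the regularized hypergeometric function, which is
entire in `c`; so every complex order `μ` is allowed. -/
noncomputable def ferrersP (ν μ : ℂ) (x : ℝ) : ℂ :=
  (((1 + x) / (1 - x) : ℝ) : ℂ) ^ (μ / 2) *
    Complex.regularizedGaussHGFun (-ν) (ν + 1) (1 - μ) ((1 - (x : ℂ)) / 2)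

/-- The hypergeometric representation of the Ferrers function of the second kind on `(-1, 1)`.
If `ν + μ` is not a negative integer, no gamma function in a numerator is at a pole; a gamma
function in a denominator at a pole makes its summand vanish (Mathlib has `Γ = 0` at the poles
and division by zero is zero). -/
noncomputable def ferrersQSeries (ν μ : ℂ) (x : ℝ) : ℂ :=
  (Real.sqrt Real.pi : ℂ) * (2 : ℂ) ^ μ *
      (Complex.Gamma ((ν + μ + 2) / 2) / Complex.Gamma ((ν - μ + 1) / 2)) *
      ((x : ℂ) * Complex.cos (Real.pi / 2 * (ν + μ)) / ((1 - x ^ 2 : ℝ) : ℂ) ^ (μ / 2)) *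
      ordinaryHypergeometric ((1 - ν - μ) / 2) ((ν - μ + 2) / 2) (3 / 2 : ℂ) ((x : ℂ) ^ 2)
    - (Real.sqrt Real.pi : ℂ) * (2 : ℂ) ^ (μ - 1) *
      (Complex.Gamma ((ν + μ + 1) / 2) / Complex.Gamma ((ν - μ + 2) / 2)) *
      (Complex.sin (Real.pi / 2 * (ν + μ)) / ((1 - x ^ 2 : ℝ) : ℂ) ^ (μ / 2)) *
      ordinaryHypergeometric ((-ν - μ) / 2) ((ν - μ + 1) / 2) (1 / 2 : ℂ) ((x : ℂ) ^ 2)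

/-- `z` is one of `-1, -2, -3, …`. -/
def IsNegInt (z : ℂ) : Prop :=
  ∃ m : ℕ, z = -((m : ℂ) + 1)

/-- The pairs (degree, order) for which the Ferrers function of the second kind is defined:
`ν + μ` is not a negative integer, or the case is anomalous, i.e. `ν` is one of
`-3/2, -5/2, …` and the poles of the gamma functions in the numerators of the hypergeometric
representation, as a function of the order, are cancelled by those in the denominators (for
`ν + μ` a negative integer this means that `ν - μ` is a negative integer too). -/
def FerrersQDefined (ν μ : ℂ) : Prop :=
  ¬ IsNegInt (ν + μ) ∨ ((∃ k : ℕ, ν = -((k : ℂ) + 3 / 2)) ∧ IsNegInt (ν - μ))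

open Classical in
/-- The Ferrers function of the second kind `𝖰_ν^μ` on `(-1, 1)`: the hypergeometric
representation, extended to the anomalous cases by continuity in the order. -/
noncomputable def ferrersQ (ν μ : ℂ) (x : ℝ) : ℂ :=
  if IsNegInt (ν + μ) then
    Filter.limUnder (nhdsWithin μ {μ}ᶜ) (fun μ' : ℂ => ferrersQSeries ν μ' x)
  else ferrersQSeries ν μ x

/-- The complex power `r^μ = exp(μ log r)` of a positive real number `r`. -/
noncomputable def realCpow (r : ℝ) (μ : ℂ) : ℂ :=
  (r : ℂ) ^ μ

/-- `f = (2^μ Γ(μ) / (sin θ sin θ')^μ) ∑_{n ≥ 0} (n + μ) a_n C_n^μ(cos γ)`, where the series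
converges absolutely. -/
def HasGegenbauerExpansion (μ : ℂ) (θ θ' γ : ℝ) (f : ℂ) (a : ℕ → ℂ) : Prop :=
  Summable (fun n : ℕ => ((n : ℂ) + μ) * a n * gegenbauerC n μ (Real.cos γ)) ∧
  f = (2 : ℂ) ^ μ * Complex.Gamma μ / realCpow (Real.sin θ * Real.sin θ') μ *
    ∑' n : ℕ, ((n : ℂ) + μ) * a n * gegenbauerC n μ (Real.cos γ)

/-! Divided by the power sin^μ, a Ferrers function of order μ or -μ becomes a solution of the
Gegenbauer equation with parameter μ in z = cos Θ, and differentiation raises the parameter by one.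
With the sign and normalisation of `IsGegenbauerFamily`, the m-th Taylor coefficient of G_0 at z is
(-1)^m G_m(z) / m!. Let α and β be the smaller and the larger angle. Expand G_0(cos Θ) about z = cos
α cos β with increment 2 s cos γ, where 2 s = sin α sin β. Each (2 cos γ)^m / m! is a finite
combination of the C_{m-2k}^μ(cos γ) (`monomial_eq_sum_gegenbauer`). Absolute convergence
(`summable_doubleTerm`) permits collecting the coefficient of C_n^μ(cos γ), a series in k with terms
(-s)^{n+2k} G_{n+2k}(z) / (k! Γ(μ+n+k+1)).

The product formula `tsum_productTerm_eq` sums this series and separates the variables. As a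
function of w = (1 - cos α)/2 with y = cos β fixed, the sum solves a hypergeometric equation,
because the differential operator makes its terms telescope. It is analytic at w = 0, so it is
G_n(y) times the regularized hypergeometric function. By Euler's transformation the latter is the
Ferrers function of order -(μ+n) at cos α, up to a power of sin α / 2.

Convergence requires the discs of radius sin φ sin β about cos φ cos β, 0 ≤ φ ≤ α, to stay in the
disc on which the family is given. For the first kind of order -μ this is |z - 1| < 2, which needs α
+ β < π; for its reflection it is |z + 1| < 2, which needs α < β; in the other cases it is |z| < 1,
which needs both. The condition on tangents says α + β < π.

Functions of the second kind are described by their values at the origin, which need only satisfy a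
two-step recursion (`isGegenbauerFamily_taylorFamily`). In the anomalous cases the reflection
formula rewrites these values in a form continuous in the order. -/

open Filter Topology

/-! ### Power series on the unit disc. -/

/-- The coefficients of a power series which converges absolutely on the open unit disc. -/
def UnitDiscCoeff (a : ℕ → ℂ) : Prop :=
  ∀ r : ℝ, 0 ≤ r → r < 1 → Summable fun j => ‖a j‖ * r ^ j

/-- The sum of the power series with coefficients `a`. -/
noncomputable def powerSum (a : ℕ → ℂ) (z : ℂ) : ℂ := ∑' j, a j * z ^ j

/-- The coefficients of the derivative of a power series. -/
def derivCoeff (a : ℕ → ℂ) (j : ℕ) : ℂ := ((j : ℂ) + 1) * a (j + 1)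

namespace UnitDiscCoeff

variable {a b : ℕ → ℂ}

/-- A bound at a radius s between r and 1 leaves a geometric series of ratio r / s at radius r. -/
theorem of_bounded (h : ∀ r : ℝ, 0 ≤ r → r < 1 → ∃ C, ∀ j, ‖a j‖ * r ^ j ≤ C) :
    UnitDiscCoeff a := by
  intro r hr hr1
  obtain ⟨s, hrs, hs1⟩ := exists_between hr1
  have hs0 : 0 < s := hr.trans_lt hrs
  obtain ⟨C, hC⟩ := h s hs0.le hs1
  have hg : Summable fun j : ℕ => C * (r / s) ^ j :=
    (summable_geometric_of_lt_one (div_nonneg hr hs0.le) ((div_lt_one hs0).2 hrs)).mul_left C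
  refine Summable.of_nonneg_of_le (fun j => by positivity) (fun j => ?_) hg
  calc ‖a j‖ * r ^ j = ‖a j‖ * s ^ j * (r / s) ^ j := by
        rw [div_pow]; field_simp
    _ ≤ C * (r / s) ^ j := by gcongr; exact hC j

theorem bounded (ha : UnitDiscCoeff a) {r : ℝ} (hr : 0 ≤ r) (hr1 : r < 1) :
    ∃ C, 0 ≤ C ∧ ∀ j, ‖a j‖ * r ^ j ≤ C :=
  ⟨∑' j, ‖a j‖ * r ^ j, tsum_nonneg fun _ => by positivity,
    fun j => (ha r hr hr1).le_tsum j fun _ _ => by positivity⟩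

theorem of_two_step {ρ : ℕ → ℝ} (hρ : Tendsto ρ atTop (𝓝 1))
    (h : ∀ j, ‖a (j + 2)‖ ≤ ρ j * ‖a j‖) : UnitDiscCoeff a := by
  refine of_bounded fun r hr hr1 => ?_
  have hlim : Tendsto (fun j => ρ j * r ^ 2) atTop (𝓝 (1 * r ^ 2)) := hρ.mul_const _
  have hev : ∀ᶠ j in atTop, ρ j * r ^ 2 < 1 :=
    hlim.eventually_lt_const (by nlinarith)
  obtain ⟨N, hN⟩ := eventually_atTop.1 hev
  -- From index N on, two steps never increase ‖a j‖ r^j, so every term is at most one of the first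
  -- N + 2, hence at most their sum.
  refine ⟨∑ j ∈ Finset.range (N + 2), ‖a j‖ * r ^ j, fun j => ?_⟩
  induction j using Nat.strong_induction_on with
  | _ j ih =>
    by_cases hj : j < N + 2
    · exact Finset.single_le_sum (f := fun j => ‖a j‖ * r ^ j) (fun i _ => by positivity)
        (Finset.mem_range.2 hj)
    · obtain ⟨i, rfl⟩ : ∃ i, j = i + 2 := ⟨j - 2, by omega⟩
      refine le_trans ?_ (ih i (by omega))
      calc ‖a (i + 2)‖ * r ^ (i + 2) ≤ ρ i * ‖a i‖ * r ^ (i + 2) := by gcongr; exact h i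
        _ = (ρ i * r ^ 2) * (‖a i‖ * r ^ i) := by ring
        _ ≤ 1 * (‖a i‖ * r ^ i) := by
            gcongr; exact (hN i (by omega)).le
        _ = _ := one_mul _

theorem of_one_step {ρ : ℕ → ℝ} (hρ : Tendsto ρ atTop (𝓝 1)) (hρ0 : ∀ j, 0 ≤ ρ j)
    (h : ∀ j, ‖a (j + 1)‖ ≤ ρ j * ‖a j‖) : UnitDiscCoeff a := by
  refine of_two_step (ρ := fun j => ρ (j + 1) * ρ j) ?_ fun j => ?_
  · simpa using (hρ.comp (tendsto_add_atTop_nat 1)).mul hρ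
  · calc ‖a (j + 2)‖ ≤ ρ (j + 1) * ‖a (j + 1)‖ := h (j + 1)
      _ ≤ ρ (j + 1) * (ρ j * ‖a j‖) := by gcongr; exacts [hρ0 _, h j]
      _ = _ := by ring

/-- Writing r = √r · √r gives each factor a radius below one of its own. -/
theorem mul (ha : UnitDiscCoeff a) (hb : UnitDiscCoeff b) : UnitDiscCoeff fun j => a j * b j := by
  refine of_bounded fun r hr hr1 => ?_
  have hs1 : √r < 1 := by
    rw [Real.sqrt_lt' one_pos]; simpa using hr1
  obtain ⟨C, hC0, hC⟩ := ha.bounded (Real.sqrt_nonneg r) hs1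
  obtain ⟨D, hD0, hD⟩ := hb.bounded (Real.sqrt_nonneg r) hs1
  refine ⟨C * D, fun j => ?_⟩
  calc ‖a j * b j‖ * r ^ j = (‖a j‖ * √r ^ j) * (‖b j‖ * √r ^ j) := by
        rw [norm_mul]
        nth_rewrite 1 [← Real.mul_self_sqrt hr]
        ring
    _ ≤ C * D := mul_le_mul (hC j) (hD j) (by positivity) hC0

theorem add (ha : UnitDiscCoeff a) (hb : UnitDiscCoeff b) : UnitDiscCoeff fun j => a j + b j := by
  intro r hr hr1
  refine Summable.of_nonneg_of_le (fun j => by positivity) (fun j => ?_)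
    ((ha r hr hr1).add (hb r hr hr1))
  rw [← add_mul]
  gcongr
  exact norm_add_le _ _

theorem const (c : ℂ) : UnitDiscCoeff fun _ => c :=
  of_one_step (ρ := fun _ => 1) tendsto_const_nhds (fun _ => zero_le_one) fun j => by simp

theorem natCast : UnitDiscCoeff fun j => (j : ℂ) := by
  intro r hr hr1
  have := summable_pow_mul_geometric_of_norm_lt_one 1 (r := r) (by rwa [Real.norm_of_nonneg hr])
  simpa using this

theorem const_mul (ha : UnitDiscCoeff a) (c : ℂ) : UnitDiscCoeff fun j => c * a j :=
  (const c).mul ha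

theorem natCast_mul (ha : UnitDiscCoeff a) : UnitDiscCoeff fun j => (j : ℂ) * a j :=
  natCast.mul ha

theorem neg (ha : UnitDiscCoeff a) : UnitDiscCoeff fun j => - a j := by
  simpa using ha.const_mul (-1)

theorem sub (ha : UnitDiscCoeff a) (hb : UnitDiscCoeff b) : UnitDiscCoeff fun j => a j - b j := by
  simpa [sub_eq_add_neg] using ha.add hb.neg

theorem of_norm_le (hb : UnitDiscCoeff b) (h : ∀ j, ‖a j‖ ≤ ‖b j‖) : UnitDiscCoeff a :=
  fun r hr hr1 => Summable.of_nonneg_of_le (fun j => by positivity)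
    (fun j => mul_le_mul_of_nonneg_right (h j) (by positivity)) (hb r hr hr1)

theorem succ (ha : UnitDiscCoeff a) : UnitDiscCoeff fun j => a (j + 1) := by
  refine of_bounded fun r hr hr1 => ?_
  obtain ⟨s, hrs, hs1⟩ := exists_between hr1
  have hs0 : 0 < s := hr.trans_lt hrs
  obtain ⟨C, hC0, hC⟩ := ha.bounded hs0.le hs1
  refine ⟨C / s, fun j => ?_⟩
  rw [le_div_iff₀ hs0]
  calc ‖a (j + 1)‖ * r ^ j * s ≤ ‖a (j + 1)‖ * s ^ j * s := by gcongr
    _ = ‖a (j + 1)‖ * s ^ (j + 1) := by ring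
    _ ≤ C := hC _

theorem derivCoeff (ha : UnitDiscCoeff a) : UnitDiscCoeff (derivCoeff a) := by
  have := ha.natCast_mul.succ
  refine this.of_norm_le fun j => ?_
  simp [_root_.derivCoeff]

theorem summable_norm (ha : UnitDiscCoeff a) {z : ℂ} (hz : ‖z‖ < 1) :
    Summable fun j => ‖a j * z ^ j‖ := by
  simpa using ha ‖z‖ (norm_nonneg z) hz

theorem summable (ha : UnitDiscCoeff a) {z : ℂ} (hz : ‖z‖ < 1) : Summable fun j => a j * z ^ j :=
  (ha.summable_norm hz).of_norm

/-- Cauchy products of absolutely convergent power series. -/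
theorem cauchyProduct (ha : UnitDiscCoeff a) (hb : UnitDiscCoeff b) :
    UnitDiscCoeff fun n => ∑ kl ∈ Finset.HasAntidiagonal.antidiagonal n, a kl.1 * b kl.2 := by
  intro r hr hr1
  have hr' : ‖(r : ℂ)‖ < 1 := by simpa [abs_of_nonneg hr] using hr1
  have := summable_norm_sum_mul_antidiagonal_of_summable_norm
    (ha.summable_norm hr') (hb.summable_norm hr')
  refine this.congr fun n => ?_
  have : ∑ kl ∈ Finset.HasAntidiagonal.antidiagonal n,
        a kl.1 * (r : ℂ) ^ kl.1 * (b kl.2 * (r : ℂ) ^ kl.2)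
      = (∑ kl ∈ Finset.HasAntidiagonal.antidiagonal n, a kl.1 * b kl.2) * (r : ℂ) ^ n := by
    rw [Finset.sum_mul]
    refine Finset.sum_congr rfl fun kl hkl => ?_
    rw [← Finset.HasAntidiagonal.mem_antidiagonal.1 hkl, pow_add]
    ring
  rw [this, norm_mul, norm_pow, Complex.norm_real, Real.norm_of_nonneg hr]

theorem hasDerivAt_powerSum (ha : UnitDiscCoeff a) {z : ℂ} (hz : ‖z‖ < 1) :
    HasDerivAt (powerSum a) (powerSum (_root_.derivCoeff a) z) z := by
  obtain ⟨s, hzs, hs1⟩ := exists_between hz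
  have hs0 : 0 < s := (norm_nonneg z).trans_lt hzs
  have hu : Summable fun j : ℕ => ‖a j‖ * s ^ j := ha s hs0.le hs1
  have hd : ∀ j : ℕ, DifferentiableOn ℂ (fun w : ℂ => a j * w ^ j) (Metric.ball 0 s) :=
    fun j => by fun_prop
  have hb : ∀ (j : ℕ) (w : ℂ), w ∈ Metric.ball (0 : ℂ) s → ‖a j * w ^ j‖ ≤ ‖a j‖ * s ^ j := by
    intro j w hw
    rw [norm_mul, norm_pow]
    have : ‖w‖ ≤ s := (mem_ball_zero_iff.1 hw).le
    gcongr
  have hzm : z ∈ Metric.ball (0 : ℂ) s := mem_ball_zero_iff.2 hzs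
  have h1 := Complex.hasSum_deriv_of_summable_norm hu hd Metric.isOpen_ball hb hzm
  have h2 :=
    (Complex.differentiableOn_tsum_of_summable_norm hu hd Metric.isOpen_ball hb).differentiableAt
    (Metric.isOpen_ball.mem_nhds hzm)
  have h3 := h2.hasDerivAt
  have h4 : deriv (fun w => ∑' j, a j * w ^ j) z = powerSum (_root_.derivCoeff a) z := by
    rw [← h1.tsum_eq, h1.summable.tsum_eq_zero_add]
    simp only [pow_zero, mul_one, deriv_const, zero_add, powerSum, _root_.derivCoeff]
    refine tsum_congr fun j => ?_
    rw [deriv_const_mul _ (by fun_prop)]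
    simp
    ring
  rw [h4] at h3
  exact h3

theorem differentiableOn_powerSum (ha : UnitDiscCoeff a) :
    DifferentiableOn ℂ (powerSum a) (Metric.ball 0 1) := fun _ hz =>
  (ha.hasDerivAt_powerSum (mem_ball_zero_iff.1 hz)).differentiableAt.differentiableWithinAt

theorem powerSum_add (ha : UnitDiscCoeff a) (hb : UnitDiscCoeff b) {z : ℂ} (hz : ‖z‖ < 1) :
    powerSum (fun j => a j + b j) z = powerSum a z + powerSum b z := by
  rw [powerSum, powerSum, powerSum, ← (ha.summable hz).tsum_add (hb.summable hz)]
  simp only [add_mul]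

theorem powerSum_sub (ha : UnitDiscCoeff a) (hb : UnitDiscCoeff b) {z : ℂ} (hz : ‖z‖ < 1) :
    powerSum (fun j => a j - b j) z = powerSum a z - powerSum b z := by
  rw [powerSum, powerSum, powerSum, ← (ha.summable hz).tsum_sub (hb.summable hz)]
  simp only [sub_mul]

end UnitDiscCoeff

theorem powerSum_const_mul (c : ℂ) (a : ℕ → ℂ) (z : ℂ) :
    powerSum (fun j => c * a j) z = c * powerSum a z := by
  simp only [powerSum, mul_assoc, tsum_mul_left]

theorem powerSum_zero_right (a : ℕ → ℂ) : powerSum a 0 = a 0 := by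
  rw [powerSum, tsum_eq_single 0 fun j hj => by simp [hj]]
  simp

/-- The Euler operator `z d/dz` on power series. -/
theorem mul_powerSum_derivCoeff {a : ℕ → ℂ} (ha : UnitDiscCoeff a) {z : ℂ} (hz : ‖z‖ < 1) :
    z * powerSum (derivCoeff a) z = powerSum (fun j => (j : ℂ) * a j) z := by
  rw [powerSum, powerSum, (ha.natCast_mul.summable hz).tsum_eq_zero_add, ← tsum_mul_left]
  simp only [Nat.cast_zero, zero_mul, zero_add, derivCoeff]
  refine tsum_congr fun j => ?_
  push_cast
  ring

theorem sq_mul_powerSum_derivCoeff {a : ℕ → ℂ} (ha : UnitDiscCoeff a) {z : ℂ} (hz : ‖z‖ < 1) :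
    z ^ 2 * powerSum (derivCoeff (derivCoeff a)) z
      = powerSum (fun j => (j : ℂ) * ((j : ℂ) - 1) * a j) z := by
  have h1 := mul_powerSum_derivCoeff ha.derivCoeff hz
  have h2 := mul_powerSum_derivCoeff (ha.natCast_mul.sub ha) hz
  have h3 : derivCoeff (fun j => (j : ℂ) * a j - a j) = fun j : ℕ => (j : ℂ) * derivCoeff a j := by
    funext j
    simp only [derivCoeff]
    push_cast
    ring
  rw [h3] at h2
  rw [sq, mul_assoc, h1, h2]
  congr 1
  funext j
  ring

/-! ### The hypergeometric equation and Euler's transformation. -/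

/-- At the origin, the hypergeometric equation has no nonzero analytic solution that vanishes at
the origin. -/
theorem eventually_eq_zero_of_hypergeometricODE {a b c : ℂ} (hc : ∀ k : ℕ, c ≠ -k)
    {f f₁ f₂ : ℂ → ℂ} (hf : ∀ᶠ z in 𝓝 0, HasDerivAt f (f₁ z) z)
    (hf₁ : ∀ᶠ z in 𝓝 0, HasDerivAt f₁ (f₂ z) z)
    (hode : ∀ᶠ z in 𝓝 0, z * (1 - z) * f₂ z + (c - (a + b + 1) * z) * f₁ z - a * b * f z = 0)
    (h0 : f 0 = 0) : ∀ᶠ z in 𝓝 0, f z = 0 := by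
  have hfa : AnalyticAt ℂ f 0 :=
    Complex.analyticAt_iff_eventually_differentiableAt.2 (hf.mono fun z hz => hz.differentiableAt)
  by_contra hne
  -- If f does not vanish near 0, it is z^m g with g(0) ≠ 0, and f(0) = 0 forces m = k + 1. The
  -- lowest-order term of the equation is then (k + 1)(k + c) g(0) z^k, which cannot vanish.
  obtain ⟨m, g, hg, hg0, hfg⟩ := hfa.exists_eventuallyEq_pow_smul_nonzero_iff.2 hne
  simp only [sub_zero, smul_eq_mul] at hfg
  obtain ⟨k, rfl⟩ : ∃ k, m = k + 1 := by
    refine Nat.exists_eq_succ_of_ne_zero fun hm => hg0 ?_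
    have := hfg.self_of_nhds
    simpa [hm, h0] using this.symm
  set h : ℂ → ℂ := fun z => ((k : ℂ) + 1) * g z + z * deriv g z with hh
  have hgd : ∀ᶠ z in 𝓝 0, HasDerivAt g (deriv g z) z :=
    hg.eventually_analyticAt.mono fun z hz => hz.differentiableAt.hasDerivAt
  have hha : AnalyticAt ℂ h 0 := by
    have := hg.deriv
    fun_prop
  have hhd : ∀ᶠ z in 𝓝 0, HasDerivAt h (deriv h z) z :=
    hha.eventually_analyticAt.mono fun z hz => hz.differentiableAt.hasDerivAt
  have e₁ : ∀ᶠ z in 𝓝 0, f₁ z = z ^ k * h z := by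
    filter_upwards [hfg.eventually_nhds, hf, hgd] with z hz hz1 hz2
    have h1 : HasDerivAt (fun z => z ^ (k + 1) * g z)
        (((k + 1 : ℕ) : ℂ) * z ^ k * g z + z ^ (k + 1) * deriv g z) z := by
      exact (hasDerivAt_pow (k + 1) z).fun_mul hz2
    have h2 := (h1.congr_of_eventuallyEq hz).unique hz1
    rw [← h2, hh]
    push_cast
    ring
  have e₂ : ∀ᶠ z in 𝓝 0, z * f₂ z = z ^ k * (k * h z + z * deriv h z) := by
    filter_upwards [e₁.eventually_nhds, hf₁, hhd] with z hz hz1 hz2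
    have h1 := (hasDerivAt_pow k z).mul hz2
    have h2 := (h1.congr_of_eventuallyEq hz).unique hz1
    rw [← h2]
    rcases k with _ | k
    · simp
    · simp only [Nat.add_sub_cancel]
      push_cast
      ring
  -- `φ` is the left side of the equation divided by z^k; it vanishes off 0, hence at 0 by
  -- continuity.
  set φ : ℂ → ℂ := fun z => (1 - z) * (k * h z + z * deriv h z) + (c - (a + b + 1) * z) * h z
    - a * b * z * g z with hφ
  have hφc : ContinuousAt φ 0 := by
    have h1 := hha.continuousAt
    have h2 := hha.deriv.continuousAt
    have h3 := hg.continuousAt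
    fun_prop
  have hφ0 : ∀ᶠ z in 𝓝[≠] 0, φ z = 0 := by
    have key : ∀ᶠ z in 𝓝 0, z ^ k * φ z = 0 := by
      filter_upwards [hode, e₁, e₂, hfg] with z h1 h2 h3 h4
      rw [h2, h4] at h1
      rw [← h1, hφ]
      linear_combination (-(1 - z)) * h3
    filter_upwards [key.filter_mono nhdsWithin_le_nhds, self_mem_nhdsWithin] with z h1 h2
    exact (mul_eq_zero.1 h1).resolve_left (pow_ne_zero _ h2)
  have hlim : φ 0 = 0 := by
    have h1 : Tendsto φ (𝓝[≠] 0) (𝓝 (φ 0)) := hφc.tendsto.mono_left nhdsWithin_le_nhds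
    have h2 : Tendsto φ (𝓝[≠] 0) (𝓝 0) :=
      tendsto_const_nhds.congr' (hφ0.mono fun z hz => hz.symm)
    exact tendsto_nhds_unique h1 h2
  have : ((k : ℂ) + c) * (((k : ℂ) + 1) * g 0) = 0 := by
    have := hlim
    simp only [hφ, hh] at this
    linear_combination this
  rcases mul_eq_zero.1 this with h1 | h1
  · exact hc k (by linear_combination h1)
  · rcases mul_eq_zero.1 h1 with h1 | h1
    · exact Nat.cast_add_one_ne_zero k h1
    · exact hg0 h1

/-- The coefficients of the regularized Gauss hypergeometric series. -/
noncomputable def gaussCoeff (a b c : ℂ) (j : ℕ) : ℂ :=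
  (ascPochhammer ℂ j).eval a * (ascPochhammer ℂ j).eval b / (j.factorial * Complex.Gamma (c + j))

/-- For 1/Γ the functional equation holds at the poles of Γ too, so no parameter has to be excluded
in the recursions below. -/
theorem inv_Gamma_eq_mul (s : ℂ) : (Complex.Gamma s)⁻¹ = s * (Complex.Gamma (s + 1))⁻¹ :=
  Complex.one_div_Gamma_eq_self_mul_one_div_Gamma_add_one s

theorem gaussCoeff_succ (a b c : ℂ) (j : ℕ) :
    ((j : ℂ) + 1) * (c + j) * gaussCoeff a b c (j + 1) = (a + j) * (b + j) * gaussCoeff a b c j := by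
  have h := inv_Gamma_eq_mul (c + j)
  have hj : ((j : ℂ) + 1) ≠ 0 := Nat.cast_add_one_ne_zero j
  have hj' : (j.factorial : ℂ) ≠ 0 := Nat.cast_ne_zero.2 j.factorial_ne_zero
  simp only [gaussCoeff, ascPochhammer_succ_eval, Nat.factorial_succ, Nat.cast_mul, Nat.cast_add,
    Nat.cast_one, div_eq_mul_inv, mul_inv, h, ← add_assoc]
  field_simp

theorem powerSum_gaussCoeff (a b c z : ℂ) :
    powerSum (gaussCoeff a b c) z = Complex.regularizedGaussHGFun a b c z := by
  rw [powerSum, Complex.regularizedGaussHGFun, FormalMultilinearSeries.sum]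
  refine tsum_congr fun j => ?_
  rw [FormalMultilinearSeries.apply_eq_pow_smul_coeff, Complex.coeff_regularizedGaussHGFunSeries,
    smul_eq_mul, mul_comm, gaussCoeff]

theorem unitDiscCoeff_gaussCoeff (a b c : ℂ) : UnitDiscCoeff (gaussCoeff a b c) := by
  intro r hr hr1
  lift r to NNReal using hr
  have h1 : (r : ENNReal) < (Complex.regularizedGaussHGFunSeries a b c).radius :=
    lt_of_lt_of_le (by exact_mod_cast hr1) (Complex.radius_regularizedGaussHGFunSeries_ge_one a b c)
  refine (FormalMultilinearSeries.summable_norm_mul_pow _ h1).congr fun j => ?_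
  rw [FormalMultilinearSeries.norm_apply_eq_norm_coef, Complex.coeff_regularizedGaussHGFunSeries,
    gaussCoeff]

/-- A power series whose coefficients satisfy the hypergeometric recursion solves the
hypergeometric equation. -/
theorem hypergeometricODE_powerSum {a b c : ℂ} {r : ℕ → ℂ} (hr : UnitDiscCoeff r)
    (hrec : ∀ j : ℕ, ((j : ℂ) + 1) * (c + j) * r (j + 1) = (a + j) * (b + j) * r j)
    {z : ℂ} (hz : ‖z‖ < 1) :
    z * (1 - z) * powerSum (derivCoeff (derivCoeff r)) z
      + (c - (a + b + 1) * z) * powerSum (derivCoeff r) z - a * b * powerSum r z = 0 := by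
  have h1 := mul_powerSum_derivCoeff hr.derivCoeff hz
  have h2 := mul_powerSum_derivCoeff hr hz
  have h3 := sq_mul_powerSum_derivCoeff hr hz
  have c1 := hr.derivCoeff.natCast_mul
  have c2 := hr.derivCoeff.const_mul c
  have c3 : UnitDiscCoeff fun j => (j : ℂ) * ((j : ℂ) - 1) * r j := by
    have := (hr.natCast_mul.sub hr).natCast_mul
    refine this.of_norm_le fun j => le_of_eq ?_
    congr 1; ring
  have c4 := hr.natCast_mul.const_mul (a + b + 1)
  have c5 := hr.const_mul (a * b)
  have key : powerSum (fun j => (((j : ℂ) * derivCoeff r j + c * derivCoeff r j)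
      - (j : ℂ) * ((j : ℂ) - 1) * r j - (a + b + 1) * ((j : ℂ) * r j)) - a * b * r j) z = 0 := by
    rw [powerSum]
    convert tsum_zero with j
    have := hrec j
    simp only [derivCoeff]
    linear_combination (z ^ j) * this
  rw [(((c1.add c2).sub c3).sub c4).powerSum_sub c5 hz, ((c1.add c2).sub c3).powerSum_sub c4 hz,
    (c1.add c2).powerSum_sub c3 hz, c1.powerSum_add c2 hz, powerSum_const_mul, powerSum_const_mul,
    powerSum_const_mul, ← h1, ← h2, ← h3] at key
  linear_combination key

theorem one_sub_mem_slitPlane {z : ℂ} (hz : ‖z‖ < 1) : 1 - z ∈ Complex.slitPlane := by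
  rw [sub_eq_add_neg]
  exact Complex.mem_slitPlane_of_norm_lt_one (by simpa using hz)

theorem cpow_eq_cpow_sub_one_mul {x : ℂ} (hx : x ≠ 0) (s : ℂ) : x ^ s = x ^ (s - 1) * x := by
  rw [Complex.cpow_sub _ _ hx, Complex.cpow_one, div_mul_cancel₀ _ hx]

/-- **Euler's transformation** of the regularized Gauss hypergeometric function. -/
theorem regularizedGaussHGFun_euler {a b c : ℂ} (hc : ∀ k : ℕ, c ≠ -k) {z : ℂ} (hz : ‖z‖ < 1) :
    Complex.regularizedGaussHGFun a b c z =
      (1 - z) ^ (c - a - b) * Complex.regularizedGaussHGFun (c - a) (c - b) c z := by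
  set s := c - a - b with hs
  set r := gaussCoeff a b c
  set t := gaussCoeff (c - a) (c - b) c
  have hr : UnitDiscCoeff r := unitDiscCoeff_gaussCoeff _ _ _
  have ht : UnitDiscCoeff t := unitDiscCoeff_gaussCoeff _ _ _
  let F := powerSum t
  let F₁ := powerSum (derivCoeff t)
  let F₂ := powerSum (derivCoeff (derivCoeff t))
  -- `H` is chosen so that (1 - z)^s F has derivative (1 - z)^(s-1) H; `H₁` is the derivative of
  -- `H`.
  let H : ℂ → ℂ := fun z => -s * F z + (1 - z) * F₁ z
  let H₁ : ℂ → ℂ := fun z => -s * F₁ z + (-F₁ z + (1 - z) * F₂ z)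
  have hF : ∀ z : ℂ, ‖z‖ < 1 → HasDerivAt F (F₁ z) z := fun z hz => ht.hasDerivAt_powerSum hz
  have hF₁ : ∀ z : ℂ, ‖z‖ < 1 → HasDerivAt F₁ (F₂ z) z :=
    fun z hz => ht.derivCoeff.hasDerivAt_powerSum hz
  have hsub : ∀ z : ℂ, HasDerivAt (fun z : ℂ => 1 - z) (-1) z := fun z => by
    simpa using (hasDerivAt_id z).const_sub 1
  have hH : ∀ z : ℂ, ‖z‖ < 1 → HasDerivAt H (H₁ z) z := fun z hz => by
    refine (((hF z hz).const_mul (-s)).fun_add ((hsub z).fun_mul (hF₁ z hz))).congr_deriv ?_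
    simp only [H₁]; ring
  have hpow : ∀ (e z : ℂ), ‖z‖ < 1 →
      HasDerivAt (fun z : ℂ => (1 - z) ^ e) (-e * (1 - z) ^ (e - 1)) z := fun e z hz => by
    convert (hsub z).cpow_const (c := e) (one_sub_mem_slitPlane hz) using 1
    ring
  have hne : ∀ z : ℂ, ‖z‖ < 1 → 1 - z ≠ 0 := fun z hz =>
    Complex.slitPlane_ne_zero (one_sub_mem_slitPlane hz)
  have hg : ∀ z : ℂ, ‖z‖ < 1 →
      HasDerivAt (fun z => (1 - z) ^ s * F z) ((1 - z) ^ (s - 1) * H z) z := fun z hz => by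
    refine ((hpow s z hz).fun_mul (hF z hz)).congr_deriv ?_
    simp only [H]
    rw [cpow_eq_cpow_sub_one_mul (hne z hz) s]; ring
  have hg₁ : ∀ z : ℂ, ‖z‖ < 1 →
      HasDerivAt (fun z => (1 - z) ^ (s - 1) * H z)
        (-(s - 1) * (1 - z) ^ (s - 1 - 1) * H z + (1 - z) ^ (s - 1) * H₁ z) z := fun z hz =>
    (hpow (s - 1) z hz).fun_mul (hH z hz)
  have hball : ∀ᶠ z : ℂ in 𝓝 0, ‖z‖ < 1 := by
    filter_upwards [Metric.ball_mem_nhds (0 : ℂ) one_pos] with z hz using mem_ball_zero_iff.1 hz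
  -- Both sides solve the equation with parameters a, b, c and have the value 1/Γ(c) at 0, so
  -- uniqueness applies near 0. The identity theorem then covers the disc.
  have hloc : ∀ᶠ z in 𝓝 0, powerSum r z - (1 - z) ^ s * F z = 0 := by
    refine eventually_eq_zero_of_hypergeometricODE (a := a) (b := b) hc
      (hball.mono fun z hz => (hr.hasDerivAt_powerSum hz).sub (hg z hz))
      (hball.mono fun z hz => (hr.derivCoeff.hasDerivAt_powerSum hz).sub (hg₁ z hz))
      (hball.mono fun z hz => ?_) ?_
    · have h1 := hypergeometricODE_powerSum hr (gaussCoeff_succ a b c) hz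
      have h2 := hypergeometricODE_powerSum ht (gaussCoeff_succ (c - a) (c - b) c) hz
      have e1 := cpow_eq_cpow_sub_one_mul (hne z hz) (s - 1)
      have e2 : (1 - z) ^ s = (1 - z) ^ (s - 1 - 1) * (1 - z) ^ 2 := by
        rw [cpow_eq_cpow_sub_one_mul (hne z hz) s, e1]
        ring
      change z * (1 - z) * (_ - _) + (c - (a + b + 1) * z) * (_ - _) - a * b * (_ - _) = 0
      rw [e2, e1]
      simp only [H, H₁, hs]
      change z * (1 - z) * F₂ z + (c - ((c - a) + (c - b) + 1) * z) * F₁ z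
        - (c - a) * (c - b) * F z = 0 at h2
      linear_combination h1 - (1 - z) ^ (s - 1 - 1) * (1 - z) ^ 2 * h2
    · simp [r, t, F, powerSum_zero_right, gaussCoeff]
  have h1 : AnalyticOnNhd ℂ (powerSum r) (Metric.ball 0 1) :=
    hr.differentiableOn_powerSum.analyticOnNhd Metric.isOpen_ball
  have h2 : AnalyticOnNhd ℂ (fun z => (1 - z) ^ s * F z) (Metric.ball 0 1) :=
    DifferentiableOn.analyticOnNhd (fun z hz => (hg z (mem_ball_zero_iff.1
      hz)).differentiableAt.differentiableWithinAt) Metric.isOpen_ball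
  have := h1.eqOn_of_preconnected_of_eventuallyEq h2
    (convex_ball (0 : ℂ) 1).isPreconnected (Metric.mem_ball_self one_pos)
    (hloc.mono fun z hz => sub_eq_zero.1 hz) (mem_ball_zero_iff.2 hz)
  simpa [F, r, t, powerSum_gaussCoeff] using this

theorem ordinaryHypergeometric_euler {a b c : ℂ} (hc : ∀ k : ℕ, c ≠ -k) {z : ℂ} (hz : ‖z‖ < 1) :
    ordinaryHypergeometric a b c z =
      (1 - z) ^ (c - a - b) * ordinaryHypergeometric (c - a) (c - b) c z := by
  have h := regularizedGaussHGFun_euler (a := a) (b := b) hc hz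
  rw [← Complex.ordinaryHypergeometric_div_Gamma_eq hc,
    ← Complex.ordinaryHypergeometric_div_Gamma_eq hc] at h
  have hG : Complex.Gamma c ≠ 0 := Complex.Gamma_ne_zero hc
  field_simp at h
  exact h

/-! ### Gegenbauer polynomials and their three-term recurrence. -/

theorem ascPochhammer_eval_ne_zero_of_re_pos {z : ℂ} (hz : 0 < z.re) (n : ℕ) :
    (ascPochhammer ℂ n).eval z ≠ 0 := by
  rw [Ne, ascPochhammer_eval_eq_zero_iff]
  rintro ⟨k, -, hk⟩
  have := congrArg Complex.re hk
  simp at this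
  have hk0 : (0 : ℝ) ≤ k := k.cast_nonneg
  linarith

/-- The coefficients of the Gegenbauer polynomial `C_n^μ(x)` in powers of `(1 - x) / 2`. -/
noncomputable def gegenbauerCoeff (μ : ℂ) (n j : ℕ) : ℂ :=
  (-1) ^ j * (n.choose j : ℂ) * (ascPochhammer ℂ (n + j)).eval (2 * μ) /
    (n.factorial * (ascPochhammer ℂ j).eval (μ + 1 / 2))

theorem ascPochhammer_eval_add (z : ℂ) (n j : ℕ) :
    (ascPochhammer ℂ (n + j)).eval z
      = (ascPochhammer ℂ n).eval z * (ascPochhammer ℂ j).eval (z + n) := by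
  rw [← ascPochhammer_mul]
  simp

theorem ascPochhammer_eval_neg_natCast (n j : ℕ) :
    (ascPochhammer ℂ j).eval (-(n : ℂ)) = (-1) ^ j * (j.factorial * n.choose j) := by
  rw [ascPochhammer_eval_neg_eq_descPochhammer, descPochhammer_eval_eq_descFactorial,
    Nat.descFactorial_eq_factorial_mul_choose]
  push_cast
  ring

/-- The factor (-n)_j cuts the series off after j = n. The freedom in N lets polynomials of
different degrees be summed over one range. -/
theorem gegenbauerC_eq_sum (μ : ℂ) (x : ℝ) {n N : ℕ} (hN : n < N) :
    gegenbauerC n μ x = ∑ j ∈ Finset.range N, gegenbauerCoeff μ n j * ((1 - (x : ℂ)) / 2) ^ j := by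
  rw [gegenbauerC, ordinaryHypergeometric_eq_tsum]
  beta_reduce
  rw [tsum_eq_sum (s := Finset.range N), Finset.mul_sum]
  · refine Finset.sum_congr rfl fun j _ => ?_
    have hj' : (j.factorial : ℂ) ≠ 0 := Nat.cast_ne_zero.2 j.factorial_ne_zero
    rw [ascPochhammer_eval_neg_natCast, gegenbauerCoeff, ascPochhammer_eval_add, pochhammerSymbol,
      smul_eq_mul]
    field_simp
  · intro j hj
    have : n.choose j = 0 := Nat.choose_eq_zero_of_lt (by
      have := Finset.mem_range.not.1 hj; omega)
    simp [ascPochhammer_eval_neg_natCast, this]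

theorem gegenbauerC_zero (μ : ℂ) (x : ℝ) : gegenbauerC 0 μ x = 1 := by
  rw [gegenbauerC_eq_sum μ x (Nat.lt_succ_self 0)]
  simp [gegenbauerCoeff]

theorem gegenbauerC_one {μ : ℂ} (hμ : -(1 / 2 : ℝ) < μ.re) (x : ℝ) :
    gegenbauerC 1 μ x = 2 * μ * x := by
  have h : μ + 1 / 2 ≠ 0 := fun h => by
    have := congrArg Complex.re h
    simp at this
    linarith
  rw [gegenbauerC_eq_sum μ x (Nat.lt_succ_self 1)]
  have h' : 2 * (2 * μ + 1) / (μ + 1 / 2) = 4 := by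
    rw [div_eq_iff h]; ring
  simp only [gegenbauerCoeff, Finset.sum_range_succ, ascPochhammer_succ_eval, Finset.range_zero,
    Finset.sum_empty, ascPochhammer_zero, Polynomial.eval_one]
  simp
  linear_combination (-(1 - (x : ℂ)) / 2 * μ) * h'

theorem gegenbauerCoeff_recurrence_zero (μ : ℂ) (n : ℕ) :
    ((n : ℂ) + 2) * gegenbauerCoeff μ (n + 2) 0
      = 2 * (n + 1 + μ) * gegenbauerCoeff μ (n + 1) 0 - (n + 2 * μ) * gegenbauerCoeff μ n 0 := by
  have h1 : (n : ℂ) + 1 ≠ 0 := Nat.cast_add_one_ne_zero n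
  have h2 : (n : ℂ) + 1 + 1 ≠ 0 := by
    have := Nat.cast_add_one_ne_zero (R := ℂ) (n + 1)
    push_cast at this
    exact this
  have h3 : (n.factorial : ℂ) ≠ 0 := Nat.cast_ne_zero.2 n.factorial_ne_zero
  simp only [gegenbauerCoeff, pow_zero, Nat.choose_zero_right, Nat.cast_one, add_zero,
    ascPochhammer_zero, Polynomial.eval_one, mul_one, one_mul, ascPochhammer_succ_eval,
    Nat.factorial_succ, Nat.cast_mul, Nat.cast_add]
  field_simp
  ring

/-- This is the three-term recurrence read off at the power i + 1 of v = (1 - x)/2: since x = 1 -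
2v, multiplication by x subtracts twice the preceding coefficient. The bound on Re μ keeps the
denominators (μ + 1/2)_j away from zero. -/
theorem gegenbauerCoeff_recurrence_succ {μ : ℂ} (hμ : -(1 / 2 : ℝ) < μ.re) (n i : ℕ) :
    ((n : ℂ) + 2) * gegenbauerCoeff μ (n + 2) (i + 1)
      = 2 * (n + 1 + μ) * (gegenbauerCoeff μ (n + 1) (i + 1) - 2 * gegenbauerCoeff μ (n + 1) i)
        - (n + 2 * μ) * gegenbauerCoeff μ n (i + 1) := by
  have h1 : (n : ℂ) + 1 ≠ 0 := Nat.cast_add_one_ne_zero n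
  have h2 : (n : ℂ) + 1 + 1 ≠ 0 := by
    have := Nat.cast_add_one_ne_zero (R := ℂ) (n + 1)
    push_cast at this
    exact this
  have h3 : (n.factorial : ℂ) ≠ 0 := Nat.cast_ne_zero.2 n.factorial_ne_zero
  have hd : ∀ j, (ascPochhammer ℂ j).eval (μ + 1 / 2) ≠ 0 := fun j =>
    ascPochhammer_eval_ne_zero_of_re_pos (by simp; linarith) j
  have hdi := hd i
  have hdi' := hd (i + 1)
  rw [ascPochhammer_succ_eval] at hdi'
  have hdi2 := right_ne_zero_of_mul hdi'
  have c1 : ((n + 1).choose (i + 1) : ℂ) * (i + 1) = (n + 1).choose i * (n + 1 - i) := by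
    rcases le_or_gt i (n + 1) with hi | hi
    · have := Nat.choose_succ_right_eq (n + 1) i
      have := congrArg (Nat.cast : ℕ → ℂ) this
      push_cast [Nat.cast_sub hi] at this
      exact this
    · rw [Nat.choose_eq_zero_of_lt hi, Nat.choose_eq_zero_of_lt (by omega)]
      simp
  have c2 : ((n + 2).choose (i + 1) : ℂ) = (n + 1).choose i + (n + 1).choose (i + 1) := by
    rw [Nat.choose_succ_succ]; push_cast; ring
  have c3 : ((n : ℂ) + 1) * n.choose (i + 1) = (n - i) * (n + 1).choose (i + 1) := by
    rcases le_or_gt i n with hi | hi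
    · have h4 := Nat.choose_mul_succ_eq n (i + 1)
      have h4 := congrArg (Nat.cast : ℕ → ℂ) h4
      rw [show n + 1 - (i + 1) = n - i by omega] at h4
      push_cast [Nat.cast_sub hi] at h4
      linear_combination h4
    · rw [Nat.choose_eq_zero_of_lt (show n < i + 1 by omega),
        Nat.choose_eq_zero_of_lt (show n + 1 < i + 1 by omega)]
      simp
  generalize hX : ((n + 1).choose i : ℂ) = X at *
  generalize hW : ((n + 1).choose (i + 1) : ℂ) = W at *
  generalize hZ' : (n.choose (i + 1) : ℂ) = Z at *
  generalize hD : (ascPochhammer ℂ i).eval (μ + 1 / 2) = D at *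
  set P := (ascPochhammer ℂ (n + i + 1)).eval (2 * μ) with hP
  have p1 : (ascPochhammer ℂ (n + 2 + (i + 1))).eval (2 * μ)
      = P * (2 * μ + (n + i + 1)) * (2 * μ + (n + i + 2)) := by
    rw [show n + 2 + (i + 1) = n + i + 1 + 1 + 1 by ring, ascPochhammer_succ_eval,
      ascPochhammer_succ_eval, ← hP]
    push_cast
    ring
  have p2 : (ascPochhammer ℂ (n + 1 + (i + 1))).eval (2 * μ) = P * (2 * μ + (n + i + 1)) := by
    rw [show n + 1 + (i + 1) = n + i + 1 + 1 by ring, ascPochhammer_succ_eval, ← hP]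
    push_cast
    ring
  have p3 : (ascPochhammer ℂ (n + 1 + i)).eval (2 * μ) = P := by
    rw [show n + 1 + i = n + i + 1 by ring]
  have p4 : (ascPochhammer ℂ (n + (i + 1))).eval (2 * μ) = P := by
    rw [show n + (i + 1) = n + i + 1 by ring]
  have hZ : Z = (n - i) * W / (n + 1) := by
    rw [eq_div_iff h1, ← c3]; ring
  have key : (X + W) * (2 * μ + (n + i + 1)) * (2 * μ + (n + i + 2))
      - 2 * (n + 1 + μ) * (W * (2 * μ + (n + i + 1)) + 2 * X * (μ + 1 / 2 + i))
      + (n + 2 * μ) * ((n - i) * W) = 0 := by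
    linear_combination (i - n : ℂ) * c1
  -- `M` is the common factor of all the coefficients; without it the recurrence becomes `key`,
  -- which follows from relations between neighbouring binomial coefficients.
  set M : ℂ := (-1) ^ (i + 1) * P / ((n + 1) * n.factorial * (D * (μ + 1 / 2 + i))) with hM
  have q1 : ((n : ℂ) + 2) * gegenbauerCoeff μ (n + 2) (i + 1)
      = M * ((X + W) * (2 * μ + (n + i + 1)) * (2 * μ + (n + i + 2))) := by
    simp only [gegenbauerCoeff, p1, c2, ascPochhammer_succ_eval (S := ℂ) i, hD,
      Nat.factorial_succ, Nat.cast_mul, Nat.cast_add, Nat.cast_one, hM]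
    field_simp
    ring
  have q2 : gegenbauerCoeff μ (n + 1) (i + 1) = M * (W * (2 * μ + (n + i + 1))) := by
    simp only [gegenbauerCoeff, p2, hW, ascPochhammer_succ_eval (S := ℂ) i, hD,
      Nat.factorial_succ, Nat.cast_mul, Nat.cast_add, Nat.cast_one, hM]
    field_simp
  have q3 : gegenbauerCoeff μ (n + 1) i = -M * (X * (μ + 1 / 2 + i)) := by
    simp only [gegenbauerCoeff, p3, hX, hD,
      Nat.factorial_succ, Nat.cast_mul, Nat.cast_add, Nat.cast_one, hM, pow_succ]
    generalize μ + 1 / 2 + (i : ℂ) = δ at hdi2 ⊢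
    field_simp
  have q4 : gegenbauerCoeff μ n (i + 1) = M * ((n - i) * W) := by
    simp only [gegenbauerCoeff, p4, hZ', hZ, ascPochhammer_succ_eval (S := ℂ) i, hD, hM]
    field_simp
  rw [q1, q2, q3, q4]
  linear_combination M * key

theorem gegenbauerC_recurrence {μ : ℂ} (hμ : -(1 / 2 : ℝ) < μ.re) (x : ℝ) (n : ℕ) :
    ((n : ℂ) + 2) * gegenbauerC (n + 2) μ x
      = 2 * (n + 1 + μ) * x * gegenbauerC (n + 1) μ x - (n + 2 * μ) * gegenbauerC n μ x := by
  set v : ℂ := (1 - (x : ℂ)) / 2 with hv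
  have hx : (x : ℂ) = 1 - 2 * v := by rw [hv]; ring
  have e1 : (x : ℂ) * gegenbauerC (n + 1) μ x = gegenbauerCoeff μ (n + 1) 0 +
      ∑ j ∈ Finset.range (n + 2), (gegenbauerCoeff μ (n + 1) (j + 1)
        - 2 * gegenbauerCoeff μ (n + 1) j) * v ^ (j + 1) := by
    -- Two truncations of one polynomial: the copy to be multiplied by v is one term shorter, so
    -- that both end at the power n + 2.
    have f1 := gegenbauerC_eq_sum μ x (show n + 1 < n + 3 by omega)
    have f2 := gegenbauerC_eq_sum μ x (show n + 1 < n + 2 by omega)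
    rw [Finset.sum_range_succ'] at f1
    have : (x : ℂ) * gegenbauerC (n + 1) μ x = gegenbauerC (n + 1) μ x
        - 2 * (v * gegenbauerC (n + 1) μ x) := by rw [hx]; ring
    rw [this]
    nth_rewrite 1 [f1]
    rw [f2, Finset.mul_sum, Finset.mul_sum, add_comm _ (gegenbauerCoeff μ (n + 1) 0 * _),
      add_sub_assoc, ← Finset.sum_sub_distrib]
    congr 1
    · simp
    · refine Finset.sum_congr rfl fun j _ => ?_
      ring
  rw [mul_assoc, e1, gegenbauerC_eq_sum μ x (show n + 2 < n + 3 by omega),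
    gegenbauerC_eq_sum μ x (show n < n + 3 by omega), Finset.sum_range_succ',
    Finset.sum_range_succ' (n := n + 2), ← hv]
  have h0 := gegenbauerCoeff_recurrence_zero μ n
  have h1 : ((n : ℂ) + 2) * ∑ j ∈ Finset.range (n + 2), gegenbauerCoeff μ (n + 2) (j + 1) * v ^ (j + 1)
      = 2 * (n + 1 + μ) * (∑ j ∈ Finset.range (n + 2), (gegenbauerCoeff μ (n + 1) (j + 1)
        - 2 * gegenbauerCoeff μ (n + 1) j) * v ^ (j + 1)) - (n + 2 * μ) *
        ∑ j ∈ Finset.range (n + 2), gegenbauerCoeff μ n (j + 1) * v ^ (j + 1) := by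
    rw [Finset.mul_sum, Finset.mul_sum, Finset.mul_sum, ← Finset.sum_sub_distrib]
    refine Finset.sum_congr rfl fun j _ => ?_
    have := gegenbauerCoeff_recurrence_succ hμ n j
    linear_combination v ^ (j + 1) * this
  simp only [pow_zero, mul_one]
  linear_combination h0 + h1

/-! ### Growth of the Gegenbauer polynomials by their generating function. -/

theorem unitDiscCoeff_ascPochhammer_div_factorial (μ w : ℂ) (hw : ‖w‖ = 1) :
    UnitDiscCoeff fun k => (ascPochhammer ℂ k).eval μ / k.factorial * w ^ k := by
  refine UnitDiscCoeff.of_one_step (ρ := fun k : ℕ => ‖(μ + k) / (1 + k)‖) ?_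
    (fun _ => norm_nonneg _) fun k => ?_
  · have : Tendsto (fun k : ℕ => (μ + k) / (1 + k)) atTop (𝓝 1) := by
      simpa using tendsto_add_mul_div_add_mul_atTop_nhds μ 1 (1 : ℂ) (one_ne_zero (α := ℂ))
    simpa using this.norm
  · rw [← norm_mul]
    apply le_of_eq
    have : (ascPochhammer ℂ (k + 1)).eval μ / (k + 1).factorial * w ^ (k + 1)
        = (μ + k) / (1 + k) * ((ascPochhammer ℂ k).eval μ / k.factorial * w ^ k) * w := by
      rw [ascPochhammer_succ_eval, Nat.factorial_succ]
      have h1 : (1 : ℂ) + k ≠ 0 := by rw [add_comm]; exact Nat.cast_add_one_ne_zero k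
      have h3 : (k.factorial : ℂ) ≠ 0 := Nat.cast_ne_zero.2 k.factorial_ne_zero
      push_cast
      rw [add_comm (k : ℂ) 1, pow_succ]
      field_simp
    rw [this, norm_mul, hw, mul_one]

section PowerSeries

open PowerSeries

/-- The binomial series `(1 - w X)^(-μ)`. -/
noncomputable def binomialPowerSeries (μ w : ℂ) : PowerSeries ℂ :=
  PowerSeries.mk fun k => (ascPochhammer ℂ k).eval μ / k.factorial * w ^ k

theorem derivative_binomialPowerSeries (μ w : ℂ) :
    (1 - C w * X) * PowerSeries.derivative ℂ (binomialPowerSeries μ w)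
      = C (μ * w) * binomialPowerSeries μ w := by
  ext k
  have h3 : (k.factorial : ℂ) ≠ 0 := Nat.cast_ne_zero.2 k.factorial_ne_zero
  have h1 : (k : ℂ) + 1 ≠ 0 := Nat.cast_add_one_ne_zero k
  rw [sub_mul, one_mul, map_sub, mul_assoc, coeff_C_mul, coeff_C_mul]
  rcases k with _ | k
  · simp [binomialPowerSeries, coeff_derivative]
  · have h3 : (k.factorial : ℂ) ≠ 0 := Nat.cast_ne_zero.2 k.factorial_ne_zero
    have h2 : (k : ℂ) + 1 ≠ 0 := Nat.cast_add_one_ne_zero k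
    rw [coeff_succ_X_mul]
    push_cast at h1
    simp only [binomialPowerSeries, coeff_derivative, coeff_mk, ascPochhammer_succ_eval,
      Nat.factorial_succ, Nat.cast_mul, Nat.cast_add, Nat.cast_one]
    field_simp
    ring

/-- The Gegenbauer polynomials are the coefficients of `((1 - w X) (1 - w⁻¹ X))^(-μ)`, where
`2 x = w + w⁻¹`. -/
theorem gegenbauerC_eq_coeff {μ : ℂ} (hμ : -(1 / 2 : ℝ) < μ.re) {x : ℝ} {w : ℂ} (hw : w ≠ 0)
    (hx : 2 * (x : ℂ) = w + w⁻¹) (n : ℕ) :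
    gegenbauerC n μ x = coeff n (binomialPowerSeries μ w * binomialPowerSeries μ w⁻¹) := by
  set A := binomialPowerSeries μ w with hA
  set B := binomialPowerSeries μ w⁻¹ with hB
  have hCw : C w * C w⁻¹ = (1 : PowerSeries ℂ) := by rw [← map_mul, mul_inv_cancel₀ hw, map_one]
  -- The first-order equations of the two factors combine to (1 - 2xX + X²)(AB)' = 2μ(x - X)AB,
  -- whose coefficients give the Gegenbauer recurrence.
  have hD : PowerSeries.derivative ℂ (A * B) - C (2 * (x : ℂ)) * (X * PowerSeries.derivative ℂ (A * B))
      + X * (X * PowerSeries.derivative ℂ (A * B))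
      = C (2 * μ * x) * (A * B) - C (2 * μ) * (X * (A * B)) := by
    have h1 := derivative_binomialPowerSeries μ w
    have h2 := derivative_binomialPowerSeries μ w⁻¹
    rw [← hA] at h1
    rw [← hB] at h2
    rw [map_mul] at h1 h2
    have h3 : C (2 * μ * x) = C μ * (C w + C w⁻¹ : PowerSeries ℂ) := by
      rw [← map_add, ← map_mul, ← hx]; congr 1; ring
    have h4 : C (2 * μ) = 2 * (C μ : PowerSeries ℂ) := by rw [two_mul, map_add, two_mul]
    rw [Derivation.leibniz, smul_eq_mul, smul_eq_mul, hx, h3, h4, map_add]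
    set A' := PowerSeries.derivative ℂ A
    set B' := PowerSeries.derivative ℂ B
    linear_combination (1 - C w⁻¹ * X) * B * h1 + (1 - C w * X) * A * h2
      + (-(X ^ 2 * (A * B' + B * A')) - 2 * C μ * X * A * B) * hCw
  have hrec : ∀ n : ℕ, ((n : ℂ) + 2) * coeff (n + 2) (A * B)
      = 2 * (n + 1 + μ) * x * coeff (n + 1) (A * B) - (n + 2 * μ) * coeff n (A * B) := by
    intro n
    have h := congrArg (coeff (n + 1)) hD
    rw [map_add, map_sub, map_sub, coeff_C_mul, coeff_C_mul, coeff_C_mul, coeff_succ_X_mul,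
      coeff_succ_X_mul, coeff_succ_X_mul, coeff_derivative] at h
    rcases n with _ | n
    · rw [coeff_zero_X_mul] at h
      simp only [coeff_derivative] at h
      push_cast at h ⊢
      linear_combination h
    · rw [coeff_succ_X_mul] at h
      simp only [coeff_derivative] at h
      push_cast at h ⊢
      linear_combination h
  have h0 : coeff 0 (A * B) = 1 := by
    simp [hA, hB, binomialPowerSeries]
  have h1 : coeff 1 (A * B) = 2 * μ * x := by
    have h := congrArg (coeff 0) hD
    rw [map_add, map_sub, map_sub, coeff_C_mul, coeff_C_mul, coeff_C_mul, coeff_zero_X_mul,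
      coeff_zero_X_mul, coeff_zero_X_mul, coeff_derivative, h0] at h
    simpa using h
  induction n using Nat.twoStepInduction with
  | zero => rw [gegenbauerC_zero, h0]
  | one => rw [gegenbauerC_one hμ, h1]
  | more n ih1 ih2 =>
    have h2 : (n : ℂ) + 2 ≠ 0 := by
      have := Nat.cast_add_one_ne_zero (R := ℂ) (n + 1)
      push_cast at this
      intro h
      apply this
      linear_combination h
    apply mul_left_cancel₀ h2
    rw [gegenbauerC_recurrence hμ, hrec, ih1, ih2]

/-- With w = exp(iγ) both factors of the generating function have coefficients of subexponential
growth, because |w| = 1; so has their Cauchy product. -/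
theorem unitDiscCoeff_gegenbauerC {μ : ℂ} (hμ : -(1 / 2 : ℝ) < μ.re) (γ : ℝ) :
    UnitDiscCoeff fun n => gegenbauerC n μ (Real.cos γ) := by
  set w : ℂ := Complex.exp (γ * Complex.I) with hw
  have hn : ‖w‖ = 1 := Complex.norm_exp_ofReal_mul_I γ
  have hx : 2 * ((Real.cos γ : ℝ) : ℂ) = w + w⁻¹ := by
    rw [Complex.ofReal_cos, Complex.two_cos, hw, ← Complex.exp_neg, neg_mul]
  have := (unitDiscCoeff_ascPochhammer_div_factorial μ w hn).cauchyProduct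
    (unitDiscCoeff_ascPochhammer_div_factorial μ w⁻¹ (by simp [hn]))
  convert this using 2 with n
  rw [gegenbauerC_eq_coeff hμ (Complex.exp_ne_zero _) hx, coeff_mul]
  simp only [binomialPowerSeries, coeff_mk, hw]

end PowerSeries

/-! ### Monomials in terms of Gegenbauer polynomials. -/

/-- The Gegenbauer polynomials with an integer index, zero for negative indices. -/
noncomputable def gegenbauerInt (μ : ℂ) (x : ℝ) (n : ℤ) : ℂ :=
  if n < 0 then 0 else gegenbauerC n.toNat μ x

theorem gegenbauerInt_natCast (μ : ℂ) (x : ℝ) (n : ℕ) :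
    gegenbauerInt μ x n = gegenbauerC n μ x := by
  simp [gegenbauerInt]

theorem gegenbauerInt_of_neg (μ : ℂ) (x : ℝ) {n : ℤ} (hn : n < 0) : gegenbauerInt μ x n = 0 := by
  simp [gegenbauerInt, hn]

/-- Extension by zero is consistent: at n = -1 the factor n + 1 removes the only nonzero polynomial,
and at n = 0 the lower neighbour is zero. -/
theorem gegenbauerInt_recurrence {μ : ℂ} (hμ : -(1 / 2 : ℝ) < μ.re) (x : ℝ) (n : ℤ) :
    2 * (n + μ) * x * gegenbauerInt μ x n
      = (n + 1) * gegenbauerInt μ x (n + 1) + (n + 2 * μ - 1) * gegenbauerInt μ x (n - 1) := by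
  rcases lt_or_ge n 0 with hn | hn
  · rw [gegenbauerInt_of_neg μ x hn, gegenbauerInt_of_neg μ x (show n - 1 < 0 by omega)]
    rcases eq_or_ne n (-1) with rfl | h
    · simp
    · rw [gegenbauerInt_of_neg μ x (show n + 1 < 0 by omega)]; simp
  · lift n to ℕ using hn
    rcases n with _ | n
    · rw [gegenbauerInt_of_neg μ x (show ((0 : ℕ) : ℤ) - 1 < 0 by simp)]
      have h := gegenbauerInt_natCast μ x 1
      have h' := gegenbauerInt_natCast μ x 0
      simp only [Nat.cast_one, Nat.cast_zero, gegenbauerC_one hμ, gegenbauerC_zero] at h h'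
      simp [h, h']
    · have e1 : ((n + 1 : ℕ) : ℤ) + 1 = ((n + 2 : ℕ) : ℤ) := by push_cast; ring
      have e2 : ((n + 1 : ℕ) : ℤ) - 1 = (n : ℤ) := by push_cast; ring
      rw [e1, e2, gegenbauerInt_natCast, gegenbauerInt_natCast, gegenbauerInt_natCast]
      have := gegenbauerC_recurrence hμ x n
      push_cast
      linear_combination -this

theorem Gamma_ne_zero_of_neg_half_lt_re {μ : ℂ} (hμ : -(1 / 2 : ℝ) < μ.re) (hμ0 : μ ≠ 0) :
    Complex.Gamma μ ≠ 0 := Complex.Gamma_ne_zero fun k hk => by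
  have h1 := congrArg Complex.re hk
  simp at h1
  rcases k with _ | k
  · exact hμ0 (by simpa using hk)
  · push_cast at h1
    have : (0 : ℝ) ≤ k := k.cast_nonneg
    linarith

/-- The expansion of a monomial in Gegenbauer polynomials. -/
theorem monomial_eq_sum_gegenbauer {μ : ℂ} (hμ : -(1 / 2 : ℝ) < μ.re) (hμ0 : μ ≠ 0) (x : ℝ)
    (m : ℕ) : (2 * (x : ℂ)) ^ m / m.factorial = Complex.Gamma μ * ∑ k ∈ Finset.range (m + 1),
      ((m - 2 * k : ℂ) + μ) / (k.factorial * Complex.Gamma (μ + m - k + 1))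
        * gegenbauerInt μ x (m - 2 * k) := by
  induction m with
  | zero =>
    have h := gegenbauerInt_natCast μ x 0
    rw [gegenbauerC_zero] at h
    have hG := Gamma_ne_zero_of_neg_half_lt_re hμ hμ0
    have h2 := Complex.Gamma_add_one μ hμ0
    simp at h
    simp [h, h2]
    field_simp
  | succ m ih =>
    set g := gegenbauerInt μ x with hg
    have h1 : (m : ℂ) + 1 ≠ 0 := Nat.cast_add_one_ne_zero m
    have hm : (2 * (x : ℂ)) ^ (m + 1) / (m + 1).factorial
        = 2 * x / (m + 1) * ((2 * (x : ℂ)) ^ m / m.factorial) := by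
      rw [Nat.factorial_succ, pow_succ]; push_cast; field_simp
    rw [hm, ih]
    have hterm : ∀ k : ℕ, 2 * (x : ℂ) * (((m - 2 * k : ℂ) + μ) /
        (k.factorial * Complex.Gamma (μ + m - k + 1)) * g (m - 2 * k))
        = (m - 2 * k + 1) / (k.factorial * Complex.Gamma (μ + m - k + 1)) * g (m + 1 - 2 * k)
        + (m - 2 * k + 2 * μ - 1) / (k.factorial * Complex.Gamma (μ + m - k + 1))
          * g (m + 1 - 2 * (k + 1)) := by
      intro k
      have := gegenbauerInt_recurrence hμ x (m - 2 * k)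
      rw [← hg, show (m : ℤ) - 2 * k + 1 = m + 1 - 2 * k by ring,
        show (m : ℤ) - 2 * k - 1 = m + 1 - 2 * (k + 1) by ring] at this
      push_cast at this
      linear_combination this / (k.factorial * Complex.Gamma (μ + m - k + 1))
    have hsum : 2 * (x : ℂ) * ∑ k ∈ Finset.range (m + 1), ((m - 2 * k : ℂ) + μ) /
        (k.factorial * Complex.Gamma (μ + m - k + 1)) * g (m - 2 * k)
        = ∑ k ∈ Finset.range (m + 2), ((m : ℂ) + 1) * (((m + 1 - 2 * k : ℂ) + μ) /
        (k.factorial * Complex.Gamma (μ + (m + 1) - k + 1)) * g (m + 1 - 2 * k)) := by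
      rw [Finset.mul_sum, Finset.sum_congr rfl fun k _ => hterm k, Finset.sum_add_distrib]
      -- Both sums are brought to the index m + 1 - 2k: the first gains the term k = m + 1, which is
      -- zero because its index is negative, and the second is shifted by one.
      have hlast : g (m + 1 - 2 * ((m + 1 : ℕ) : ℤ)) = 0 :=
        gegenbauerInt_of_neg μ x (by push_cast; omega)
      have hfirst : ∑ k ∈ Finset.range (m + 1), (m - 2 * k + 1 : ℂ) /
          (k.factorial * Complex.Gamma (μ + m - k + 1)) * g (m + 1 - 2 * k)
          = ∑ k ∈ Finset.range (m + 2), (m - 2 * k + 1 : ℂ) /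
          (k.factorial * Complex.Gamma (μ + m - k + 1)) * g (m + 1 - 2 * k) := by
        rw [Finset.sum_range_succ _ (m + 1), hlast, mul_zero, add_zero]
      rw [hfirst, Finset.sum_range_succ', Finset.sum_range_succ' _ (m + 1), add_right_comm,
        ← Finset.sum_add_distrib]
      congr 1
      · refine Finset.sum_congr rfl fun k _ => ?_
        have hG := inv_Gamma_eq_mul (μ + m - (k + 1) + 1)
        have e1 : μ + (m : ℂ) - (k + 1) + 1 + 1 = μ + m - k + 1 := by ring
        have e2 : μ + ((m : ℂ) + 1) - (k + 1) + 1 = μ + m - k + 1 := by ring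
        have h2 : (k : ℂ) + 1 ≠ 0 := Nat.cast_add_one_ne_zero k
        have h3 : (k.factorial : ℂ) ≠ 0 := Nat.cast_ne_zero.2 k.factorial_ne_zero
        push_cast [Nat.factorial_succ]
        rw [e2]
        rw [e1] at hG
        simp only [div_eq_mul_inv, mul_inv, hG]
        field_simp
        ring
      · have hG := inv_Gamma_eq_mul (μ + m + 1)
        have e2 : μ + ((m : ℂ) + 1) + 1 = μ + m + 1 + 1 := by ring
        simp only [Nat.cast_zero, mul_zero, sub_zero, Nat.factorial_zero, Nat.cast_one, one_mul, e2,
          div_eq_mul_inv, hG]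
        ring
    push_cast at hsum ⊢
    rw [← Finset.mul_sum] at hsum
    rw [div_mul_eq_mul_div, div_eq_iff h1]
    linear_combination Complex.Gamma μ * hsum

/-! ### Families of solutions of the Gegenbauer equation. -/

/-- A sequence of functions on the disc of radius `R` about `p` with `G_n' = -G_{n+1}`, where
`G_n` solves the Gegenbauer equation with parameter `μ + n`. -/
structure IsGegenbauerFamily (ν μ p : ℂ) (R : ℝ) (G : ℕ → ℂ → ℂ) : Prop where
  hasDerivAt : ∀ n, ∀ z ∈ Metric.ball p R, HasDerivAt (G n) (-G (n + 1) z) z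
  ode : ∀ n : ℕ, ∀ z ∈ Metric.ball p R, (1 - z ^ 2) * G (n + 2) z
    + 2 * (μ + n + 1) * z * G (n + 1) z + (ν - (μ + n)) * (ν + (μ + n) + 1) * G n z = 0

/-- The sequence `k! / Γ(μ + k + 1)`. -/
noncomputable def factorialDivGamma (μ : ℂ) (k : ℕ) : ℂ :=
  k.factorial / Complex.Gamma (μ + k + 1)

/-- Consecutive ratios tend to one. Up to a geometric factor, this sequence is what the Cauchy bound
(2k)! ≤ 4^k (k!)² for G_{2k} leaves after division by k! Γ(μ+k+1). -/
theorem unitDiscCoeff_factorialDivGamma {μ : ℂ} (hμ : -(1 / 2 : ℝ) < μ.re) :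
    UnitDiscCoeff (factorialDivGamma μ) := by
  refine UnitDiscCoeff.of_one_step (ρ := fun k : ℕ => ‖(1 + k) / (μ + 1 + k)‖) ?_
    (fun _ => norm_nonneg _) fun k => ?_
  · have : Tendsto (fun k : ℕ => (1 + k) / (μ + 1 + k)) atTop (𝓝 1) := by
      simpa using tendsto_add_mul_div_add_mul_atTop_nhds (1 : ℂ) (μ + 1) 1 (one_ne_zero (α := ℂ))
    simpa using this.norm
  · rw [← norm_mul]
    apply le_of_eq
    congr 1
    have h0 : μ + 1 + k ≠ 0 := fun h => by
      have h1 := congrArg Complex.re h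
      simp at h1
      have : (0 : ℝ) ≤ k := k.cast_nonneg
      linarith
    have hG := inv_Gamma_eq_mul (μ + 1 + k)
    simp only [factorialDivGamma, Nat.factorial_succ, div_eq_mul_inv]
    push_cast
    rw [show μ + (k + 1 : ℂ) + 1 = μ + 1 + k + 1 by ring, show μ + (k : ℂ) + 1 = μ + 1 + k by ring,
      hG]
    field_simp
    ring

namespace IsGegenbauerFamily

variable {ν μ p : ℂ} {R : ℝ} {G : ℕ → ℂ → ℂ}

/-- Dropping the first n members reduces a statement about G_n to one about G_0 with parameter μ +
n. -/
theorem shift (hG : IsGegenbauerFamily ν μ p R G) (n : ℕ) :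
    IsGegenbauerFamily ν (μ + n) p R fun k => G (n + k) where
  hasDerivAt k z hz := hG.hasDerivAt (n + k) z hz
  ode k z hz := by
    have := hG.ode (n + k) z hz
    push_cast at this
    rw [← add_assoc] at this
    exact this

/-- The equation is even, and the sign (-1)^n absorbs the sign of the chain rule. This serves the
functions of -cos Θ. -/
theorem reflect (hG : IsGegenbauerFamily ν μ p R G) :
    IsGegenbauerFamily ν μ (-p) R fun n z => (-1) ^ n * G n (-z) := by
  have hmem : ∀ z ∈ Metric.ball (-p) R, -z ∈ Metric.ball p R := fun z hz => by
    rw [Metric.mem_ball, dist_eq_norm] at hz ⊢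
    rwa [← norm_neg, show -(-z - p) = z - -p by ring]
  refine ⟨fun n z hz => ?_, fun n z hz => ?_⟩
  · have h := (hG.hasDerivAt n (-z) (hmem z hz)).scomp z (hasDerivAt_neg z)
    refine (h.const_mul ((-1) ^ n)).congr_deriv ?_
    simp [pow_succ]
  · have := hG.ode n (-z) (hmem z hz)
    simp only [pow_succ]
    linear_combination (-1) ^ n * this

theorem differentiableOn (hG : IsGegenbauerFamily ν μ p R G) (n : ℕ) :
    DifferentiableOn ℂ (G n) (Metric.ball p R) := fun z hz =>
  (hG.hasDerivAt n z hz).differentiableAt.differentiableWithinAt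

theorem iteratedDeriv_eq (hG : IsGegenbauerFamily ν μ p R G) (k : ℕ) :
    ∀ z ∈ Metric.ball p R, iteratedDeriv k (G 0) z = (-1) ^ k * G k z := by
  induction k with
  | zero => simp
  | succ k ih =>
    intro z hz
    rw [iteratedDeriv_succ]
    have h1 : iteratedDeriv k (G 0) =ᶠ[𝓝 z] fun z => (-1) ^ k * G k z := by
      filter_upwards [Metric.isOpen_ball.mem_nhds hz] with w hw using ih w hw
    rw [h1.deriv_eq, ((hG.hasDerivAt k z hz).const_mul _).deriv, pow_succ]
    ring

/-- Cauchy's estimates, locally uniformly. -/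
theorem norm_le (hG : IsGegenbauerFamily ν μ p R G) {z₁ : ℂ} {r : ℝ} (hr : 0 < r)
    (h : ‖z₁ - p‖ + r < R) : ∃ δ > 0, ∃ M, 0 ≤ M ∧ Metric.ball z₁ δ ⊆ Metric.ball p R ∧
      ∀ z ∈ Metric.ball z₁ δ, ∀ k, ‖G k z‖ ≤ k.factorial * M / r ^ k := by
  -- Half of the available room: circles of radius r about points of the ball of radius δ then lie
  -- in one compact ball inside the domain, so one bound M serves them all.
  set δ := (R - ‖z₁ - p‖ - r) / 2 with hδ
  have hδ0 : 0 < δ := by rw [hδ]; linarith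
  have hsub : Metric.closedBall z₁ (r + δ) ⊆ Metric.ball p R := fun z hz => by
    rw [Metric.mem_closedBall, dist_eq_norm] at hz
    rw [Metric.mem_ball, dist_eq_norm]
    have h2 : ‖z - p‖ ≤ ‖z - z₁‖ + ‖z₁ - p‖ := by
      have := norm_add_le (z - z₁) (z₁ - p)
      rwa [sub_add_sub_cancel] at this
    linarith
  have hbs : Metric.ball z₁ δ ⊆ Metric.ball p R :=
    (Metric.ball_subset_closedBall.trans (Metric.closedBall_subset_closedBall (by linarith))).trans
      hsub
  obtain ⟨M, hM⟩ := (isCompact_closedBall z₁ (r + δ)).exists_bound_of_continuousOn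
    ((hG.differentiableOn 0).continuousOn.mono hsub)
  have hM0 : 0 ≤ M := (norm_nonneg _).trans (hM z₁ (Metric.mem_closedBall_self (by linarith)))
  refine ⟨δ, hδ0, M, hM0, hbs, fun z hz k => ?_⟩
  have hcb : Metric.closedBall z r ⊆ Metric.closedBall z₁ (r + δ) := by
    apply Metric.closedBall_subset_closedBall'
    have := Metric.mem_ball.1 hz
    linarith
  have hd : DiffContOnCl ℂ (G 0) (Metric.ball z r) := by
    apply DifferentiableOn.diffContOnCl
    rw [closure_ball z hr.ne']
    exact (hG.differentiableOn 0).mono (hcb.trans hsub)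
  have h1 := Complex.norm_iteratedDeriv_le_of_forall_mem_sphere_norm_le k hr hd
    (fun w hw => hM w (hcb (Metric.sphere_subset_closedBall hw)))
  rw [hG.iteratedDeriv_eq k z (hbs hz)] at h1
  simpa using h1

end IsGegenbauerFamily

/-! ### The product formula. -/

/-- The terms of the series of the product formula. -/
noncomputable def productTerm (μ : ℂ) (G : ℕ → ℂ → ℂ) (y : ℂ) (k : ℕ) (w : ℂ) : ℂ :=
  (k.factorial * Complex.Gamma (μ + k + 1))⁻¹ *
    ((w * (1 - w) * (1 - y ^ 2)) ^ k * G (2 * k) ((1 - 2 * w) * y))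

/-- The domain on which the series of the product formula converges. -/
def productDomain (p : ℂ) (R : ℝ) (y : ℂ) : Set ℂ :=
  {w | ‖(1 - 2 * w) * y - p‖ + 2 * √‖w * (1 - w) * (1 - y ^ 2)‖ < R}

theorem isOpen_productDomain (p : ℂ) (R : ℝ) (y : ℂ) : IsOpen (productDomain p R y) :=
  isOpen_lt (by fun_prop) continuous_const

theorem factorial_two_mul_le (n k : ℕ) :
    ((n + 2 * k).factorial : ℝ) ≤ 2 ^ (n + 2 * k) * (k.factorial * (n + k).factorial) := by
  have h1 := Nat.add_choose_mul_factorial_mul_factorial k (n + k)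
  have h2 := Nat.choose_le_two_pow (k + (n + k)) (n + k)
  rw [show k + (n + k) = n + 2 * k by ring] at h1 h2
  rw [← h1, mul_assoc]
  push_cast
  gcongr
  exact_mod_cast h2

section Product

variable {ν μ p y : ℂ} {R : ℝ} {G : ℕ → ℂ → ℂ}

/-- Cauchy's estimate with radius r and (2k)! ≤ 4^k (k!)² compare the terms with powers of q =
4σ/r², where σ bounds |w(1-w)(1-y²)| near the point. The domain is exactly the condition that leaves
room for such an r with q < 1. -/
theorem productTerm_bound (hG : IsGegenbauerFamily ν μ p R G) {w₁ : ℂ}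
    (hw : w₁ ∈ productDomain p R y) : ∃ U : Set ℂ, IsOpen U ∧ w₁ ∈ U ∧
      (∀ w ∈ U, (1 - 2 * w) * y ∈ Metric.ball p R) ∧ ∃ M q : ℝ, 0 ≤ q ∧ q < 1 ∧
      ∀ k, ∀ w ∈ U, ‖productTerm μ G y k w‖ ≤ M * (‖factorialDivGamma μ k‖ * q ^ k) := by
  set z₁ := (1 - 2 * w₁) * y with hz₁
  set s₁ := ‖w₁ * (1 - w₁) * (1 - y ^ 2)‖ with hs₁
  have hw' : ‖z₁ - p‖ + 2 * √s₁ < R := hw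
  obtain ⟨r, hr1, hr2⟩ := exists_between (show 2 * √s₁ < R - ‖z₁ - p‖ by linarith)
  have hr0 : 0 < r := lt_of_le_of_lt (by positivity) hr1
  have hs : s₁ < r ^ 2 / 4 := by
    have h1 : √s₁ < r / 2 := by linarith
    rw [Real.sqrt_lt' (by linarith)] at h1
    linarith
  obtain ⟨σ, hσ1, hσ2⟩ := exists_between hs
  have hσ0 : 0 < σ := lt_of_le_of_lt (norm_nonneg _) hσ1
  obtain ⟨δ, hδ, M, hM0, hb, hM⟩ := hG.norm_le hr0 (show ‖z₁ - p‖ + r < R by linarith)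
  refine ⟨{w | ‖w * (1 - w) * (1 - y ^ 2)‖ < σ} ∩ {w | (1 - 2 * w) * y ∈ Metric.ball z₁ δ},
    (isOpen_lt (by fun_prop) continuous_const).inter
      (Metric.isOpen_ball.preimage (by fun_prop)), ⟨hσ1, Metric.mem_ball_self hδ⟩,
    fun w hw => hb hw.2, M, 4 * σ / r ^ 2, by positivity, ?_, fun k w hw => ?_⟩
  · rw [div_lt_one (by positivity)]; linarith
  · have h1 := hM _ hw.2 (2 * k)
    have h2 : ‖w * (1 - w) * (1 - y ^ 2)‖ ≤ σ := le_of_lt hw.1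
    have h3 := factorial_two_mul_le 0 k
    rw [zero_add, zero_add] at h3
    rw [productTerm, norm_mul, norm_mul, norm_inv, norm_mul, norm_pow, Complex.norm_natCast,
      factorialDivGamma, norm_div, Complex.norm_natCast]
    set g := ‖Complex.Gamma (μ + k + 1)‖ with hg
    have hg0 : 0 ≤ g := norm_nonneg _
    have hk : (0 : ℝ) < k.factorial := by exact_mod_cast k.factorial_pos
    calc (k.factorial * g)⁻¹ * (‖w * (1 - w) * (1 - y ^ 2)‖ ^ k * ‖G (2 * k) ((1 - 2 * w) * y)‖)
        ≤ (k.factorial * g)⁻¹ * (σ ^ k * ((2 ^ (2 * k) * (k.factorial * k.factorial)) * M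
            / r ^ (2 * k))) := by
          gcongr
          exact h1.trans (by gcongr)
      _ = M * (k.factorial / g * (4 * σ / r ^ 2) ^ k) := by
          rw [div_pow, mul_pow, pow_mul, pow_mul, mul_inv]
          field_simp
          norm_num
          ring

end Product

section Product

variable {ν μ p y : ℂ} {R : ℝ} {G : ℕ → ℂ → ℂ}

/-- The first derivative of `productTerm`. -/
noncomputable def productTermDeriv (μ : ℂ) (G : ℕ → ℂ → ℂ) (y : ℂ) (k : ℕ) (w : ℂ) : ℂ :=
  (k.factorial * Complex.Gamma (μ + k + 1))⁻¹ *
    (k * (w * (1 - w) * (1 - y ^ 2)) ^ (k - 1) * ((1 - 2 * w) * (1 - y ^ 2))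
        * G (2 * k) ((1 - 2 * w) * y)
      + (w * (1 - w) * (1 - y ^ 2)) ^ k * (2 * y * G (2 * k + 1) ((1 - 2 * w) * y)))

/-- The second derivative of `productTerm`. -/
noncomputable def productTermDeriv₂ (μ : ℂ) (G : ℕ → ℂ → ℂ) (y : ℂ) (k : ℕ) (w : ℂ) : ℂ :=
  (k.factorial * Complex.Gamma (μ + k + 1))⁻¹ *
    ((k * (((k - 1 : ℕ) : ℂ) * (w * (1 - w) * (1 - y ^ 2)) ^ (k - 1 - 1)
          * ((1 - 2 * w) * (1 - y ^ 2))) * ((1 - 2 * w) * (1 - y ^ 2))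
        + k * (w * (1 - w) * (1 - y ^ 2)) ^ (k - 1) * (-2 * (1 - y ^ 2)))
        * G (2 * k) ((1 - 2 * w) * y)
      + k * (w * (1 - w) * (1 - y ^ 2)) ^ (k - 1) * ((1 - 2 * w) * (1 - y ^ 2))
        * (2 * y * G (2 * k + 1) ((1 - 2 * w) * y))
      + (k * (w * (1 - w) * (1 - y ^ 2)) ^ (k - 1) * ((1 - 2 * w) * (1 - y ^ 2))
          * (2 * y * G (2 * k + 1) ((1 - 2 * w) * y))
        + (w * (1 - w) * (1 - y ^ 2)) ^ k
          * (2 * y * (2 * y * G (2 * k + 2) ((1 - 2 * w) * y)))))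

theorem IsGegenbauerFamily.hasDerivAt_comp (hG : IsGegenbauerFamily ν μ p R G) {w : ℂ}
    (hw : (1 - 2 * w) * y ∈ Metric.ball p R) (j : ℕ) :
    HasDerivAt (fun w => G j ((1 - 2 * w) * y)) (2 * y * G (j + 1) ((1 - 2 * w) * y)) w := by
  have h1 : HasDerivAt (fun w : ℂ => (1 - 2 * w) * y) (-2 * y) w := by
    simpa using ((((hasDerivAt_id w).const_mul 2).const_sub 1).mul_const y)
  refine ((hG.hasDerivAt j _ hw).scomp w h1).congr_deriv ?_
  simp only [smul_eq_mul]
  ring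

theorem hasDerivAt_productBase (y w : ℂ) : HasDerivAt (fun w : ℂ => w * (1 - w) * (1 - y ^ 2))
    ((1 - 2 * w) * (1 - y ^ 2)) w := by
  refine ((((hasDerivAt_id w).mul ((hasDerivAt_id w).const_sub 1)).mul_const
    (1 - y ^ 2))).congr_deriv ?_
  simp only [id]
  ring

theorem hasDerivAt_productTerm (hG : IsGegenbauerFamily ν μ p R G) {w : ℂ}
    (hw : (1 - 2 * w) * y ∈ Metric.ball p R) (k : ℕ) :
    HasDerivAt (productTerm μ G y k) (productTermDeriv μ G y k w) w :=
  ((((hasDerivAt_productBase y w).fun_pow k).fun_mul (hG.hasDerivAt_comp hw (2 * k))).const_mul _)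

theorem hasDerivAt_productTermDeriv (hG : IsGegenbauerFamily ν μ p R G) {w : ℂ}
    (hw : (1 - 2 * w) * y ∈ Metric.ball p R) (k : ℕ) :
    HasDerivAt (productTermDeriv μ G y k) (productTermDeriv₂ μ G y k w) w := by
  have hs := hasDerivAt_productBase y w
  have hl : HasDerivAt (fun w : ℂ => (1 - 2 * w) * (1 - y ^ 2)) (-2 * (1 - y ^ 2)) w := by
    simpa using ((((hasDerivAt_id w).const_mul 2).const_sub 1).mul_const (1 - y ^ 2))
  have h1 := ((((hs.fun_pow (k - 1)).const_mul (k : ℂ)).fun_mul hl).fun_mul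
    (hG.hasDerivAt_comp hw (2 * k)))
  have h2 := (hs.fun_pow k).fun_mul ((hG.hasDerivAt_comp hw (2 * k + 1)).const_mul (2 * y))
  exact (h1.fun_add h2).const_mul _

/-- The telescoping remainder of the product formula. -/
noncomputable def productRemainder (μ : ℂ) (G : ℕ → ℂ → ℂ) (y : ℂ) (k : ℕ) (w : ℂ) : ℂ :=
  (k.factorial * Complex.Gamma (μ + k + 1))⁻¹ *
    ((w * (1 - w) * (1 - y ^ 2)) ^ k * ((1 - y ^ 2) * G (2 * k + 2) ((1 - 2 * w) * y)))

theorem inv_factorial_mul_Gamma (μ : ℂ) (k : ℕ) :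
    ((k.factorial : ℂ) * Complex.Gamma (μ + k + 1))⁻¹
      = (k + 1) * (μ + k + 1) * (((k + 1).factorial : ℂ) * Complex.Gamma (μ + (k + 1 : ℕ) + 1))⁻¹ := by
  have h1 : (k : ℂ) + 1 ≠ 0 := Nat.cast_add_one_ne_zero k
  have h3 : (k.factorial : ℂ) ≠ 0 := Nat.cast_ne_zero.2 k.factorial_ne_zero
  push_cast [Nat.factorial_succ]
  rw [mul_inv, inv_Gamma_eq_mul, mul_inv, mul_inv, ← add_assoc μ]
  field_simp

theorem productTerm_ode_zero (hG : IsGegenbauerFamily ν μ p R G) {w : ℂ}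
    (hw : (1 - 2 * w) * y ∈ Metric.ball p R) :
    w * (1 - w) * productTermDeriv₂ μ G y 0 w + (μ + 1) * (1 - 2 * w) * productTermDeriv μ G y 0 w
      + (ν - μ) * (ν + μ + 1) * productTerm μ G y 0 w = -productRemainder μ G y 0 w := by
  have h := hG.ode 0 _ hw
  simp only [productTermDeriv₂, productTermDeriv, productTerm, productRemainder, Nat.cast_zero,
    mul_zero, zero_mul, zero_add, pow_zero, one_mul, add_zero] at h ⊢
  linear_combination ((Nat.factorial 0 : ℂ) * Complex.Gamma (μ + 1))⁻¹ * h

/-- The Gegenbauer equation of G_{2k+2} eliminates G_{2k+4}; what remains involves G_{2k+2} and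
G_{2k+4} only through two consecutive remainders. Partial sums therefore telescope to minus the last
remainder. -/
theorem productTerm_ode_succ (hG : IsGegenbauerFamily ν μ p R G) {w : ℂ}
    (hw : (1 - 2 * w) * y ∈ Metric.ball p R) (k : ℕ) :
    w * (1 - w) * productTermDeriv₂ μ G y (k + 1) w
      + (μ + 1) * (1 - 2 * w) * productTermDeriv μ G y (k + 1) w
      + (ν - μ) * (ν + μ + 1) * productTerm μ G y (k + 1) w
      = productRemainder μ G y k w - productRemainder μ G y (k + 1) w := by
  have h := hG.ode (2 * (k + 1)) _ hw
  simp only [productTermDeriv₂, productTermDeriv, productTerm, productRemainder, inv_factorial_mul_Gamma μ k]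
  set c := (((k + 1).factorial : ℂ) * Complex.Gamma (μ + (k + 1 : ℕ) + 1))⁻¹
  rw [show 2 * (k + 1) = 2 * k + 2 by ring] at h ⊢
  set g₀ := G (2 * k + 2) ((1 - 2 * w) * y)
  set g₁ := G (2 * k + 2 + 1) ((1 - 2 * w) * y)
  set g₂ := G (2 * k + 2 + 2) ((1 - 2 * w) * y)
  -- For k = 0 the exponent k - 1 is truncated to 0, and the factor k makes the identity true all
  -- the same.
  have hs : (k : ℂ) * (w * (1 - w) * (1 - y ^ 2)) ^ (k - 1) * (w * (1 - w) * (1 - y ^ 2))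
      = k * (w * (1 - w) * (1 - y ^ 2)) ^ k := by
    rcases k with _ | k
    · simp
    · rw [Nat.add_sub_cancel, pow_succ]; ring
  simp only [Nat.add_sub_cancel, pow_succ (w * (1 - w) * (1 - y ^ 2)) k]
  push_cast at h ⊢
  set S := (w * (1 - w) * (1 - y ^ 2)) ^ k
  linear_combination c * S * (w * (1 - w) * (1 - y ^ 2)) * h
    + c * (k + 1) * (1 - 2 * w) ^ 2 * (1 - y ^ 2) * g₀ * hs

/-- Up to a factor quadratic in k the remainder is the next term divided by w(1 - w), so the bound
on the terms makes it tend to zero. -/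
theorem productRemainder_mul (k : ℕ) (w : ℂ) :
    productRemainder μ G y k w * (w * (1 - w))
      = (k + 1) * (μ + k + 1) * productTerm μ G y (k + 1) w := by
  rw [productRemainder, productTerm, inv_factorial_mul_Gamma, show 2 * (k + 1) = 2 * k + 2 by ring]
  ring

end Product

section Product

variable {ν μ p y : ℂ} {R : ℝ} {G : ℕ → ℂ → ℂ}

/-- The sum of the series of the product formula is analytic and solves a hypergeometric
equation. -/
theorem tsum_productTerm_ode (hμ : -(1 / 2 : ℝ) < μ.re) (hG : IsGegenbauerFamily ν μ p R G)
    {w₁ : ℂ} (hw : w₁ ∈ productDomain p R y) :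
    AnalyticAt ℂ (fun w => ∑' k, productTerm μ G y k w) w₁ ∧
    (w₁ ≠ 1 →
      w₁ * (1 - w₁) * deriv (deriv fun w => ∑' k, productTerm μ G y k w) w₁
      + (μ + 1) * (1 - 2 * w₁) * deriv (fun w => ∑' k, productTerm μ G y k w) w₁
      + (ν - μ) * (ν + μ + 1) * ∑' k, productTerm μ G y k w₁ = 0) := by
  obtain ⟨U, hU, hwU, hball, M, q, hq0, hq1, hb⟩ := productTerm_bound hG hw
  set T : ℂ → ℂ := fun w => ∑' k, productTerm μ G y k w with hT
  have hu : Summable fun k => M * (‖factorialDivGamma μ k‖ * q ^ k) :=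
    (unitDiscCoeff_factorialDivGamma hμ q hq0 hq1).mul_left M
  have hd : ∀ k, DifferentiableOn ℂ (productTerm μ G y k) U := fun k w hw =>
    (hasDerivAt_productTerm hG (hball w hw) k).differentiableAt.differentiableWithinAt
  have hTd : DifferentiableOn ℂ T U :=
    Complex.differentiableOn_tsum_of_summable_norm hu hd hU hb
  refine ⟨(hTd.analyticOnNhd hU) w₁ hwU, fun hw1 => ?_⟩
  let S : ℕ → ℂ → ℂ := fun N w => ∑ k ∈ Finset.range N, productTerm μ G y k w
  have hS1 : ∀ N, ∀ w ∈ U,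
      HasDerivAt (S N) (∑ k ∈ Finset.range N, productTermDeriv μ G y k w) w :=
    fun N w hw => HasDerivAt.fun_sum fun k _ => hasDerivAt_productTerm hG (hball w hw) k
  have hS2 : ∀ N, ∀ w ∈ U, HasDerivAt (fun w => ∑ k ∈ Finset.range N, productTermDeriv μ G y k w)
      (∑ k ∈ Finset.range N, productTermDeriv₂ μ G y k w) w :=
    fun N w hw => HasDerivAt.fun_sum fun k _ => hasDerivAt_productTermDeriv hG (hball w hw) k
  have hd1 : ∀ N, ∀ w ∈ U, deriv (S N) w = ∑ k ∈ Finset.range N, productTermDeriv μ G y k w :=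
    fun N w hw => (hS1 N w hw).deriv
  have hd2 : ∀ N, ∀ w ∈ U,
      deriv (deriv (S N)) w = ∑ k ∈ Finset.range N, productTermDeriv₂ μ G y k w := by
    intro N w hw
    have : deriv (S N) =ᶠ[𝓝 w] fun w => ∑ k ∈ Finset.range N, productTermDeriv μ G y k w := by
      filter_upwards [hU.mem_nhds hw] with v hv using hd1 N v hv
    rw [this.deriv_eq, (hS2 N w hw).deriv]
  have hdS : ∀ N, DifferentiableOn ℂ (S N) U := fun N w hw =>
    (hS1 N w hw).differentiableAt.differentiableWithinAt
  have hlim : TendstoLocallyUniformlyOn S T atTop U :=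
    (tendstoUniformlyOn_tsum_nat hu hb).tendstoLocallyUniformlyOn
  -- Locally uniform limits of holomorphic functions may be differentiated, so the telescoped
  -- equation of the partial sums passes to the limit.
  have hlim1 : TendstoLocallyUniformlyOn (deriv ∘ S) (deriv T) atTop U :=
    hlim.deriv (Eventually.of_forall hdS) hU
  have hlim2 : TendstoLocallyUniformlyOn (deriv ∘ deriv ∘ S) (deriv (deriv T)) atTop U :=
    hlim1.deriv (Eventually.of_forall fun N => (hdS N).deriv hU) hU
  have t0 : Tendsto (fun N => S N w₁) atTop (𝓝 (T w₁)) := hlim.tendsto_at hwU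
  have t1 : Tendsto (fun N => deriv (S N) w₁) atTop (𝓝 (deriv T w₁)) := hlim1.tendsto_at hwU
  have t2 : Tendsto (fun N => deriv (deriv (S N)) w₁) atTop (𝓝 (deriv (deriv T) w₁)) :=
    hlim2.tendsto_at hwU
  have tsum := ((t2.const_mul (w₁ * (1 - w₁))).add (t1.const_mul ((μ + 1) * (1 - 2 * w₁)))).add
    (t0.const_mul ((ν - μ) * (ν + μ + 1)))
  have tele : ∀ N, w₁ * (1 - w₁) * deriv (deriv (S (N + 1))) w₁
      + (μ + 1) * (1 - 2 * w₁) * deriv (S (N + 1)) w₁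
      + (ν - μ) * (ν + μ + 1) * S (N + 1) w₁ = -productRemainder μ G y N w₁ := by
    intro N
    rw [hd1 _ _ hwU, hd2 _ _ hwU]
    induction N with
    | zero => simpa [S] using productTerm_ode_zero hG (hball _ hwU)
    | succ N ih =>
      have := productTerm_ode_succ hG (hball _ hwU) N
      simp only [S] at ih ⊢
      rw [Finset.sum_range_succ _ (N + 1), Finset.sum_range_succ _ (N + 1),
        Finset.sum_range_succ _ (N + 1)]
      linear_combination ih + this
  -- At w₁ = 0 the factor 0^N removes the remainder for N ≠ 0. Elsewhere w₁(1 - w₁) is nonzero, the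
  -- point 1 being excluded, and can be divided out.
  have hrem : Tendsto (fun N => productRemainder μ G y N w₁) atTop (𝓝 0) := by
    rcases eq_or_ne w₁ 0 with h0 | h0
    · refine tendsto_const_nhds.congr' ?_
      filter_upwards [eventually_ne_atTop 0] with N hN
      simp [productRemainder, h0, hN]
    · have hne : w₁ * (1 - w₁) ≠ 0 := mul_ne_zero h0 (sub_ne_zero.2 hw1.symm)
      have hβ := ((unitDiscCoeff_factorialDivGamma hμ).natCast_mul.natCast_mul.add
        ((unitDiscCoeff_factorialDivGamma hμ).natCast_mul.const_mul μ))
      have hz := (tendsto_add_atTop_iff_nat 1).2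
        ((hβ q hq0 hq1).tendsto_atTop_zero.const_mul M)
      rw [mul_zero] at hz
      have hprod : Tendsto (fun N => productRemainder μ G y N w₁ * (w₁ * (1 - w₁))) atTop (𝓝 0) := by
        refine squeeze_zero_norm (fun N => ?_) hz
        rw [productRemainder_mul, norm_mul]
        have e : ((N + 1 : ℕ) : ℂ) * (((N + 1 : ℕ) : ℂ) * factorialDivGamma μ (N + 1))
            + μ * (((N + 1 : ℕ) : ℂ) * factorialDivGamma μ (N + 1))
            = (N + 1) * (μ + N + 1) * factorialDivGamma μ (N + 1) := by push_cast; ring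
        beta_reduce
        rw [e, norm_mul _ (factorialDivGamma μ (N + 1))]
        calc _ ≤ ‖((N : ℂ) + 1) * (μ + N + 1)‖ * (M * (‖factorialDivGamma μ (N + 1)‖ * q ^ (N + 1))) :=
              mul_le_mul_of_nonneg_left (hb (N + 1) w₁ hwU) (norm_nonneg _)
          _ = _ := by ring
      have := hprod.mul_const (w₁ * (1 - w₁))⁻¹
      rw [zero_mul] at this
      refine this.congr fun N => ?_
      rw [mul_assoc, mul_inv_cancel₀ hne, mul_one]
  have hneg := hrem.neg
  rw [neg_zero] at hneg
  exact tendsto_nhds_unique ((tendsto_add_atTop_iff_nat 1).2 tsum)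
    (hneg.congr fun N => (tele N).symm)

/-- The product formula for solutions of the Gegenbauer equation. -/
theorem tsum_productTerm_eq (hμ : -(1 / 2 : ℝ) < μ.re) (hG : IsGegenbauerFamily ν μ p R G)
    {w₁ : ℂ} (hseg : segment ℝ 0 w₁ ⊆ productDomain p R y ∩ Metric.ball 0 1) :
    ∑' k, productTerm μ G y k w₁
      = G 0 y * Complex.regularizedGaussHGFun (μ - ν) (ν + μ + 1) (μ + 1) w₁ := by
  set T : ℂ → ℂ := fun w => ∑' k, productTerm μ G y k w with hT
  set r := gaussCoeff (μ - ν) (ν + μ + 1) (μ + 1) with hr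
  have hrd : UnitDiscCoeff r := unitDiscCoeff_gaussCoeff _ _ _
  set V := productDomain p R y ∩ Metric.ball (0 : ℂ) 1 with hV
  have hVo : IsOpen V := (isOpen_productDomain p R y).inter Metric.isOpen_ball
  have h0V : (0 : ℂ) ∈ V := hseg (left_mem_segment ℝ 0 w₁)
  have hTa : AnalyticOnNhd ℂ T V := fun w hw => (tsum_productTerm_ode hμ hG hw.1).1
  have hFa : AnalyticOnNhd ℂ (fun w => G 0 y * powerSum r w) V := fun w hw =>
    analyticAt_const.mul ((hrd.differentiableOn_powerSum.analyticOnNhd Metric.isOpen_ball) w hw.2)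
  have hc : ∀ k : ℕ, μ + 1 ≠ -k := fun k hk => by
    have h1 := congrArg Complex.re hk
    simp at h1
    have : (0 : ℝ) ≤ k := k.cast_nonneg
    linarith
  have hev : ∀ᶠ w in 𝓝 0, w ∈ V := hVo.mem_nhds h0V
  have hloc : ∀ᶠ w in 𝓝 0, T w - G 0 y * powerSum r w = 0 := by
    refine eventually_eq_zero_of_hypergeometricODE (a := μ - ν) (b := ν + μ + 1) hc
      (hev.mono fun w hw => (hTa w hw).differentiableAt.hasDerivAt.fun_sub
        ((hrd.hasDerivAt_powerSum (mem_ball_zero_iff.1 hw.2)).const_mul (G 0 y)))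
      (hev.mono fun w hw => (hTa w hw).deriv.differentiableAt.hasDerivAt.fun_sub
        ((hrd.derivCoeff.hasDerivAt_powerSum (mem_ball_zero_iff.1 hw.2)).const_mul (G 0 y)))
      (hev.mono fun w hw => ?_) ?_
    · have h1 := hypergeometricODE_powerSum hrd (gaussCoeff_succ _ _ _) (mem_ball_zero_iff.1 hw.2)
      have h2 := (tsum_productTerm_ode hμ hG hw.1).2 (by
        rintro rfl
        have := mem_ball_zero_iff.1 hw.2
        simp at this)
      rw [← hT] at h2
      linear_combination h2 - G 0 y * h1
    -- At w = 0 only the term k = 0 survives, which fixes the multiple of the hypergeometric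
    -- function.
    · have : T 0 = (Complex.Gamma (μ + 1))⁻¹ * G 0 y := by
        simp only [hT]
        rw [tsum_eq_single 0 fun k hk => by simp [productTerm, hk]]
        simp [productTerm]
      rw [this, powerSum_zero_right, hr, gaussCoeff]
      simp
      ring
  -- The segment puts w₁ in the connected component of 0, so the identity theorem applies without
  -- connectedness of the whole domain.
  have hpre := (convex_segment (𝕜 := ℝ) (0 : ℂ) w₁).isPreconnected.subset_connectedComponentIn
    (left_mem_segment ℝ 0 w₁) hseg
  have hsub := connectedComponentIn_subset V (0 : ℂ)
  have := (hTa.mono hsub).eqOn_of_preconnected_of_eventuallyEq (hFa.mono hsub)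
    isPreconnected_connectedComponentIn (mem_connectedComponentIn h0V)
    (hloc.mono fun w hw => sub_eq_zero.1 hw) (hpre (right_mem_segment ℝ 0 w₁))
  rw [← powerSum_gaussCoeff]
  exact this

end Product

/-! ### The addition theorem for a Gegenbauer family. -/

section Expansion

variable {ν μ p : ℂ} {R : ℝ} {G : ℕ → ℂ → ℂ}

theorem factorialDivGamma_add (μ : ℂ) (n k : ℕ) :
    ((k.factorial : ℂ) * Complex.Gamma (μ + n + k + 1))⁻¹
      = factorialDivGamma μ (n + k) / (k.factorial * (n + k).factorial) := by
  have h1 : ((n + k).factorial : ℂ) ≠ 0 := Nat.cast_ne_zero.2 (n + k).factorial_ne_zero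
  rw [factorialDivGamma]
  push_cast
  rw [← add_assoc, mul_inv]
  field_simp

/-- The terms of the double series behind the Gegenbauer expansion. -/
noncomputable def doubleTerm (μ : ℂ) (G : ℕ → ℂ → ℂ) (γ : ℝ) (z s : ℂ) (n k : ℕ) : ℂ :=
  ((n : ℂ) + μ) * gegenbauerC n μ (Real.cos γ) *
    ((k.factorial * Complex.Gamma (μ + n + k + 1))⁻¹ * ((-s) ^ (n + 2 * k) * G (n + 2 * k) z))

theorem summable_doubleTerm (hμ : -(1 / 2 : ℝ) < μ.re) (hG : IsGegenbauerFamily ν μ p R G)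
    (γ : ℝ) {z s : ℂ} (hz : ‖z - p‖ + 2 * ‖s‖ < R) :
    Summable fun nk : ℕ × ℕ => doubleTerm μ G γ z s nk.1 nk.2 := by
  obtain ⟨ρ, hρ1, hρ2⟩ := exists_between (show 2 * ‖s‖ < R - ‖z - p‖ by linarith)
  have hρ0 : 0 < ρ := lt_of_le_of_lt (by positivity) hρ1
  obtain ⟨δ, hδ, M, hM0, -, hM⟩ := hG.norm_le hρ0 (show ‖z - p‖ + ρ < R by linarith)
  have hM := hM z (Metric.mem_ball_self hδ)
  set q := 2 * ‖s‖ / ρ with hq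
  have hq0 : 0 ≤ q := by positivity
  have hq1 : q < 1 := (div_lt_one hρ0).2 hρ1
  set τ := √q with hτ
  have hτ0 : 0 ≤ τ := Real.sqrt_nonneg q
  have hτ1 : τ < 1 := by rw [hτ, Real.sqrt_lt' one_pos]; simpa using hq1
  have hτq : τ ^ 2 = q := Real.sq_sqrt hq0
  obtain ⟨B, hB0, hB⟩ := (unitDiscCoeff_factorialDivGamma hμ).bounded hτ0 hτ1
  have hC : UnitDiscCoeff fun n => ((n : ℂ) + μ) * gegenbauerC n μ (Real.cos γ) :=
    (UnitDiscCoeff.natCast.add (UnitDiscCoeff.const μ)).mul (unitDiscCoeff_gegenbauerC hμ γ)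
  have hsum : Summable fun nk : ℕ × ℕ => M * B *
      ((‖((nk.1 : ℂ) + μ) * gegenbauerC nk.1 μ (Real.cos γ)‖ * τ ^ nk.1) * τ ^ nk.2) :=
    ((hC τ hτ0 hτ1).mul_of_nonneg (summable_geometric_of_lt_one hτ0 hτ1)
      (fun n => by positivity) (fun n => by positivity)).mul_left _
  refine Summable.of_norm_bounded hsum fun nk => ?_
  obtain ⟨n, k⟩ := nk
  simp only [doubleTerm]
  rw [norm_mul]
  set c := ‖((n : ℂ) + μ) * gegenbauerC n μ (Real.cos γ)‖
  have key : ‖((k.factorial : ℂ) * Complex.Gamma (μ + n + k + 1))⁻¹ *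
      ((-s) ^ (n + 2 * k) * G (n + 2 * k) z)‖ ≤ M * (‖factorialDivGamma μ (n + k)‖ * q ^ (n + 2 * k)) := by
    rw [factorialDivGamma_add, norm_mul, norm_div, norm_mul, norm_mul, norm_pow, norm_neg,
      Complex.norm_natCast, Complex.norm_natCast]
    have h1 := hM (n + 2 * k)
    have h2 := factorial_two_mul_le n k
    have hk : (0 : ℝ) < k.factorial := by exact_mod_cast k.factorial_pos
    have hnk : (0 : ℝ) < (n + k).factorial := by exact_mod_cast (n + k).factorial_pos
    calc _ ≤ ‖factorialDivGamma μ (n + k)‖ / (k.factorial * (n + k).factorial) *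
          (‖s‖ ^ (n + 2 * k) * ((2 ^ (n + 2 * k) * (k.factorial * (n + k).factorial)) * M
            / ρ ^ (n + 2 * k))) := by
          gcongr
          exact h1.trans (by gcongr)
      _ = _ := by
          rw [hq, div_pow, mul_pow]
          field_simp
  -- Since q = τ², a power τ^(2n+4k) is available: τ^(n+k) pays for the gamma quotient, τ^n for the
  -- Gegenbauer polynomials and τ^k for the sum over k.
  have hpow : q ^ (n + 2 * k) ≤ τ ^ (n + k) * (τ ^ n * τ ^ k) := by
    rw [← hτq, ← pow_mul, ← pow_add, ← pow_add]
    exact pow_le_pow_of_le_one hτ0 hτ1.le (by omega)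
  calc _ ≤ c * (M * (‖factorialDivGamma μ (n + k)‖ * (τ ^ (n + k) * (τ ^ n * τ ^ k)))) := by
        gcongr
        exact key.trans (by gcongr)
    _ = c * M * (τ ^ n * τ ^ k) * (‖factorialDivGamma μ (n + k)‖ * τ ^ (n + k)) := by ring
    _ ≤ c * M * (τ ^ n * τ ^ k) * B := by
        gcongr
        exact hB _
    _ = _ := by ring

/-- Summing along m = n + 2k instead of n reassembles (2 cos γ)^m / m!, and the sum over m is the
Taylor series of G_0 about z with increment 2 s cos γ. -/
theorem tsum_doubleTerm (hμ : -(1 / 2 : ℝ) < μ.re) (hμ0 : μ ≠ 0)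
    (hG : IsGegenbauerFamily ν μ p R G) (γ : ℝ) {z s : ℂ} (hz : ‖z - p‖ + 2 * ‖s‖ < R) :
    Complex.Gamma μ * ∑' nk : ℕ × ℕ, doubleTerm μ G γ z s nk.1 nk.2
      = G 0 (z + 2 * s * Real.cos γ) := by
  set F : ℕ × ℕ → ℂ := fun mk => (((mk.1 : ℂ) - 2 * mk.2) + μ) /
    (mk.2.factorial * Complex.Gamma (μ + mk.1 - mk.2 + 1)) *
      gegenbauerInt μ (Real.cos γ) (mk.1 - 2 * mk.2) * ((-s) ^ mk.1 * G mk.1 z) with hF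
  let i : ℕ × ℕ → ℕ × ℕ := fun nk => (nk.1 + 2 * nk.2, nk.2)
  have hi : Function.Injective i := fun a b h => by
    simp only [i, Prod.mk.injEq] at h
    ext <;> omega
  -- Pairs (m, k) that are not of the form (n + 2k, k) carry a Gegenbauer polynomial of negative
  -- index.
  have hsupp : ∀ mk ∉ Set.range i, F mk = 0 := by
    rintro ⟨m, k⟩ hmk
    have : (m : ℤ) - 2 * k < 0 := by
      by_contra hlt
      exact hmk ⟨(m - 2 * k, k), Prod.ext (by dsimp only [i]; omega) rfl⟩
    simp [hF, gegenbauerInt_of_neg μ _ this]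
  have hFi : F ∘ i = fun nk => doubleTerm μ G γ z s nk.1 nk.2 := by
    funext ⟨n, k⟩
    simp only [hF, i, Function.comp_apply, doubleTerm]
    push_cast
    rw [show (n : ℤ) + 2 * k - 2 * k = n by ring, gegenbauerInt_natCast,
      show (n : ℂ) + 2 * k - 2 * k = n by ring,
      show μ + ((n : ℂ) + 2 * k) - k + 1 = μ + n + k + 1 by ring]
    ring
  have hsum := summable_doubleTerm hμ hG γ hz
  have hsF : Summable F := (hi.summable_iff hsupp).1 (by rw [hFi]; exact hsum)
  have htF : ∑' nk : ℕ × ℕ, doubleTerm μ G γ z s nk.1 nk.2 = ∑' mk, F mk := by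
    rw [← hFi]
    exact hi.tsum_eq (f := F) fun mk hmk => by
      by_contra h
      exact hmk (hsupp mk h)
  rw [htF, hsF.tsum_prod, ← tsum_mul_left]
  have hinner : ∀ m : ℕ, Complex.Gamma μ * ∑' k, F (m, k)
      = (2 * (Real.cos γ : ℂ)) ^ m / m.factorial * ((-s) ^ m * G m z) := by
    intro m
    rw [tsum_eq_sum (s := Finset.range (m + 1)), monomial_eq_sum_gegenbauer hμ hμ0, mul_assoc,
      Finset.sum_mul]
    intro k hk
    have : (m : ℤ) - 2 * k < 0 := by
      have := Finset.mem_range.not.1 hk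
      omega
    simp [hF, gegenbauerInt_of_neg μ _ this]
  have hsub : Metric.ball z (R - ‖z - p‖) ⊆ Metric.ball p R := by
    apply Metric.ball_subset_ball'
    rw [dist_eq_norm]
    linarith
  have hr : 0 < R - ‖z - p‖ := by
    have := norm_nonneg s
    linarith
  have hmem : z + 2 * s * Real.cos γ ∈ Metric.ball z (R - ‖z - p‖) := by
    rw [Metric.mem_ball, dist_eq_norm, add_sub_cancel_left, norm_mul, norm_mul, Complex.norm_real,
      Real.norm_eq_abs]
    have h1 := Real.abs_cos_le_one γ
    have h2 := norm_nonneg s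
    simp only [Complex.norm_ofNat]
    nlinarith
  have hT := Complex.hasSum_taylorSeries_on_ball ((hG.differentiableOn 0).mono hsub) hmem
  rw [← hT.tsum_eq]
  refine tsum_congr fun m => ?_
  rw [hinner, hG.iteratedDeriv_eq m z (hsub (Metric.mem_ball_self hr)), add_sub_cancel_left,
    smul_eq_mul, smul_eq_mul, mul_pow, mul_pow, mul_pow, neg_pow s]
  ring

/-- The addition theorem for solutions of the Gegenbauer equation. -/
theorem IsGegenbauerFamily.expansion (hμ : -(1 / 2 : ℝ) < μ.re) (hμ0 : μ ≠ 0)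
    (hG : IsGegenbauerFamily ν μ p R G) (γ : ℝ) {y w s : ℂ}
    (hseg : segment ℝ 0 w ⊆ productDomain p R y ∩ Metric.ball 0 1)
    (hs : s ^ 2 = w * (1 - w) * (1 - y ^ 2)) :
    HasSum (fun n : ℕ => ((n : ℂ) + μ) * ((-s) ^ n *
      Complex.regularizedGaussHGFun (μ + n - ν) (ν + (μ + n) + 1) (μ + n + 1) w * G n y) *
        gegenbauerC n μ (Real.cos γ))
      ((Complex.Gamma μ)⁻¹ * G 0 ((1 - 2 * w) * y + 2 * s * Real.cos γ)) := by
  have hΓ := Gamma_ne_zero_of_neg_half_lt_re hμ hμ0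
  have hz : ‖(1 - 2 * w) * y - p‖ + 2 * ‖s‖ < R := by
    have := (hseg (right_mem_segment ℝ 0 w)).1
    rw [productDomain, Set.mem_ofPred_eq, ← hs, norm_pow, Real.sqrt_sq (norm_nonneg s)] at this
    exact this
  have hsum := summable_doubleTerm hμ hG γ hz
  have htsum := tsum_doubleTerm hμ hμ0 hG γ hz
  have hprod := hsum.hasSum.prod_fiberwise fun n => (hsum.prod_factor n).hasSum
  rw [← htsum, inv_mul_cancel_left₀ hΓ]
  refine hprod.congr_fun fun n => ?_
  have hμn : -(1 / 2 : ℝ) < (μ + n).re := by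
    have : (0 : ℝ) ≤ n := n.cast_nonneg
    simp
    linarith
  -- For fixed n the sum over k is the product formula with parameter μ + n for the shifted family.
  have h1 := tsum_productTerm_eq hμn (hG.shift n) hseg
  rw [add_zero] at h1
  rw [mul_assoc ((-s) ^ n), mul_comm (Complex.regularizedGaussHGFun _ _ _ _), ← h1,
    ← tsum_mul_left, ← tsum_mul_left, ← tsum_mul_right]
  refine tsum_congr fun k => ?_
  rw [productTerm, doubleTerm, ← hs, pow_add, pow_mul (-s), neg_sq]
  ring

end Expansion

/-! ### The addition theorem in terms of Ferrers functions. -/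

theorem ofReal_cpow_eq_exp {r : ℝ} (hr : 0 < r) (e : ℂ) :
    (r : ℂ) ^ e = Complex.exp (Real.log r * e) := by
  rw [Complex.cpow_def_of_ne_zero (by exact_mod_cast hr.ne'), Complex.ofReal_log hr.le]

theorem one_sub_cos_pos {α : ℝ} (hα : α ∈ Set.Ioo 0 Real.pi) : 0 < 1 - Real.cos α := by
  have := Real.cos_lt_cos_of_nonneg_of_le_pi le_rfl hα.2.le hα.1
  rw [Real.cos_zero] at this
  linarith

theorem one_add_cos_pos {α : ℝ} (hα : α ∈ Set.Ioo 0 Real.pi) : 0 < 1 + Real.cos α := by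
  have := Real.cos_lt_cos_of_nonneg_of_le_pi hα.1.le le_rfl hα.2
  rw [Real.cos_pi] at this
  linarith

theorem two_mul_log_sin {α : ℝ} (hα : α ∈ Set.Ioo 0 Real.pi) :
    2 * Real.log (Real.sin α) = Real.log (1 + Real.cos α) + Real.log (1 - Real.cos α) := by
  rw [← Real.log_mul (one_add_cos_pos hα).ne' (one_sub_cos_pos hα).ne',
    show (1 + Real.cos α) * (1 - Real.cos α) = Real.sin α ^ 2 by
      rw [Real.sin_sq]; ring, Real.log_pow]
  norm_num

theorem norm_half_one_sub_cos_lt {α : ℝ} (hα : α ∈ Set.Ioo 0 Real.pi) :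
    ‖(1 - (Real.cos α : ℂ)) / 2‖ < 1 := by
  have h1 := one_sub_cos_pos hα
  have h2 := one_add_cos_pos hα
  have : (1 - (Real.cos α : ℂ)) / 2 = (((1 - Real.cos α) / 2 : ℝ) : ℂ) := by push_cast; ring
  rw [this, Complex.norm_real, Real.norm_of_nonneg (by linarith)]
  linarith

/-- The Ferrers function of the first kind as a multiple of a solution of the Gegenbauer
equation. -/
theorem ferrersP_neg_cos (ν : ℂ) {m : ℂ} (hm : ∀ k : ℕ, m + 1 ≠ -k) {α : ℝ}
    (hα : α ∈ Set.Ioo 0 Real.pi) :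
    ferrersP ν (-m) (Real.cos α) = (((Real.sin α / 2 : ℝ)) : ℂ) ^ m *
      Complex.regularizedGaussHGFun (m - ν) (ν + m + 1) (m + 1) ((1 - (Real.cos α : ℂ)) / 2) := by
  have hA := one_add_cos_pos hα
  have hB := one_sub_cos_pos hα
  have hS := Real.sin_pos_of_mem_Ioo hα
  -- Euler's transformation contributes ((1 + cos α)/2)^m, which combines with ((1 + cos α)/(1 - cos
  -- α))^(-m/2) to (sin α / 2)^m.
  rw [ferrersP, sub_neg_eq_add, add_comm 1 m,
    regularizedGaussHGFun_euler hm (norm_half_one_sub_cos_lt hα),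
    show m + 1 - -ν = ν + m + 1 by ring, show m + 1 - (ν + 1) = m - ν by ring,
    show ν + m + 1 - (ν + 1) = m by ring, Complex.regularizedGaussHGFun_symm (ν + m + 1),
    ← mul_assoc]
  congr 1
  rw [show 1 - (1 - (Real.cos α : ℂ)) / 2 = (((1 + Real.cos α) / 2 : ℝ) : ℂ) by push_cast; ring,
    ofReal_cpow_eq_exp (div_pos hA hB), ofReal_cpow_eq_exp (by linarith),
    ofReal_cpow_eq_exp (by linarith), ← Complex.exp_add, Real.log_div hA.ne' hB.ne',
    Real.log_div hA.ne' two_ne_zero, Real.log_div hS.ne' two_ne_zero]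
  congr 1
  have h := congrArg (fun t : ℝ => (t : ℂ)) (two_mul_log_sin hα)
  push_cast at h ⊢
  linear_combination (-m / 2) * h

theorem segment_zero_ofReal {w : ℝ} (hw : 0 ≤ w) {z : ℂ} (hz : z ∈ segment ℝ (0 : ℂ) w) :
    ∃ t : ℝ, 0 ≤ t ∧ t ≤ w ∧ z = t := by
  obtain ⟨a, b, ha, hb, hab, rfl⟩ := hz
  refine ⟨b * w, mul_nonneg hb hw, ?_, by simp⟩
  nlinarith

/-- The addition theorem for a Gegenbauer family, in terms of Ferrers functions. -/
theorem IsGegenbauerFamily.hasGegenbauerExpansion {ν μ : ℂ} {p R : ℝ} {G : ℕ → ℂ → ℂ}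
    (hG : IsGegenbauerFamily ν μ p R G) (hμ : -(1 / 2 : ℝ) < μ.re) (hμ0 : μ ≠ 0)
    {α β γ Θ θ θ' : ℝ} (hα : α ∈ Set.Ioo 0 Real.pi) (hβ : β ∈ Set.Ioo 0 Real.pi)
    (hdom : ∀ φ, 0 ≤ φ → φ ≤ α →
      |Real.cos φ * Real.cos β - p| + Real.sin φ * Real.sin β < R)
    (hsin : Real.sin θ * Real.sin θ' = Real.sin α * Real.sin β)
    (hcos : Real.cos Θ = Real.cos α * Real.cos β + Real.sin α * Real.sin β * Real.cos γ)
    {a : ℕ → ℂ} (ha : ∀ n, a n = (-1) ^ n * ferrersP ν (-(μ + n)) (Real.cos α) *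
      ((Real.sin β : ℂ) ^ (μ + n) * G n (Real.cos β))) :
    HasGegenbauerExpansion μ θ θ' γ (G 0 (Real.cos Θ)) a := by
  have hsα := Real.sin_pos_of_mem_Ioo hα
  have hsβ := Real.sin_pos_of_mem_Ioo hβ
  set s : ℝ := Real.sin α / 2 * Real.sin β with hs
  have hs0 : 0 < s := by positivity
  have hsC : (s : ℂ) ≠ 0 := by exact_mod_cast hs0.ne'
  set w : ℝ := (1 - Real.cos α) / 2 with hw
  have hw0 : 0 ≤ w := by have := one_sub_cos_pos hα; rw [hw]; linarith
  have hw1 : w < 1 := by have := one_add_cos_pos hα; rw [hw]; linarith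
  have hseg : segment ℝ 0 (w : ℂ) ⊆ productDomain p R (Real.cos β) ∩ Metric.ball 0 1 := by
    intro z hz
    obtain ⟨t, ht0, htw, rfl⟩ := segment_zero_ofReal hw0 hz
    refine ⟨?_, ?_⟩
    · have hx1 : -1 ≤ 1 - 2 * t := by linarith
      have hx2 : 1 - 2 * t ≤ 1 := by linarith
      -- A point t of the segment is (1 - cos φ)/2 with 0 ≤ φ ≤ α; in terms of φ the condition of
      -- `productDomain` is `hdom`.
      have hφ : Real.arccos (1 - 2 * t) ≤ α := by
        rw [← Real.arccos_cos hα.1.le hα.2.le]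
        exact Real.arccos_le_arccos (by rw [hw] at htw; linarith)
      have h := hdom _ (Real.arccos_nonneg _) hφ
      rw [Real.cos_arccos hx1 hx2] at h
      rw [productDomain, Set.mem_ofPred_eq]
      have e1 : (1 - 2 * (t : ℂ)) * Real.cos β - p
          = (((1 - 2 * t) * Real.cos β - p : ℝ) : ℂ) := by push_cast; ring
      have e2 : (t : ℂ) * (1 - t) * (1 - (Real.cos β : ℂ) ^ 2)
          = ((t * (1 - t) * (1 - Real.cos β ^ 2) : ℝ) : ℂ) := by push_cast; ring
      have e3 : t * (1 - t) * (1 - Real.cos β ^ 2)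
          = (Real.sin (Real.arccos (1 - 2 * t)) * Real.sin β / 2) ^ 2 := by
        rw [div_pow, mul_pow, Real.sin_sq (Real.arccos _), Real.cos_arccos hx1 hx2, Real.sin_sq]
        ring
      have hsn : 0 ≤ Real.sin (Real.arccos (1 - 2 * t)) :=
        Real.sin_nonneg_of_nonneg_of_le_pi (Real.arccos_nonneg _) (Real.arccos_le_pi _)
      rw [e1, e2, Complex.norm_real, Complex.norm_real, Real.norm_eq_abs, e3,
        Real.norm_of_nonneg (sq_nonneg _), Real.sqrt_sq (by positivity)]
      linarith
    · rw [mem_ball_zero_iff, Complex.norm_real, Real.norm_of_nonneg ht0]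
      linarith
  have hsq : (s : ℂ) ^ 2 = w * (1 - w) * (1 - (Real.cos β : ℂ) ^ 2) := by
    have : s ^ 2 = w * (1 - w) * (1 - Real.cos β ^ 2) := by
      rw [hs, hw, mul_pow, div_pow, Real.sin_sq, Real.sin_sq]
      ring
    exact_mod_cast this
  have hexp := hG.expansion hμ hμ0 γ hseg hsq
  have harg : (1 - 2 * (w : ℂ)) * Real.cos β + 2 * s * Real.cos γ = (Real.cos Θ : ℂ) := by
    rw [hcos, hw, hs]
    push_cast
    ring
  rw [harg] at hexp
  have hterm : HasSum (fun n : ℕ => ((n : ℂ) + μ) * a n * gegenbauerC n μ (Real.cos γ))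
      ((s : ℂ) ^ μ * ((Complex.Gamma μ)⁻¹ * G 0 (Real.cos Θ))) := by
    refine (hexp.mul_left ((s : ℂ) ^ μ)).congr_fun fun n => ?_
    have hm : ∀ k : ℕ, μ + n + 1 ≠ -k := fun k hk => by
      have h1 := congrArg Complex.re hk
      simp at h1
      have : (0 : ℝ) ≤ k := k.cast_nonneg
      have : (0 : ℝ) ≤ n := n.cast_nonneg
      linarith
    have hpow : ((Real.sin α / 2 : ℝ) : ℂ) ^ (μ + n) * (Real.sin β : ℂ) ^ (μ + n)
        = (s : ℂ) ^ μ * (s : ℂ) ^ n := by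
      rw [← Complex.mul_cpow_ofReal_nonneg (by positivity) hsβ.le, ← Complex.ofReal_mul, ← hs,
        Complex.cpow_add _ _ hsC, Complex.cpow_natCast]
    rw [ha, ferrersP_neg_cos ν hm hα, neg_pow (s : ℂ),
      show (1 - (Real.cos α : ℂ)) / 2 = (w : ℂ) by rw [hw]; push_cast; ring]
    linear_combination (((n : ℂ) + μ) * (-1) ^ n * Complex.regularizedGaussHGFun (μ + n - ν)
      (ν + (μ + n) + 1) (μ + n + 1) w * G n (Real.cos β) * gegenbauerC n μ (Real.cos γ)) * hpow
  refine ⟨hterm.summable, ?_⟩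
  have hΓ := Gamma_ne_zero_of_neg_half_lt_re hμ hμ0
  have h2 : (2 : ℂ) ^ μ ≠ 0 := by simp [Complex.cpow_eq_zero_iff]
  have hsμ : (s : ℂ) ^ μ ≠ 0 := by simp [Complex.cpow_eq_zero_iff, hsC]
  rw [hterm.tsum_eq, realCpow, hsin, show Real.sin α * Real.sin β = 2 * s by rw [hs]; ring,
    Complex.ofReal_mul, Complex.mul_cpow_ofReal_nonneg two_pos.le hs0.le]
  push_cast
  field_simp

/-! ### The two families of Ferrers functions of the first kind. -/

theorem derivCoeff_gaussCoeff (a b c : ℂ) :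
    derivCoeff (gaussCoeff a b c) = fun j => a * b * gaussCoeff (a + 1) (b + 1) (c + 1) j := by
  funext j
  have hj : ((j : ℂ) + 1) ≠ 0 := Nat.cast_add_one_ne_zero j
  have hj' : (j.factorial : ℂ) ≠ 0 := Nat.cast_ne_zero.2 j.factorial_ne_zero
  have h : ∀ t : ℂ, (ascPochhammer ℂ (j + 1)).eval t = t * (ascPochhammer ℂ j).eval (t + 1) :=
    fun t => by simp [ascPochhammer_succ_left]
  simp only [derivCoeff, gaussCoeff, h, Nat.factorial_succ, Nat.cast_mul, Nat.cast_add,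
    Nat.cast_one]
  rw [show c + (j + 1 : ℂ) = c + 1 + j by ring]
  field_simp

theorem powerSum_derivCoeff_gaussCoeff (a b c z : ℂ) :
    powerSum (derivCoeff (gaussCoeff a b c)) z
      = a * b * Complex.regularizedGaussHGFun (a + 1) (b + 1) (c + 1) z := by
  rw [derivCoeff_gaussCoeff, powerSum_const_mul, powerSum_gaussCoeff]

theorem hasDerivAt_regularizedGaussHGFun (a b c : ℂ) {z : ℂ} (hz : ‖z‖ < 1) :
    HasDerivAt (Complex.regularizedGaussHGFun a b c)
      (a * b * Complex.regularizedGaussHGFun (a + 1) (b + 1) (c + 1) z) z := by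
  have h := (unitDiscCoeff_gaussCoeff a b c).hasDerivAt_powerSum hz
  rw [powerSum_derivCoeff_gaussCoeff] at h
  rwa [show powerSum (gaussCoeff a b c) = Complex.regularizedGaussHGFun a b c from
    funext fun z => powerSum_gaussCoeff a b c z] at h

/-- The Gegenbauer family of the Ferrers functions of the first kind that is regular at `1`. -/
noncomputable def regularFamily (ν μ : ℂ) (n : ℕ) (z : ℂ) : ℂ :=
  pochhammerSymbol (ν + μ + 1) n * pochhammerSymbol (μ - ν) n * (2 : ℂ) ^ (-(μ + n)) *
    Complex.regularizedGaussHGFun (μ + n - ν) (ν + (μ + n) + 1) (μ + n + 1) ((1 - z) / 2)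

/-- Differentiation raises all three hypergeometric parameters by one, and the factors that it
produces are those by which the Pochhammer symbols and the power of 2 change. The disc |z - 1| < 2
is the unit disc of (1 - z)/2. -/
theorem isGegenbauerFamily_regularFamily (ν μ : ℂ) :
    IsGegenbauerFamily ν μ 1 2 (regularFamily ν μ) := by
  have hmem : ∀ z ∈ Metric.ball (1 : ℂ) 2, ‖(1 - z) / 2‖ < 1 := fun z hz => by
    rw [Metric.mem_ball, dist_eq_norm, norm_sub_rev] at hz
    rw [norm_div, Complex.norm_ofNat]
    linarith
  have hpoch : ∀ (t : ℂ) (n : ℕ), pochhammerSymbol t (n + 1) = pochhammerSymbol t n * (t + n) :=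
    fun t n => ascPochhammer_succ_eval _ _
  have hcast : ∀ n : ℕ, μ + ((n + 1 : ℕ) : ℂ) = μ + n + 1 := fun n => by push_cast; ring
  have htwo : ∀ e : ℂ, (2 : ℂ) ^ (-(e + 1)) = (2 : ℂ) ^ (-e) / 2 := fun e => by
    rw [neg_add, ← sub_eq_add_neg, Complex.cpow_sub _ _ two_ne_zero, Complex.cpow_one]
  refine ⟨fun n z hz => ?_, fun n z hz => ?_⟩
  · have h1 : HasDerivAt (fun z : ℂ => (1 - z) / 2) (-1 / 2) z := by
      simpa using ((hasDerivAt_id z).const_sub 1).div_const 2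
    have h2 := (hasDerivAt_regularizedGaussHGFun (μ + n - ν) (ν + (μ + n) + 1) (μ + n + 1)
      (hmem z hz)).scomp z h1
    refine (h2.const_mul _).congr_deriv ?_
    simp only [regularFamily, hpoch, hcast, htwo, smul_eq_mul]
    rw [show μ + n + 1 - ν = μ + n - ν + 1 by ring, show ν + (μ + n + 1) + 1
      = ν + (μ + n) + 1 + 1 by ring]
    ring
  · have h := hypergeometricODE_powerSum (unitDiscCoeff_gaussCoeff (μ + n - ν) (ν + (μ + n) + 1)
      (μ + n + 1)) (gaussCoeff_succ _ _ _) (hmem z hz)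
    rw [derivCoeff_gaussCoeff] at h
    rw [show derivCoeff (fun j => (μ + n - ν) * (ν + (μ + n) + 1) *
        gaussCoeff (μ + n - ν + 1) (ν + (μ + n) + 1 + 1) (μ + n + 1 + 1) j)
        = fun j => (μ + n - ν) * (ν + (μ + n) + 1) * derivCoeff (gaussCoeff (μ + n - ν + 1)
          (ν + (μ + n) + 1 + 1) (μ + n + 1 + 1)) j by funext j; simp only [derivCoeff]; ring] at h
    rw [powerSum_const_mul, powerSum_const_mul, powerSum_derivCoeff_gaussCoeff,
      powerSum_gaussCoeff, powerSum_gaussCoeff] at h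
    simp only [regularFamily, hpoch, hcast, htwo]
    rw [show μ + n + 1 - ν = μ + n - ν + 1 by ring,
      show μ + n + 1 + 1 - ν = μ + n - ν + 1 + 1 by ring,
      show ν + (μ + n + 1) + 1 = ν + (μ + n) + 1 + 1 by ring,
      show ν + (μ + n + 1 + 1) + 1 = ν + (μ + n) + 1 + 1 + 1 by ring]
    push_cast
    linear_combination (pochhammerSymbol (ν + μ + 1) n * pochhammerSymbol (μ - ν) n *
      (2 : ℂ) ^ (-(μ + n))) * h

/-- The operator c - 1 + z d/dz lowers the third parameter. It appears when a power of 1 - z times a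
hypergeometric function of (1 - z)/2 is differentiated. -/
theorem gaussCoeff_sub_one (a b c : ℂ) (j : ℕ) :
    gaussCoeff a b (c - 1) j = (c - 1) * gaussCoeff a b c j + j * gaussCoeff a b c j := by
  have h := inv_Gamma_eq_mul (c - 1 + j)
  rw [show c - 1 + (j : ℂ) + 1 = c + j by ring] at h
  simp only [gaussCoeff, div_eq_mul_inv, mul_inv, h]
  ring

theorem powerSum_gaussCoeff_sub_one (a b c : ℂ) {z : ℂ} (hz : ‖z‖ < 1) :
    powerSum (gaussCoeff a b (c - 1)) z = (c - 1) * powerSum (gaussCoeff a b c) z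
      + z * powerSum (derivCoeff (gaussCoeff a b c)) z := by
  have hr := unitDiscCoeff_gaussCoeff a b c
  rw [mul_powerSum_derivCoeff hr hz, ← powerSum_const_mul,
    ← (hr.const_mul _).powerSum_add hr.natCast_mul hz]
  congr 1
  funext j
  exact gaussCoeff_sub_one a b c j

theorem powerSum_derivCoeff_gaussCoeff_sub_one (a b c : ℂ) {z : ℂ} (hz : ‖z‖ < 1) :
    powerSum (derivCoeff (gaussCoeff a b (c - 1))) z
      = c * powerSum (derivCoeff (gaussCoeff a b c)) z
        + z * powerSum (derivCoeff (derivCoeff (gaussCoeff a b c))) z := by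
  have hr := (unitDiscCoeff_gaussCoeff a b c).derivCoeff
  rw [mul_powerSum_derivCoeff hr hz, ← powerSum_const_mul,
    ← (hr.const_mul _).powerSum_add hr.natCast_mul hz]
  congr 1
  funext j
  simp only [derivCoeff, gaussCoeff_sub_one]
  push_cast
  ring

/-- The Gegenbauer family of the Ferrers functions of the first kind of order `μ + n`. -/
noncomputable def singularFamily (ν μ : ℂ) (n : ℕ) (z : ℂ) : ℂ :=
  (1 - z) ^ (-(μ + n)) *
    Complex.regularizedGaussHGFun (-ν) (ν + 1) (1 - (μ + n)) ((1 - z) / 2)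

/-- Here only the third parameter moves, together with the exponent of 1 - z. On the unit disc about
0 this power is holomorphic. -/
theorem isGegenbauerFamily_singularFamily (ν μ : ℂ) :
    IsGegenbauerFamily ν μ 0 1 (singularFamily ν μ) := by
  have hmem : ∀ z ∈ Metric.ball (0 : ℂ) 1, ‖(1 - z) / 2‖ < 1 := fun z hz => by
    rw [mem_ball_zero_iff] at hz
    rw [norm_div, Complex.norm_ofNat]
    have := norm_sub_le (1 : ℂ) z
    rw [norm_one] at this
    linarith
  have hcast : ∀ n : ℕ, μ + ((n + 1 : ℕ) : ℂ) = μ + n + 1 := fun n => by push_cast; ring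
  have hsub : ∀ e : ℂ, 1 - (e + 1) = 1 - e - 1 := fun e => by ring
  refine ⟨fun n z hz => ?_, fun n z hz => ?_⟩
  · have hsl := one_sub_mem_slitPlane (mem_ball_zero_iff.1 hz)
    have hne := Complex.slitPlane_ne_zero hsl
    have h1 : HasDerivAt (fun z : ℂ => (1 - z) / 2) (-1 / 2) z := by
      simpa using ((hasDerivAt_id z).const_sub 1).div_const 2
    have h2 := (hasDerivAt_regularizedGaussHGFun (-ν) (ν + 1) (1 - (μ + n)) (hmem z hz)).scomp z h1
    have h3 : HasDerivAt (fun z : ℂ => (1 - z) ^ (-(μ + n)))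
        ((μ + n) * (1 - z) ^ (-(μ + n) - 1)) z := by
      have h0 : HasDerivAt (fun z : ℂ => 1 - z) (-1) z := by
        simpa using (hasDerivAt_id z).const_sub 1
      refine (h0.cpow_const (c := -(μ + n)) hsl).congr_deriv ?_
      ring
    refine (h3.fun_mul h2).congr_deriv ?_
    have h4 := powerSum_gaussCoeff_sub_one (-ν) (ν + 1) (1 - (μ + n)) (hmem z hz)
    rw [powerSum_derivCoeff_gaussCoeff, powerSum_gaussCoeff, powerSum_gaussCoeff] at h4
    simp only [singularFamily, hcast, hsub, smul_eq_mul, Function.comp_apply]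
    rw [h4, cpow_eq_cpow_sub_one_mul hne (-(μ + n)), show -(μ + n + 1) = -(μ + n) - 1 by ring]
    ring
  · have hsl := one_sub_mem_slitPlane (mem_ball_zero_iff.1 hz)
    have hne := Complex.slitPlane_ne_zero hsl
    have hz' := hmem z hz
    have h := hypergeometricODE_powerSum (unitDiscCoeff_gaussCoeff (-ν) (ν + 1)
      (1 - (μ + n))) (gaussCoeff_succ _ _ _) hz'
    simp only [singularFamily, hcast, hsub, ← powerSum_gaussCoeff]
    rw [powerSum_gaussCoeff_sub_one _ _ (1 - (μ + n) - 1) hz',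
      powerSum_derivCoeff_gaussCoeff_sub_one _ _ _ hz', powerSum_gaussCoeff_sub_one _ _ _ hz',
      cpow_eq_cpow_sub_one_mul hne (-(μ + n)), show -(μ + n + 1) = -(μ + n) - 1 by ring,
      show -(μ + n + 1 + 1) = -(μ + n) - 1 - 1 by ring,
      cpow_eq_cpow_sub_one_mul hne (-(μ + n) - 1)]
    set E := (1 - z) ^ (-(μ + n) - 1 - 1)
    linear_combination (E * (1 - z) ^ 2) * h

/-! ### Families prescribed by their values at the origin. -/

/-- The power series with the Taylor coefficients `(-1)^j q_{n+j} / j!`. -/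
noncomputable def taylorFamily (q : ℕ → ℂ) (n : ℕ) (z : ℂ) : ℂ :=
  powerSum (fun j => (-1) ^ j * q (n + j) / j.factorial) z

/-- The hypothesis on q is the Gegenbauer equation evaluated at the origin. It links indices of
equal parity, and the two-step ratios of the coefficients tend to one. -/
theorem unitDiscCoeff_taylorFamily {ν μ : ℂ} {q : ℕ → ℂ}
    (hq : ∀ n : ℕ, q (n + 2) = (ν + (μ + n) + 1) * (μ + n - ν) * q n) (n : ℕ) :
    UnitDiscCoeff fun j => (-1) ^ j * q (n + j) / j.factorial := by
  refine UnitDiscCoeff.of_two_step (ρ := fun j : ℕ =>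
    ‖((ν + μ + n + 1) + j) / (1 + j) * (((μ + n - ν) + j) / (2 + j))‖) ?_ fun j => ?_
  · have h1 : Tendsto (fun j : ℕ => ((ν + μ + n + 1) + j) / (1 + j)) atTop (𝓝 1) := by
      simpa using tendsto_add_mul_div_add_mul_atTop_nhds (ν + μ + n + 1) 1 1 (one_ne_zero (α := ℂ))
    have h2 : Tendsto (fun j : ℕ => ((μ + n - ν) + j) / (2 + j)) atTop (𝓝 1) := by
      simpa using tendsto_add_mul_div_add_mul_atTop_nhds (μ + n - ν) 2 1 (one_ne_zero (α := ℂ))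
    simpa using (h1.mul h2).norm
  · rw [← norm_mul]
    apply le_of_eq
    congr 1
    have h1 : (1 : ℂ) + j ≠ 0 := by rw [add_comm]; exact Nat.cast_add_one_ne_zero j
    have h2 : (2 : ℂ) + j ≠ 0 := by
      have := Nat.cast_add_one_ne_zero (R := ℂ) (j + 1)
      push_cast at this
      intro h
      apply this
      linear_combination h
    have h3 : (j.factorial : ℂ) ≠ 0 := Nat.cast_ne_zero.2 j.factorial_ne_zero
    rw [← add_assoc, hq, Nat.factorial_succ, Nat.factorial_succ]
    push_cast
    rw [show (j : ℂ) + 1 + 1 = 2 + j by ring, add_comm (j : ℂ) 1]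
    field_simp
    ring

theorem derivCoeff_taylorFamily (q : ℕ → ℂ) (n : ℕ) :
    derivCoeff (fun j => (-1) ^ j * q (n + j) / j.factorial)
      = fun j => -1 * ((-1) ^ j * q (n + 1 + j) / j.factorial) := by
  funext j
  have h1 : (j : ℂ) + 1 ≠ 0 := Nat.cast_add_one_ne_zero j
  have h3 : (j.factorial : ℂ) ≠ 0 := Nat.cast_ne_zero.2 j.factorial_ne_zero
  simp only [derivCoeff]
  rw [Nat.factorial_succ, show n + 1 + j = n + (j + 1) by ring]
  push_cast
  field_simp
  ring

/-- The coefficient of z^j in the equation of the n-th member is the recursion at n + j, so the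
recursion at the origin is all that the equation demands. -/
theorem isGegenbauerFamily_taylorFamily {ν μ : ℂ} {q : ℕ → ℂ}
    (hq : ∀ n : ℕ, q (n + 2) = (ν + (μ + n) + 1) * (μ + n - ν) * q n) :
    IsGegenbauerFamily ν μ 0 1 (taylorFamily q) := by
  refine ⟨fun n z hz => ?_, fun n z hz => ?_⟩
  · have h := (unitDiscCoeff_taylorFamily hq n).hasDerivAt_powerSum (mem_ball_zero_iff.1 hz)
    rw [derivCoeff_taylorFamily, powerSum_const_mul, neg_one_mul] at h
    exact h
  · have hz' := mem_ball_zero_iff.1 hz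
    have hu := unitDiscCoeff_taylorFamily hq n
    have h1 := mul_powerSum_derivCoeff hu hz'
    have h2 := sq_mul_powerSum_derivCoeff hu hz'
    rw [derivCoeff_taylorFamily, powerSum_const_mul] at h1
    rw [show derivCoeff (derivCoeff fun j => (-1) ^ j * q (n + j) / j.factorial)
        = fun j => (-1) ^ j * q (n + 2 + j) / j.factorial by
      have e := derivCoeff_taylorFamily q (n + 1)
      rw [derivCoeff_taylorFamily]
      funext j
      have := congrFun e j
      simp only [derivCoeff] at this ⊢
      linear_combination -this] at h2
    have key : powerSum (fun j => ((-1) ^ j * q (n + 2 + j) / j.factorial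
        - (j : ℂ) * ((j : ℂ) - 1) * ((-1) ^ j * q (n + j) / j.factorial))
        - 2 * (μ + n + 1) * ((j : ℂ) * ((-1) ^ j * q (n + j) / j.factorial))
        + (ν - (μ + n)) * (ν + (μ + n) + 1) * ((-1) ^ j * q (n + j) / j.factorial)) z = 0 := by
      rw [powerSum]
      convert tsum_zero with j
      rw [show n + 2 + j = n + j + 2 by ring, hq]
      push_cast
      ring
    have c3 : UnitDiscCoeff fun j => (j : ℂ) * ((j : ℂ) - 1) * ((-1) ^ j * q (n + j) / j.factorial) := by
      refine ((hu.natCast_mul.sub hu).natCast_mul).of_norm_le fun j => le_of_eq ?_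
      congr 1; ring
    have c2 := unitDiscCoeff_taylorFamily hq (n + 2)
    rw [((c2.sub c3).sub (hu.natCast_mul.const_mul _)).powerSum_add (hu.const_mul _) hz',
      (c2.sub c3).powerSum_sub (hu.natCast_mul.const_mul _) hz', c2.powerSum_sub c3 hz',
      powerSum_const_mul, powerSum_const_mul, ← h1, ← h2] at key
    simp only [taylorFamily]
    linear_combination key

theorem apply_two_mul_of_recurrence {ν m : ℂ} {q : ℕ → ℂ}
    (hq : ∀ n : ℕ, q (n + 2) = (ν + (m + n) + 1) * (m + n - ν) * q n) (i : ℕ) :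
    q (2 * i) = 4 ^ i * (ascPochhammer ℂ i).eval ((m - ν) / 2) *
      (ascPochhammer ℂ i).eval ((ν + m + 1) / 2) * q 0 := by
  induction i with
  | zero => simp
  | succ i ih =>
    rw [show 2 * (i + 1) = 2 * i + 2 by ring, hq, ih, ascPochhammer_succ_eval,
      ascPochhammer_succ_eval]
    push_cast
    ring

theorem factorial_two_mul_eq (i : ℕ) : ((2 * i).factorial : ℂ)
    = 4 ^ i * i.factorial * (ascPochhammer ℂ i).eval (1 / 2) := by
  induction i with
  | zero => simp
  | succ i ih =>
    rw [show 2 * (i + 1) = 2 * i + 1 + 1 by ring, Nat.factorial_succ, Nat.factorial_succ,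
      Nat.factorial_succ, ascPochhammer_succ_eval]
    push_cast
    rw [ih]
    ring

theorem factorial_two_mul_add_one_eq (i : ℕ) : ((2 * i + 1).factorial : ℂ)
    = 4 ^ i * i.factorial * (ascPochhammer ℂ i).eval (3 / 2) := by
  induction i with
  | zero => simp
  | succ i ih =>
    rw [show 2 * (i + 1) + 1 = 2 * i + 1 + 1 + 1 by ring, Nat.factorial_succ, Nat.factorial_succ,
      ascPochhammer_succ_eval, Nat.factorial_succ i]
    push_cast
    rw [ih]
    ring

theorem taylorFamily_even_coeff {ν m : ℂ} {q : ℕ → ℂ}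
    (hq : ∀ n : ℕ, q (n + 2) = (ν + (m + n) + 1) * (m + n - ν) * q n) (i : ℕ) :
    (-1) ^ (2 * i) * q (2 * i) / ((2 * i).factorial : ℂ)
      = q 0 * ordinaryHypergeometricCoefficient ((m - ν) / 2) ((ν + m + 1) / 2) (1 / 2 : ℂ) i := by
  have h4 : (4 : ℂ) ^ i ≠ 0 := pow_ne_zero _ (by norm_num)
  rw [apply_two_mul_of_recurrence hq, factorial_two_mul_eq, pow_mul, neg_one_sq, one_pow, one_mul,
    ordinaryHypergeometricCoefficient, mul_assoc (4 ^ i : ℂ) (i.factorial : ℂ), div_eq_mul_inv,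
    mul_inv (4 ^ i : ℂ), mul_inv]
  field_simp

theorem taylorFamily_odd_coeff {ν m : ℂ} {q : ℕ → ℂ}
    (hq : ∀ n : ℕ, q (n + 2) = (ν + (m + n) + 1) * (m + n - ν) * q n) (i : ℕ) :
    (-1) ^ (2 * i + 1) * q (2 * i + 1) / ((2 * i + 1).factorial : ℂ)
      = -q 1 * ordinaryHypergeometricCoefficient ((m - ν + 1) / 2) ((ν + m + 2) / 2)
        (3 / 2 : ℂ) i := by
  have h4 : (4 : ℂ) ^ i ≠ 0 := pow_ne_zero _ (by norm_num)
  -- The shifted sequence obeys the recursion with m + 1 in place of m, so the odd values follow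
  -- from the formula for the even ones.
  have hodd : ∀ n : ℕ, q (n + 2 + 1) = (ν + (m + 1 + n) + 1) * (m + 1 + n - ν) * q (n + 1) :=
    fun n => by
      have := hq (n + 1)
      push_cast at this
      rw [show n + 2 + 1 = n + 1 + 2 by ring, this]
      ring
  have := apply_two_mul_of_recurrence (q := fun n => q (n + 1)) hodd i
  simp only [zero_add] at this
  rw [this, factorial_two_mul_add_one_eq, pow_succ, pow_mul, neg_one_sq, one_pow, one_mul,
    ordinaryHypergeometricCoefficient, mul_assoc (4 ^ i : ℂ) (i.factorial : ℂ), div_eq_mul_inv,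
    mul_inv (4 ^ i : ℂ), mul_inv, show m + 1 - ν = m - ν + 1 by ring,
    show ν + (m + 1) + 1 = ν + m + 2 by ring]
  field_simp

/-- The even and the odd part of the functions of a Gegenbauer family. -/
theorem taylorFamily_zero_eq {ν m : ℂ} {q : ℕ → ℂ}
    (hq : ∀ n : ℕ, q (n + 2) = (ν + (m + n) + 1) * (m + n - ν) * q n) {z : ℂ} (hz : ‖z‖ < 1) :
    taylorFamily q 0 z
      = q 0 * ordinaryHypergeometric ((m - ν) / 2) ((ν + m + 1) / 2) (1 / 2 : ℂ) (z ^ 2)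
        - q 1 * z * ordinaryHypergeometric ((m - ν + 1) / 2) ((ν + m + 2) / 2) (3 / 2 : ℂ) (z ^ 2) := by
  have hu := (unitDiscCoeff_taylorFamily hq 0).summable hz
  simp only [zero_add] at hu
  have hu₁ : Summable fun i : ℕ => (-1) ^ (2 * i) * q (2 * i) / ((2 * i).factorial : ℂ) * z ^ (2 * i) :=
    hu.comp_injective (i := fun i : ℕ => 2 * i) (mul_right_injective₀ two_ne_zero)
  have hu₂ : Summable fun i : ℕ => (-1) ^ (2 * i + 1) * q (2 * i + 1) /
      ((2 * i + 1).factorial : ℂ) * z ^ (2 * i + 1) :=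
    hu.comp_injective (i := fun i : ℕ => 2 * i + 1) fun a b h => by simpa using h
  have hs := tsum_even_add_odd (f := fun j : ℕ => (-1) ^ j * q j / (j.factorial : ℂ) * z ^ j) hu₁ hu₂
  rw [taylorFamily, powerSum]
  simp only [zero_add]
  rw [← hs]
  simp only [taylorFamily_even_coeff hq, taylorFamily_odd_coeff hq]
  rw [ordinaryHypergeometric_eq_tsum, ordinaryHypergeometric_eq_tsum, sub_eq_add_neg (q 0 * _),
    ← neg_mul (q 1 * z), ← neg_mul (q 1)]
  beta_reduce
  rw [← tsum_mul_left, ← tsum_mul_left]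
  congr 1
  · refine tsum_congr fun i => ?_
    rw [smul_eq_mul, pow_mul, mul_assoc]
  · refine tsum_congr fun i => ?_
    rw [smul_eq_mul, pow_succ, pow_mul]
    ring

theorem norm_ascPochhammer_eval_le {a : ℂ} {A : ℝ} (h : ‖a‖ ≤ A) (j : ℕ) :
    ‖(ascPochhammer ℂ j).eval a‖ ≤ ‖(ascPochhammer ℂ j).eval (A : ℂ)‖ := by
  have hA : 0 ≤ A := (norm_nonneg a).trans h
  induction j with
  | zero => simp
  | succ j ih =>
    rw [ascPochhammer_succ_eval, ascPochhammer_succ_eval, norm_mul, norm_mul]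
    have h1 : ‖(A : ℂ) + j‖ = A + j := by
      have : (A : ℂ) + j = ((A + j : ℝ) : ℂ) := by push_cast; ring
      rw [this, Complex.norm_real, Real.norm_of_nonneg (by positivity)]
    have h2 : ‖a + j‖ ≤ A + j := by
      refine (norm_add_le _ _).trans ?_
      rw [Complex.norm_natCast]
      linarith
    rw [h1]
    gcongr

/-- The hypergeometric function is continuous in its upper parameters. -/
theorem continuous_ordinaryHypergeometric {c : ℂ} (hc : ∀ k : ℕ, c ≠ -k) {z : ℂ} (hz : ‖z‖ < 1) :
    Continuous fun ab : ℂ × ℂ => ordinaryHypergeometric ab.1 ab.2 c z := by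
  have hsum : ∀ A B : ℂ, Summable fun j : ℕ => ‖ordinaryHypergeometricCoefficient A B c j * z ^ j‖ := by
    intro A B
    refine (((unitDiscCoeff_gaussCoeff A B c).const_mul (Complex.Gamma c)).summable_norm hz).congr
      fun j => ?_
    congr 2
    have h := Complex.Gamma_inv_mul_ordinaryHypergeometricSeries_eq (a := A) (b := B) hc (n := j)
    rw [Complex.coeff_regularizedGaussHGFunSeries, ordinaryHypergeometricSeries,
      FormalMultilinearSeries.coeff_ofScalars] at h
    rw [gaussCoeff, ← h, mul_inv_cancel_left₀ (Complex.Gamma_ne_zero hc)]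
  simp only [ordinaryHypergeometric_eq_tsum, smul_eq_mul]
  rw [continuous_iff_continuousAt]
  rintro ⟨a, b⟩
  -- Near (a, b) every term is dominated by the term with the positive parameters ‖a‖ + 1 and ‖b‖ +
  -- 1.
  have hcont : ContinuousOn (fun ab : ℂ × ℂ => ∑' j : ℕ,
      ordinaryHypergeometricCoefficient ab.1 ab.2 c j * z ^ j)
      (Metric.ball 0 (‖a‖ + 1) ×ˢ Metric.ball 0 (‖b‖ + 1)) := by
    refine continuousOn_tsum (fun j => ?_)
      (hsum ((‖a‖ + 1 : ℝ) : ℂ) ((‖b‖ + 1 : ℝ) : ℂ)) fun j ab hab => ?_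
    · have h1 : Continuous fun t : ℂ => (ascPochhammer ℂ j).eval t := Polynomial.continuous _
      have h2 : Continuous fun ab : ℂ × ℂ => (ascPochhammer ℂ j).eval ab.1 := h1.comp continuous_fst
      have h3 : Continuous fun ab : ℂ × ℂ => (ascPochhammer ℂ j).eval ab.2 := h1.comp continuous_snd
      exact (((continuous_const.mul h2).mul h3).mul continuous_const |>.mul
        continuous_const).continuousOn
    · have h1 := norm_ascPochhammer_eval_le (mem_ball_zero_iff.1 hab.1).le j
      have h2 := norm_ascPochhammer_eval_le (mem_ball_zero_iff.1 hab.2).le j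
      simp only [ordinaryHypergeometricCoefficient, norm_mul]
      gcongr
  refine hcont.continuousAt ((Metric.isOpen_ball.prod Metric.isOpen_ball).mem_nhds ⟨?_, ?_⟩)
  · simp
  · simp

/-! ### Ferrers functions of the second kind. -/

/-- A Ferrers function of order `m` with prescribed value `c₀` and slope `-c₁` at the origin. -/
noncomputable def ferrersForm (c₀ c₁ ν m : ℂ) (x : ℝ) : ℂ :=
  ((1 - x ^ 2 : ℝ) : ℂ) ^ (-(m / 2)) *
    (c₀ * ordinaryHypergeometric ((-ν - m) / 2) ((ν - m + 1) / 2) (1 / 2 : ℂ) ((x : ℂ) ^ 2)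
      - c₁ * x * ordinaryHypergeometric ((1 - ν - m) / 2) ((ν - m + 2) / 2) (3 / 2 : ℂ) ((x : ℂ) ^ 2))

/-- The value at the origin of the Ferrers function of the second kind. -/
noncomputable def ferrersQAtZero (ν m : ℂ) : ℂ :=
  -((Real.sqrt Real.pi : ℂ) * (2 : ℂ) ^ (m - 1) *
    (Complex.Gamma ((ν + m + 1) / 2) / Complex.Gamma ((ν - m + 2) / 2)) *
      Complex.sin (Real.pi / 2 * (ν + m)))

/-- Since the cosine is a sine shifted by π/2, the odd part carries the value at the origin of the
next order, as a Gegenbauer family requires. -/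
theorem ferrersQSeries_eq (ν m : ℂ) (x : ℝ) :
    ferrersQSeries ν m x
      = ferrersForm (ferrersQAtZero ν m) (ferrersQAtZero ν (m + 1)) ν m x := by
  have hs : Complex.sin (Real.pi / 2 * (ν + (m + 1))) = Complex.cos (Real.pi / 2 * (ν + m)) := by
    rw [← Complex.sin_add_pi_div_two]; congr 1; ring
  rw [ferrersQSeries, ferrersForm, ferrersQAtZero, ferrersQAtZero, hs, Complex.cpow_neg,
    add_sub_cancel_right, show ν + (m + 1) + 1 = ν + m + 2 by ring,
    show ν - (m + 1) + 2 = ν - m + 1 by ring]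
  ring

theorem ferrersQAtZero_add_two {ν m : ℂ} (h : ν + m + 1 ≠ 0) :
    ferrersQAtZero ν (m + 2) = (ν + m + 1) * (m - ν) * ferrersQAtZero ν m := by
  have h1 : Complex.Gamma ((ν + (m + 2) + 1) / 2)
      = (ν + m + 1) / 2 * Complex.Gamma ((ν + m + 1) / 2) := by
    rw [← Complex.Gamma_add_one _ (div_ne_zero h two_ne_zero)]; congr 1; ring
  have h2 : (Complex.Gamma ((ν - (m + 2) + 2) / 2))⁻¹
      = (ν - m) / 2 * (Complex.Gamma ((ν - m + 2) / 2))⁻¹ := by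
    rw [inv_Gamma_eq_mul, show (ν - (m + 2) + 2) / 2 = (ν - m) / 2 by ring]
    congr 3; ring
  have h3 : Complex.sin (Real.pi / 2 * (ν + (m + 2))) = -Complex.sin (Real.pi / 2 * (ν + m)) := by
    rw [← Complex.sin_add_pi]; congr 1; ring
  have h4 : (2 : ℂ) ^ (m + 2 - 1) = 4 * (2 : ℂ) ^ (m - 1) := by
    rw [show m + 2 - 1 = m - 1 + (2 : ℕ) by push_cast; ring, Complex.cpow_add _ _ two_ne_zero,
      Complex.cpow_natCast]
    ring
  rw [ferrersQAtZero, ferrersQAtZero, h1, h3, h4, div_eq_mul_inv, h2, div_eq_mul_inv]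
  ring

theorem one_sub_cos_sq_cpow_half {β : ℝ} (hβ : β ∈ Set.Ioo 0 Real.pi) (e : ℂ) :
    ((1 - Real.cos β ^ 2 : ℝ) : ℂ) ^ (e / 2) = (Real.sin β : ℂ) ^ e := by
  have hS := Real.sin_pos_of_mem_Ioo hβ
  rw [← Real.sin_sq, ofReal_cpow_eq_exp (by positivity), ofReal_cpow_eq_exp hS, Real.log_pow]
  congr 1
  push_cast
  ring

theorem abs_cos_lt_one {β : ℝ} (hβ : β ∈ Set.Ioo 0 Real.pi) : |Real.cos β| < 1 :=
  abs_lt.2 ⟨by linarith [one_add_cos_pos hβ], by linarith [one_sub_cos_pos hβ]⟩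

theorem norm_cos_lt_one {β : ℝ} (hβ : β ∈ Set.Ioo 0 Real.pi) : ‖(Real.cos β : ℂ)‖ < 1 := by
  rw [Complex.norm_real]
  exact abs_cos_lt_one hβ

theorem norm_cos_sq_lt_one {β : ℝ} (hβ : β ∈ Set.Ioo 0 Real.pi) :
    ‖(Real.cos β : ℂ) ^ 2‖ < 1 := by
  rw [norm_pow]
  exact pow_lt_one₀ (norm_nonneg _) (norm_cos_lt_one hβ) two_ne_zero

theorem half_ne_neg_natCast (k : ℕ) : (1 / 2 : ℂ) ≠ -k := fun h => by
  have h1 := congrArg Complex.re h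
  simp at h1
  have : (0 : ℝ) ≤ k := k.cast_nonneg
  linarith [show (0 : ℝ) < 2⁻¹ by norm_num]

theorem three_halves_ne_neg_natCast (k : ℕ) : (3 / 2 : ℂ) ≠ -k := fun h => by
  have h1 := congrArg Complex.re h
  simp at h1
  have : (0 : ℝ) ≤ k := k.cast_nonneg
  linarith

/-- In both hypergeometric functions the third parameter minus the other two is m, so Euler's
transformation turns (1 - x²)^(-m/2) into (1 - x²)^(m/2) = sin^m β. -/
theorem ferrersForm_cos {ν m : ℂ} {q : ℕ → ℂ}
    (hq : ∀ n : ℕ, q (n + 2) = (ν + (m + n) + 1) * (m + n - ν) * q n) {β : ℝ}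
    (hβ : β ∈ Set.Ioo 0 Real.pi) :
    ferrersForm (q 0) (q 1) ν m (Real.cos β)
      = (Real.sin β : ℂ) ^ m * taylorFamily q 0 (Real.cos β) := by
  have hS := Real.sin_pos_of_mem_Ioo hβ
  have hz := norm_cos_sq_lt_one hβ
  rw [ferrersForm, taylorFamily_zero_eq hq (norm_cos_lt_one hβ),
    ordinaryHypergeometric_euler half_ne_neg_natCast hz,
    ordinaryHypergeometric_euler three_halves_ne_neg_natCast hz, neg_div', one_sub_cos_sq_cpow_half hβ,
    Complex.cpow_neg,
    show (1 / 2 : ℂ) - (-ν - m) / 2 - (ν - m + 1) / 2 = 2 * m / 2 by ring,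
    show (3 / 2 : ℂ) - (1 - ν - m) / 2 - (ν - m + 2) / 2 = 2 * m / 2 by ring,
    show (1 / 2 : ℂ) - (-ν - m) / 2 = (ν + m + 1) / 2 by ring,
    show (1 / 2 : ℂ) - (ν - m + 1) / 2 = (m - ν) / 2 by ring,
    show (3 / 2 : ℂ) - (1 - ν - m) / 2 = (ν + m + 2) / 2 by ring,
    show (3 / 2 : ℂ) - (ν - m + 2) / 2 = (m - ν + 1) / 2 by ring,
    show 1 - (Real.cos β : ℂ) ^ 2 = ((1 - Real.cos β ^ 2 : ℝ) : ℂ) by push_cast; ring,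
    one_sub_cos_sq_cpow_half hβ, two_mul, Complex.cpow_add _ _ (by exact_mod_cast hS.ne')]
  have hne : (Real.sin β : ℂ) ^ m ≠ 0 := by
    rw [ofReal_cpow_eq_exp hS]; exact Complex.exp_ne_zero _
  have hsymm : ∀ a b c : ℂ, ordinaryHypergeometric a b c ((Real.cos β : ℂ) ^ 2)
      = ordinaryHypergeometric b a c ((Real.cos β : ℂ) ^ 2) := fun a b c => by
    rw [ordinaryHypergeometric, ordinaryHypergeometric, ordinaryHypergeometricSeries_symm]
  rw [hsymm ((ν + m + 1) / 2), hsymm ((ν + m + 2) / 2)]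
  field_simp

/-- At order -m the exponent and the parameters already agree with those of the family, and no
transformation is needed. -/
theorem ferrersForm_neg_cos {ν m : ℂ} {q : ℕ → ℂ}
    (hq : ∀ n : ℕ, q (n + 2) = (ν + (m + n) + 1) * (m + n - ν) * q n) {β : ℝ}
    (hβ : β ∈ Set.Ioo 0 Real.pi) :
    ferrersForm (q 0) (q 1) ν (-m) (Real.cos β)
      = (Real.sin β : ℂ) ^ m * taylorFamily q 0 (Real.cos β) := by
  rw [ferrersForm, taylorFamily_zero_eq hq (norm_cos_lt_one hβ), neg_div', neg_neg,
    one_sub_cos_sq_cpow_half hβ, show -ν - -m = m - ν by ring, show ν - -m + 1 = ν + m + 1 by ring,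
    show 1 - ν - -m = m - ν + 1 by ring, show ν - -m + 2 = ν + m + 2 by ring]

theorem taylorFamily_eq_zero_shift (q : ℕ → ℂ) (n : ℕ) (z : ℂ) :
    taylorFamily q n z = taylorFamily (fun j => q (n + j)) 0 z := by
  simp only [taylorFamily, zero_add]

/-! ### The anomalous cases of the second kind. -/

theorem Gamma_div_Gamma_of_add_eq {s t : ℂ} {k : ℕ} (hst : s + t = -k) (hs : ∀ j : ℕ, s ≠ -j) :
    Complex.Gamma s / Complex.Gamma t
      = (-1) ^ (k + 1) * (Complex.Gamma (1 - t) / Complex.Gamma (1 - s)) := by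
  have hpi : (Real.pi : ℂ) ≠ 0 := by exact_mod_cast Real.pi_ne_zero
  -- If sin πs = 0, then s is a positive integer, and t and 1 - s are poles of Γ; both quotients are
  -- 0 by the convention Γ = 0 there. Otherwise the reflection formula applies to s and t, with sin
  -- πt = (-1)^(k+1) sin πs.
  by_cases hsin : Complex.sin (Real.pi * s) = 0
  · obtain ⟨N, hN⟩ := Complex.sin_eq_zero_iff.1 hsin
    have hsN : s = N := by
      rw [mul_comm] at hN
      exact mul_right_cancel₀ hpi hN
    obtain ⟨j, hj⟩ : ∃ j : ℕ, N = j + 1 := by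
      refine ⟨(N - 1).toNat, ?_⟩
      have : 0 < N := by
        by_contra hle
        refine hs (-N).toNat ?_
        have h1 : ((-N).toNat : ℤ) = -N := Int.toNat_of_nonneg (by omega)
        have h2 : (((-N).toNat : ℤ) : ℂ) = -(N : ℂ) := by rw [h1]; push_cast; ring
        rw [hsN, ← Int.cast_natCast, h2, neg_neg]
      omega
    have hsj : s = j + 1 := by rw [hsN, hj]; push_cast; ring
    have ht : t = -((k + j + 1 : ℕ) : ℂ) := by
      push_cast
      linear_combination hst - hsj
    rw [ht, Complex.Gamma_neg_nat_eq_zero, show 1 - s = -(j : ℂ) by rw [hsj]; ring,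
      Complex.Gamma_neg_nat_eq_zero]
    simp
  · have hsint : Complex.sin (Real.pi * t) = (-1) ^ (k + 1) * Complex.sin (Real.pi * s) := by
      have : (Real.pi : ℂ) * t = -(Real.pi * s + k * Real.pi) := by linear_combination Real.pi * hst
      rw [this, Complex.sin_neg, Complex.sin_antiperiodic.add_nat_mul_eq, pow_succ]
      ring
    have h1 := Complex.Gamma_mul_Gamma_one_sub s
    have h2 := Complex.Gamma_mul_Gamma_one_sub t
    rw [hsint] at h2
    have hpow : ((-1 : ℂ) ^ (k + 1)) * (-1) ^ (k + 1) = 1 := by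
      rw [← mul_pow]; simp
    have hpne : ((-1 : ℂ) ^ (k + 1)) ≠ 0 := pow_ne_zero _ (by norm_num)
    have hprod1 : Complex.Gamma s * Complex.Gamma (1 - s) ≠ 0 := by
      rw [h1]; exact div_ne_zero hpi hsin
    have hprod2 : Complex.Gamma t * Complex.Gamma (1 - t) ≠ 0 := by
      rw [h2]; exact div_ne_zero hpi (mul_ne_zero hpne hsin)
    have ht0 := left_ne_zero_of_mul hprod2
    have hs1 := right_ne_zero_of_mul hprod1
    have h3 : Complex.Gamma s * Complex.Gamma (1 - s)
        = (-1) ^ (k + 1) * (Complex.Gamma t * Complex.Gamma (1 - t)) := by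
      rw [h1, h2]
      field_simp
    rw [mul_div_assoc', div_eq_div_iff ht0 hs1, h3]
    ring

/-- The value at the origin of the Ferrers function of the second kind of degree `-(k + 3/2)`,
free of the removable singularities in the order. -/
noncomputable def anomalousQAtZero (k : ℕ) (ν m : ℂ) : ℂ :=
  -((Real.sqrt Real.pi : ℂ) * (2 : ℂ) ^ (m - 1) *
    ((-1) ^ (k + 1) * (Complex.Gamma ((m - ν) / 2) * (Complex.Gamma ((1 - ν - m) / 2))⁻¹)) *
      Complex.sin (Real.pi / 2 * (ν + m)))

/-- For ν = -(k + 3/2) the two gamma arguments add up to -k. After reflection the numerator is Γ((m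
- ν)/2), which has no pole when Re m > -1/2. -/
theorem ferrersQAtZero_eq_anomalous {k : ℕ} {ν m : ℂ} (hν : ν = -((k : ℂ) + 3 / 2))
    (hm : ¬ IsNegInt (ν + m)) : ferrersQAtZero ν m = anomalousQAtZero k ν m := by
  have h := Gamma_div_Gamma_of_add_eq (s := (ν + m + 1) / 2) (t := (ν - m + 2) / 2) (k := k)
    (by rw [hν]; ring) fun j hj => hm ⟨2 * j, by push_cast; linear_combination 2 * hj⟩
  rw [ferrersQAtZero, h, anomalousQAtZero, show 1 - (ν - m + 2) / 2 = (m - ν) / 2 by ring,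
    show 1 - (ν + m + 1) / 2 = (1 - ν - m) / 2 by ring, div_eq_mul_inv (Complex.Gamma _)]

theorem anomalousQAtZero_add_two (k : ℕ) {ν m : ℂ} (h : m - ν ≠ 0) :
    anomalousQAtZero k ν (m + 2) = (ν + m + 1) * (m - ν) * anomalousQAtZero k ν m := by
  have h1 : Complex.Gamma ((m + 2 - ν) / 2) = (m - ν) / 2 * Complex.Gamma ((m - ν) / 2) := by
    rw [← Complex.Gamma_add_one _ (div_ne_zero h two_ne_zero)]; congr 1; ring
  have h2 : (Complex.Gamma ((1 - ν - (m + 2)) / 2))⁻¹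
      = (-1 - ν - m) / 2 * (Complex.Gamma ((1 - ν - m) / 2))⁻¹ := by
    rw [inv_Gamma_eq_mul, show (1 - ν - (m + 2)) / 2 = (-1 - ν - m) / 2 by ring]
    congr 3; ring
  have h3 : Complex.sin (Real.pi / 2 * (ν + (m + 2))) = -Complex.sin (Real.pi / 2 * (ν + m)) := by
    rw [← Complex.sin_add_pi]; congr 1; ring
  have h4 : (2 : ℂ) ^ (m + 2 - 1) = 4 * (2 : ℂ) ^ (m - 1) := by
    rw [show m + 2 - 1 = m - 1 + (2 : ℕ) by push_cast; ring, Complex.cpow_add _ _ two_ne_zero,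
      Complex.cpow_natCast]
    ring
  rw [anomalousQAtZero, anomalousQAtZero, h1, h2, h3, h4]
  ring

theorem continuousAt_anomalousQAtZero (k : ℕ) {ν m : ℂ} (h : 0 < (m - ν).re) :
    ContinuousAt (anomalousQAtZero k ν) m := by
  have h1 : ContinuousAt (fun m : ℂ => Complex.Gamma ((m - ν) / 2)) m := by
    have : ContinuousAt Complex.Gamma ((m - ν) / 2) := by
      refine (Complex.differentiableAt_Gamma _ fun j hj => ?_).continuousAt
      have h1 := congrArg Complex.re hj
      rw [Complex.div_ofNat_re] at h1
      simp only [Complex.neg_re, Complex.natCast_re] at h1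
      have : (0 : ℝ) ≤ j := j.cast_nonneg
      have : 0 < (m - ν).re / 2 := by positivity
      linarith
    exact this.comp (f := fun m : ℂ => (m - ν) / 2) (by fun_prop)
  have h2 : Continuous fun m : ℂ => (Complex.Gamma ((1 - ν - m) / 2))⁻¹ :=
    Complex.differentiable_one_div_Gamma.continuous.comp (by fun_prop)
  have h3 : Continuous fun m : ℂ => (2 : ℂ) ^ (m - 1) :=
    (continuous_id.sub continuous_const).const_cpow (Or.inl two_ne_zero)
  have h4 : Continuous fun m : ℂ => Complex.sin (Real.pi / 2 * (ν + m)) := by fun_prop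
  exact ((continuousAt_const.mul h3.continuousAt).mul
    (continuousAt_const.mul (h1.mul h2.continuousAt)) |>.mul h4.continuousAt).neg

theorem ferrersQSeries_eq_anomalous {k : ℕ} {ν m : ℂ} (hν : ν = -((k : ℂ) + 3 / 2))
    (hm : ¬ IsNegInt (ν + m)) (x : ℝ) : ferrersQSeries ν m x
      = ferrersForm (anomalousQAtZero k ν m) (anomalousQAtZero k ν (m + 1)) ν m x := by
  rw [ferrersQSeries_eq, ferrersQAtZero_eq_anomalous hν hm, ferrersQAtZero_eq_anomalous hν]
  rintro ⟨j, hj⟩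
  exact hm ⟨j + 1, by push_cast; linear_combination hj⟩

theorem eventually_not_isNegInt {z m : ℂ} (h : IsNegInt (z + m)) :
    ∀ᶠ m' in 𝓝[≠] m, ¬ IsNegInt (z + m') := by
  have hb : ∀ᶠ m' in 𝓝[≠] m, m' ∈ Metric.ball m 1 :=
    nhdsWithin_le_nhds (Metric.ball_mem_nhds m one_pos)
  filter_upwards [hb, self_mem_nhdsWithin] with m' h1 h2
  rintro ⟨i, hi⟩
  obtain ⟨j, hj⟩ := h
  have hd : m' - m = ((j - i : ℤ) : ℂ) := by push_cast; linear_combination hi - hj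
  rw [Metric.mem_ball, dist_eq_norm, hd, Complex.norm_intCast] at h1
  have h3 : |(j : ℤ) - i| < 1 := by exact_mod_cast h1
  rw [Int.abs_lt_one_iff] at h3
  rw [h3] at hd
  exact h2 (by simpa [sub_eq_zero] using hd)

/-- The Ferrers function of the second kind of degree `-(k + 3/2)`, anomalous orders included. -/
theorem ferrersQ_eq_anomalous {k : ℕ} {ν m : ℂ} (hν : ν = -((k : ℂ) + 3 / 2))
    (hm : -(1 / 2 : ℝ) < m.re) {x : ℝ} (hx : |x| < 1) : ferrersQ ν m x
      = ferrersForm (anomalousQAtZero k ν m) (anomalousQAtZero k ν (m + 1)) ν m x := by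
  by_cases hneg : IsNegInt (ν + m)
  · rw [ferrersQ, if_pos hneg]
    apply Tendsto.limUnder_eq
    have hre : 0 < (m - ν).re := by
      have : (0 : ℝ) ≤ k := k.cast_nonneg
      rw [hν]
      simp
      linarith
    have hx2 : x ^ 2 < 1 := (sq_lt_one_iff_abs_lt_one x).2 hx
    have hz : ‖(x : ℂ) ^ 2‖ < 1 := by
      rw [norm_pow, Complex.norm_real]
      exact pow_lt_one₀ (norm_nonneg _) hx two_ne_zero
    have c0 := continuousAt_anomalousQAtZero k hre
    have c1 : ContinuousAt (fun m' => anomalousQAtZero k ν (m' + 1)) m := by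
      have : ContinuousAt (anomalousQAtZero k ν) (m + 1) := by
        apply continuousAt_anomalousQAtZero
        rw [show m + 1 - ν = m - ν + 1 by ring, Complex.add_re, Complex.one_re]
        linarith
      exact this.comp (f := fun m' : ℂ => m' + 1) (by fun_prop)
    have c2 : Continuous fun m' : ℂ => ((1 - x ^ 2 : ℝ) : ℂ) ^ (-(m' / 2)) :=
      Continuous.const_cpow (by fun_prop) (Or.inl (by
        have : (1 - x ^ 2 : ℝ) ≠ 0 := by linarith
        exact_mod_cast this))
    have c3 : Continuous fun m' : ℂ => ordinaryHypergeometric ((-ν - m') / 2) ((ν - m' + 1) / 2)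
        (1 / 2 : ℂ) ((x : ℂ) ^ 2) :=
      (continuous_ordinaryHypergeometric half_ne_neg_natCast hz).comp
        (f := fun m' : ℂ => ((-ν - m') / 2, (ν - m' + 1) / 2)) (by fun_prop)
    have c4 : Continuous fun m' : ℂ => ordinaryHypergeometric ((1 - ν - m') / 2) ((ν - m' + 2) / 2)
        (3 / 2 : ℂ) ((x : ℂ) ^ 2) :=
      (continuous_ordinaryHypergeometric three_halves_ne_neg_natCast hz).comp
        (f := fun m' : ℂ => ((1 - ν - m') / 2, (ν - m' + 2) / 2)) (by fun_prop)
    have hc : ContinuousAt (fun m' => ferrersForm (anomalousQAtZero k ν m')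
        (anomalousQAtZero k ν (m' + 1)) ν m' x) m :=
      c2.continuousAt.mul ((c0.mul c3.continuousAt).sub
        ((c1.mul continuousAt_const).mul c4.continuousAt))
    -- The orders with ν + m a negative integer are isolated, so near m the series agrees with a
    -- form continuous in the order, whose value at m is the limit.
    refine (hc.tendsto.mono_left nhdsWithin_le_nhds).congr' ?_
    filter_upwards [eventually_not_isNegInt hneg] with m' hm'
    exact (ferrersQSeries_eq_anomalous hν hm' x).symm
  · rw [ferrersQ, if_neg hneg, ferrersQSeries_eq_anomalous hν hneg]

/-- If one order is anomalous, the degree is -(k + 3/2) and the reflected values serve at every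
order μ + n; otherwise the original values do. Either choice obeys the recursion. -/
theorem exists_taylorFamily_ferrersQ {ν μ : ℂ} (hμ : -(1 / 2 : ℝ) < μ.re)
    (hdef : ∀ n : ℕ, FerrersQDefined ν (μ + n)) :
    ∃ q : ℕ → ℂ, (∀ n : ℕ, q (n + 2) = (ν + (μ + n) + 1) * (μ + n - ν) * q n) ∧
      ∀ n : ℕ, ∀ β ∈ Set.Ioo 0 Real.pi, ferrersQ ν (μ + n) (Real.cos β)
        = (Real.sin β : ℂ) ^ (μ + n) * taylorFamily q n (Real.cos β) := by
  have hre : ∀ n : ℕ, -(1 / 2 : ℝ) < (μ + n).re := fun n => by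
    have : (0 : ℝ) ≤ n := n.cast_nonneg
    simp
    linarith
  obtain ⟨Q, hQ2, hQ⟩ : ∃ Q : ℂ → ℂ,
      (∀ n : ℕ, Q (μ + n + 2) = (ν + (μ + n) + 1) * (μ + n - ν) * Q (μ + n)) ∧
      ∀ n : ℕ, ∀ β ∈ Set.Ioo 0 Real.pi, ferrersQ ν (μ + n) (Real.cos β)
        = ferrersForm (Q (μ + n)) (Q (μ + n + 1)) ν (μ + n) (Real.cos β) := by
    by_cases h : ∃ n : ℕ, IsNegInt (ν + (μ + n))
    · obtain ⟨n, hn⟩ := h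
      obtain ⟨k, hk⟩ := ((hdef n).resolve_left (not_not.2 hn)).1
      refine ⟨anomalousQAtZero k ν, fun n => anomalousQAtZero_add_two k fun h0 => ?_,
        fun n β hβ => ferrersQ_eq_anomalous hk (hre n) (abs_cos_lt_one hβ)⟩
      have h1 := congrArg Complex.re h0
      have h2 := hre n
      have : (0 : ℝ) ≤ k := k.cast_nonneg
      rw [hk] at h1
      simp at h1 h2
      linarith
    · push Not at h
      refine ⟨ferrersQAtZero ν, fun n => ferrersQAtZero_add_two fun h0 => ?_, fun n β hβ => ?_⟩
      · exact h n ⟨0, by push_cast; linear_combination h0⟩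
      · rw [ferrersQ, if_neg (h n), ferrersQSeries_eq]
  have hrec : ∀ n : ℕ, Q (μ + (n + 2 : ℕ)) = (ν + (μ + n) + 1) * (μ + n - ν) * Q (μ + n) :=
    fun n => by
      rw [← hQ2]; congr 1; push_cast; ring
  refine ⟨fun n => Q (μ + n), hrec, fun n β hβ => ?_⟩
  rw [taylorFamily_eq_zero_shift, ← ferrersForm_cos (ν := ν) _ hβ, hQ n β hβ]
  · simp only [add_zero]
    congr 2
    push_cast
    ring
  · intro j
    have := hrec (n + j)
    rw [← add_assoc, this]
    push_cast
    ring

/-- If ν - μ were an integer, ν - (μ + n) would be a negative integer for all large n. Being defined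
there would require ν + μ + n to be a negative integer too, which fails for large n. -/
theorem sub_ne_intCast_of_ferrersQDefined {ν μ : ℂ}
    (hdef : ∀ n : ℕ, FerrersQDefined ν (-(μ + n))) (N : ℤ) : ν - μ ≠ N := by
  intro hN
  have hneg : ∀ n : ℕ, N < n → IsNegInt (ν + -(μ + n)) := fun n hn => by
    refine ⟨(n - N - 1).toNat, ?_⟩
    have h1 : (((n : ℤ) - N - 1).toNat : ℤ) = n - N - 1 := Int.toNat_of_nonneg (by omega)
    have h2 : ((((n : ℤ) - N - 1).toNat : ℤ) : ℂ) = n - N - 1 := by rw [h1]; push_cast; ring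
    rw [Int.cast_natCast] at h2
    rw [h2]
    linear_combination hN
  obtain ⟨n, hn⟩ := exists_nat_gt (max (N : ℝ) (-(ν + μ).re))
  have hn1 : N < n := by
    have := (le_max_left _ _).trans_lt hn
    exact_mod_cast this
  have hn2 := (le_max_right _ _).trans_lt hn
  obtain ⟨-, j, hj⟩ := (hdef n).resolve_left (not_not.2 (hneg n hn1))
  have h1 := congrArg Complex.re hj
  have : (0 : ℝ) ≤ j := j.cast_nonneg
  simp at h1 hn2
  linarith

theorem exists_taylorFamily_ferrersQ_neg {ν μ : ℂ}
    (hdef : ∀ n : ℕ, FerrersQDefined ν (-(μ + n))) :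
    ∃ q : ℕ → ℂ, (∀ n : ℕ, q (n + 2) = (ν + (μ + n) + 1) * (μ + n - ν) * q n) ∧
      ∀ n : ℕ, ∀ β ∈ Set.Ioo 0 Real.pi, pochhammerSymbol (ν + μ + 1) n * pochhammerSymbol (μ - ν) n
        * ferrersQ ν (-(μ + n)) (Real.cos β)
        = (Real.sin β : ℂ) ^ (μ + n) * taylorFamily q n (Real.cos β) := by
  have hsub := sub_ne_intCast_of_ferrersQDefined hdef
  have hpoch : ∀ (t : ℂ) (n : ℕ), pochhammerSymbol t (n + 1) = pochhammerSymbol t n * (t + n) :=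
    fun t n => ascPochhammer_succ_eval _ _
  -- Raising the order -(μ+n+1) by two gives -(μ+n) + 1, the order whose value at the origin is
  -- minus the slope at order -(μ+n). The factors are those by which the Pochhammer symbols grow.
  have hstep : ∀ n : ℕ, ferrersQAtZero ν (-(μ + n) + 1)
      = (ν + μ + 1 + n) * (μ - ν + n) * ferrersQAtZero ν (-(μ + (n + 1 : ℕ))) := fun n => by
    have h := ferrersQAtZero_add_two (ν := ν) (m := -(μ + (n + 1 : ℕ))) fun h0 =>
      hsub n (by push_cast at h0 ⊢; linear_combination h0)
    rw [show -(μ + ((n + 1 : ℕ) : ℂ)) + 2 = -(μ + n) + 1 by push_cast; ring] at h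
    rw [h]
    push_cast
    ring
  set q : ℕ → ℂ := fun n => pochhammerSymbol (ν + μ + 1) n * pochhammerSymbol (μ - ν) n *
    ferrersQAtZero ν (-(μ + n)) with hq
  have hrec : ∀ n : ℕ, q (n + 2) = (ν + (μ + n) + 1) * (μ + n - ν) * q n := fun n => by
    have h := hstep (n + 1)
    rw [show -(μ + ((n + 1 : ℕ) : ℂ)) + 1 = -(μ + n) by push_cast; ring] at h
    simp only [hq, hpoch, h]
    push_cast
    ring_nf
  refine ⟨q, hrec, fun n β hβ => ?_⟩
  have hnot : ¬ IsNegInt (ν + -(μ + n)) := by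
    rintro ⟨j, hj⟩
    exact hsub (n - j - 1) (by push_cast; linear_combination hj)
  rw [taylorFamily_eq_zero_shift, ← ferrersForm_neg_cos (ν := ν) _ hβ, ferrersQ, if_neg hnot,
    ferrersQSeries_eq, hstep]
  · simp only [ferrersForm, hq, add_zero, hpoch]
    ring
  · intro j
    have := hrec (n + j)
    rw [← add_assoc, this]
    push_cast
    ring

/-! ### The conditions on the angles. -/

theorem add_lt_pi_of_tan_mul_tan_lt_one {α β : ℝ} (hα : α ∈ Set.Ioo 0 Real.pi)
    (hβ : β ∈ Set.Ioo 0 Real.pi) (h : Real.tan (α / 2) * Real.tan (β / 2) < 1) :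
    α + β < Real.pi := by
  obtain ⟨hα0, hα1⟩ := hα
  obtain ⟨hβ0, hβ1⟩ := hβ
  by_contra! hle
  have ca : 0 < Real.cos (α / 2) := Real.cos_pos_of_mem_Ioo ⟨by linarith, by linarith⟩
  have cb : 0 < Real.cos (β / 2) := Real.cos_pos_of_mem_Ioo ⟨by linarith, by linarith⟩
  rw [Real.tan_eq_sin_div_cos, Real.tan_eq_sin_div_cos, div_mul_div_comm,
    div_lt_one (mul_pos ca cb)] at h
  have h1 : Real.cos (α / 2 + β / 2) ≤ 0 :=
    Real.cos_nonpos_of_pi_div_two_le_of_le (by linarith) (by linarith)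
  rw [Real.cos_add] at h1
  linarith

theorem neg_one_lt_cos {φ : ℝ} (h0 : 0 ≤ φ) (h1 : φ < Real.pi) : -1 < Real.cos φ := by
  rw [← Real.cos_pi]
  exact Real.cos_lt_cos_of_nonneg_of_le_pi h0 le_rfl h1

theorem cos_lt_one {φ : ℝ} (h0 : 0 < φ) (h1 : φ < Real.pi) : Real.cos φ < 1 := by
  rw [← Real.cos_zero]
  exact Real.cos_lt_cos_of_nonneg_of_le_pi le_rfl h1.le h0

section Domain

variable {α β φ : ℝ}

/-- The left side is 1 - cos(φ + β). -/
theorem abs_cos_mul_cos_sub_one_add_lt (hβ : β ∈ Set.Ioo 0 Real.pi) (hαβ : α + β < Real.pi)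
    (h0 : 0 ≤ φ) (h1 : φ ≤ α) :
    |Real.cos φ * Real.cos β - (1 : ℝ)| + Real.sin φ * Real.sin β < 2 := by
  have h2 := neg_one_lt_cos (φ := φ + β) (by linarith [hβ.1]) (by linarith)
  rw [Real.cos_add] at h2
  have h3 : Real.cos φ * Real.cos β ≤ 1 := by
    have := (abs_mul (Real.cos φ) (Real.cos β)).le.trans (mul_le_one₀ (Real.abs_cos_le_one φ)
      (abs_nonneg _) (Real.abs_cos_le_one β))
    exact (le_abs_self _).trans this
  rw [abs_of_nonpos (by linarith)]
  linarith

/-- The left side is 1 + cos(β - φ). -/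
theorem abs_cos_mul_cos_add_one_add_lt (hβ : β ∈ Set.Ioo 0 Real.pi) (hαβ : α < β)
    (h0 : 0 ≤ φ) (h1 : φ ≤ α) :
    |Real.cos φ * Real.cos β - (-1 : ℝ)| + Real.sin φ * Real.sin β < 2 := by
  have h2 := cos_lt_one (φ := β - φ) (by linarith) (by linarith [hβ.2])
  rw [Real.cos_sub] at h2
  have h3 : -1 ≤ Real.cos φ * Real.cos β := by
    have := (abs_mul (Real.cos φ) (Real.cos β)).le.trans (mul_le_one₀ (Real.abs_cos_le_one φ)
      (abs_nonneg _) (Real.abs_cos_le_one β))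
    exact (abs_le.1 this).1
  rw [abs_of_nonneg (by linarith)]
  linarith

/-- The left side is the larger of cos(β - φ) and -cos(φ + β), so both conditions on the angles are
used. -/
theorem abs_cos_mul_cos_add_lt (hαβ : α + β < Real.pi) (hlt : α < β) (h0 : 0 ≤ φ) (h1 : φ ≤ α) :
    |Real.cos φ * Real.cos β - (0 : ℝ)| + Real.sin φ * Real.sin β < 1 := by
  have h2 := neg_one_lt_cos (φ := φ + β) (by linarith) (by linarith)
  have h3 := cos_lt_one (φ := β - φ) (by linarith) (by linarith)
  rw [Real.cos_add] at h2
  rw [Real.cos_sub] at h3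
  rw [sub_zero]
  rcases abs_cases (Real.cos φ * Real.cos β) with ⟨h, -⟩ | ⟨h, -⟩ <;> rw [h] <;> linarith

end Domain

/-! ### The six expansions. -/

theorem sin_cpow_ne_zero {β : ℝ} (hβ : β ∈ Set.Ioo 0 Real.pi) (e : ℂ) :
    (Real.sin β : ℂ) ^ e ≠ 0 := by
  rw [ofReal_cpow_eq_exp (Real.sin_pos_of_mem_Ioo hβ)]
  exact Complex.exp_ne_zero _

theorem one_div_realCpow_mul_eq {β : ℝ} (hβ : β ∈ Set.Ioo 0 Real.pi) {e f g : ℂ}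
    (h : f = (Real.sin β : ℂ) ^ e * g) : 1 / realCpow (Real.sin β) e * f = g := by
  rw [h, realCpow, one_div, inv_mul_cancel_left₀ (sin_cpow_ne_zero hβ e)]

theorem ferrersP_cos_eq_singularFamily (ν μ : ℂ) (n : ℕ) {β : ℝ} (hβ : β ∈ Set.Ioo 0 Real.pi) :
    ferrersP ν (μ + n) (Real.cos β)
      = (Real.sin β : ℂ) ^ (μ + n) * singularFamily ν μ n (Real.cos β) := by
  have hA := one_add_cos_pos hβ
  have hB := one_sub_cos_pos hβ
  rw [ferrersP, singularFamily, ← mul_assoc]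
  congr 1
  rw [show 1 - (Real.cos β : ℂ) = ((1 - Real.cos β : ℝ) : ℂ) by push_cast; ring,
    ofReal_cpow_eq_exp (div_pos hA hB), ofReal_cpow_eq_exp (Real.sin_pos_of_mem_Ioo hβ),
    ofReal_cpow_eq_exp hB, ← Complex.exp_add, Real.log_div hA.ne' hB.ne']
  congr 1
  have h := congrArg (fun t : ℝ => (t : ℂ)) (two_mul_log_sin hβ)
  push_cast at h ⊢
  linear_combination (-(μ + n) / 2) * h

theorem ferrersP_neg_cos_eq_regularFamily {ν μ : ℂ} (hμ : -(1 / 2 : ℝ) < μ.re) (n : ℕ) {β : ℝ}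
    (hβ : β ∈ Set.Ioo 0 Real.pi) :
    pochhammerSymbol (ν + μ + 1) n * pochhammerSymbol (μ - ν) n *
        ferrersP ν (-(μ + n)) (Real.cos β)
      = (Real.sin β : ℂ) ^ (μ + n) * regularFamily ν μ n (Real.cos β) := by
  have hS := Real.sin_pos_of_mem_Ioo hβ
  have hm : ∀ k : ℕ, μ + n + 1 ≠ -k := fun k hk => by
    have h1 := congrArg Complex.re hk
    simp at h1
    have : (0 : ℝ) ≤ k := k.cast_nonneg
    have : (0 : ℝ) ≤ n := n.cast_nonneg
    linarith
  have h2 : ((Real.sin β / 2 : ℝ) : ℂ) ^ (μ + n)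
      = (Real.sin β : ℂ) ^ (μ + n) * (2 : ℂ) ^ (-(μ + n)) := by
    rw [show (2 : ℂ) = ((2 : ℝ) : ℂ) by norm_num, ofReal_cpow_eq_exp (by positivity),
      ofReal_cpow_eq_exp hS, ofReal_cpow_eq_exp two_pos, ← Complex.exp_add,
      Real.log_div hS.ne' two_ne_zero]
    congr 1
    push_cast
    ring
  rw [ferrersP_neg_cos ν hm hβ, h2, regularFamily]
  ring

theorem pi_sub_mem_Ioo {β : ℝ} (hβ : β ∈ Set.Ioo 0 Real.pi) :
    Real.pi - β ∈ Set.Ioo 0 Real.pi := ⟨by linarith [hβ.2], by linarith [hβ.1]⟩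

theorem mainTheorem1 (μ ν : ℂ) (hμ : -(1 / 2 : ℝ) < μ.re) (hμ0 : μ ≠ 0)
    (hν : ¬ IsNegInt ν) (γ θ θ' Θ : ℝ)
    (hθ : θ ∈ Set.Ioo 0 Real.pi) (hθ' : θ' ∈ Set.Ioo 0 Real.pi)
    (htan : Real.tan (min θ θ' / 2) * Real.tan (max θ θ' / 2) < 1)
    (hΘ : Θ ∈ Set.Icc 0 Real.pi)
    (hcos : Real.cos Θ =
      Real.cos θ * Real.cos θ' + Real.sin θ * Real.sin θ' * Real.cos γ) :
    (θ ≠ θ' →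
      HasGegenbauerExpansion μ θ θ' γ
        (1 / realCpow (Real.sin Θ) μ * ferrersP ν μ (Real.cos Θ))
        (fun n => (-1) ^ n * ferrersP ν (-(μ + n)) (Real.cos (min θ θ')) *
          ferrersP ν (μ + n) (Real.cos (max θ θ')))) ∧
    (θ ≠ θ' → (∀ n : ℕ, FerrersQDefined ν (μ + n)) →
      HasGegenbauerExpansion μ θ θ' γ
        (1 / realCpow (Real.sin Θ) μ * ferrersQ ν μ (Real.cos Θ))
        (fun n => (-1) ^ n * ferrersP ν (-(μ + n)) (Real.cos (min θ θ')) *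
          ferrersQ ν (μ + n) (Real.cos (max θ θ')))) ∧
    (Θ ≠ 0 →
      HasGegenbauerExpansion μ θ θ' γ
        (1 / realCpow (Real.sin Θ) μ * ferrersP ν (-μ) (Real.cos Θ))
        (fun n => (-1) ^ n * pochhammerSymbol (ν + μ + 1) n * pochhammerSymbol (μ - ν) n *
          ferrersP ν (-(μ + n)) (Real.cos θ) *
          ferrersP ν (-(μ + n)) (Real.cos θ'))) ∧
    (θ ≠ θ' → (∀ n : ℕ, FerrersQDefined ν (-(μ + n))) →
      HasGegenbauerExpansion μ θ θ' γ
        (1 / realCpow (Real.sin Θ) μ * ferrersQ ν (-μ) (Real.cos Θ))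
        (fun n => (-1) ^ n * pochhammerSymbol (ν + μ + 1) n * pochhammerSymbol (μ - ν) n *
          ferrersP ν (-(μ + n)) (Real.cos (min θ θ')) *
          ferrersQ ν (-(μ + n)) (Real.cos (max θ θ')))) ∧
    (θ ≠ θ' →
      HasGegenbauerExpansion μ θ θ' γ
        (1 / realCpow (Real.sin Θ) μ * ferrersP ν (-μ) (-Real.cos Θ))
        (fun n => pochhammerSymbol (ν + μ + 1) n * pochhammerSymbol (μ - ν) n *
          ferrersP ν (-(μ + n)) (Real.cos (min θ θ')) *
          ferrersP ν (-(μ + n)) (-Real.cos (max θ θ')))) ∧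
    (θ ≠ θ' → (∀ n : ℕ, FerrersQDefined ν (-(μ + n))) →
      HasGegenbauerExpansion μ θ θ' γ
        (1 / realCpow (Real.sin Θ) μ * ferrersQ ν (-μ) (-Real.cos Θ))
        (fun n => pochhammerSymbol (ν + μ + 1) n * pochhammerSymbol (μ - ν) n *
          ferrersP ν (-(μ + n)) (Real.cos (min θ θ')) *
          ferrersQ ν (-(μ + n)) (-Real.cos (max θ θ')))) := by
  have hα : min θ θ' ∈ Set.Ioo 0 Real.pi := by rcases min_choice θ θ' with h | h <;> rwa [h]
  have hβ : max θ θ' ∈ Set.Ioo 0 Real.pi := by rcases max_choice θ θ' with h | h <;> rwa [h]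
  have hle : min θ θ' ≤ max θ θ' := min_le_max
  have hlt : θ ≠ θ' → min θ θ' < max θ θ' := fun h => min_lt_max.2 h
  have hsin : Real.sin θ * Real.sin θ' = Real.sin (min θ θ') * Real.sin (max θ θ') := by
    rcases le_total θ θ' with h | h
    · rw [min_eq_left h, max_eq_right h]
    · rw [min_eq_right h, max_eq_left h, mul_comm]
  have hcos' : Real.cos Θ = Real.cos (min θ θ') * Real.cos (max θ θ')
      + Real.sin (min θ θ') * Real.sin (max θ θ') * Real.cos γ := by
    rw [hcos, hsin]
    rcases le_total θ θ' with h | h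
    · rw [min_eq_left h, max_eq_right h]
    · rw [min_eq_right h, max_eq_left h, mul_comm (Real.cos θ)]
  have hPP : ∀ f : ℝ → ℂ, f (Real.cos θ) * f (Real.cos θ')
      = f (Real.cos (min θ θ')) * f (Real.cos (max θ θ')) := fun f => by
    rcases le_total θ θ' with h | h
    · rw [min_eq_left h, max_eq_right h]
    · rw [min_eq_right h, max_eq_left h, mul_comm]
  generalize min θ θ' = α at *
  generalize max θ θ' = β at *
  have hπ : α + β < Real.pi := add_lt_pi_of_tan_mul_tan_lt_one hα hβ htan
  have hss : 0 < Real.sin α * Real.sin β :=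
    mul_pos (Real.sin_pos_of_mem_Ioo hα) (Real.sin_pos_of_mem_Ioo hβ)
  -- cos Θ is at least cos(α + β) > -1, and for distinct angles at most cos(β - α) < 1; so sin Θ
  -- does not vanish where it is divided by.
  have hΘπ : Θ < Real.pi := by
    refine lt_of_le_of_ne hΘ.2 fun h => ?_
    have h1 := neg_one_lt_cos (φ := α + β) (by linarith [hα.1, hβ.1]) hπ
    rw [Real.cos_add] at h1
    rw [h, Real.cos_pi] at hcos'
    have := mul_le_mul_of_nonneg_left (Real.neg_one_le_cos γ) hss.le
    linarith
  have hΘ0 : θ ≠ θ' → Θ ≠ 0 := fun h h0 => by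
    have h1 := cos_lt_one (φ := β - α) (by linarith [hlt h]) (by linarith [hβ.2, hα.1])
    rw [Real.cos_sub] at h1
    rw [h0, Real.cos_zero] at hcos'
    have := mul_le_mul_of_nonneg_left (Real.cos_le_one γ) hss.le
    linarith
  have hΘI : Θ ≠ 0 → Θ ∈ Set.Ioo 0 Real.pi := fun h => ⟨lt_of_le_of_ne hΘ.1 h.symm, hΘπ⟩
  have hcast0 : μ + ((0 : ℕ) : ℂ) = μ := by simp
  have hpoch0 : ∀ t : ℂ, pochhammerSymbol t 0 = 1 := fun t => by simp [pochhammerSymbol]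
  refine ⟨fun hne => ?_, fun hne hdef => ?_, fun h0 => ?_, fun hne hdef => ?_, fun hne => ?_,
    fun hne hdef => ?_⟩
  · have hI := hΘI (hΘ0 hne)
    have hP := ferrersP_cos_eq_singularFamily ν μ 0 hI
    rw [hcast0] at hP
    rw [one_div_realCpow_mul_eq hI hP]
    have hG : IsGegenbauerFamily ν μ ((0 : ℝ) : ℂ) 1 (singularFamily ν μ) := by
      simpa using isGegenbauerFamily_singularFamily ν μ
    exact hG.hasGegenbauerExpansion hμ hμ0 hα hβ
      (fun φ => abs_cos_mul_cos_add_lt hπ (hlt hne)) hsin hcos' fun n => by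
        rw [ferrersP_cos_eq_singularFamily ν μ n hβ]
  · have hI := hΘI (hΘ0 hne)
    obtain ⟨q, hq, hQ⟩ := exists_taylorFamily_ferrersQ hμ hdef
    have hQ0 := hQ 0 Θ hI
    rw [hcast0] at hQ0
    rw [one_div_realCpow_mul_eq hI hQ0]
    have hG : IsGegenbauerFamily ν μ ((0 : ℝ) : ℂ) 1 (taylorFamily q) := by
      simpa using isGegenbauerFamily_taylorFamily hq
    exact hG.hasGegenbauerExpansion hμ hμ0 hα hβ
      (fun φ => abs_cos_mul_cos_add_lt hπ (hlt hne)) hsin hcos' fun n => by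
        rw [hQ n β hβ]
  -- This family is regular at 1, and the disc |z - 1| < 2 needs only α + β < π; equal angles are
  -- therefore allowed.
  · have hI := hΘI h0
    have hP := ferrersP_neg_cos_eq_regularFamily (ν := ν) hμ 0 hI
    rw [hcast0, hpoch0, hpoch0, one_mul, one_mul] at hP
    rw [one_div_realCpow_mul_eq hI hP]
    have hG : IsGegenbauerFamily ν μ ((1 : ℝ) : ℂ) 2 (regularFamily ν μ) := by
      simpa using isGegenbauerFamily_regularFamily ν μ
    refine hG.hasGegenbauerExpansion hμ hμ0 hα hβ
      (fun φ => abs_cos_mul_cos_sub_one_add_lt hβ hπ) hsin hcos' fun n => ?_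
    rw [← ferrersP_neg_cos_eq_regularFamily hμ n hβ]
    linear_combination ((-1) ^ n * pochhammerSymbol (ν + μ + 1) n * pochhammerSymbol (μ - ν) n) *
      hPP (ferrersP ν (-(μ + n)))
  · have hI := hΘI (hΘ0 hne)
    obtain ⟨q, hq, hQ⟩ := exists_taylorFamily_ferrersQ_neg hdef
    have hQ0 := hQ 0 Θ hI
    rw [hcast0, hpoch0, hpoch0, one_mul, one_mul] at hQ0
    rw [one_div_realCpow_mul_eq hI hQ0]
    have hG : IsGegenbauerFamily ν μ ((0 : ℝ) : ℂ) 1 (taylorFamily q) := by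
      simpa using isGegenbauerFamily_taylorFamily hq
    refine hG.hasGegenbauerExpansion hμ hμ0 hα hβ
      (fun φ => abs_cos_mul_cos_add_lt hπ (hlt hne)) hsin hcos' fun n => ?_
    rw [← hQ n β hβ]
    ring
  · have hI := hΘI (hΘ0 hne)
    have hP := ferrersP_neg_cos_eq_regularFamily (ν := ν) hμ 0 (pi_sub_mem_Ioo hI)
    rw [hcast0, hpoch0, hpoch0, one_mul, one_mul, Real.cos_pi_sub, Real.sin_pi_sub] at hP
    rw [one_div_realCpow_mul_eq hI hP]
    have hG : IsGegenbauerFamily ν μ ((-1 : ℝ) : ℂ) 2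
        (fun n z => (-1) ^ n * regularFamily ν μ n (-z)) := by
      simpa using (isGegenbauerFamily_regularFamily ν μ).reflect
    have := hG.hasGegenbauerExpansion (Θ := Θ) (a := fun n => pochhammerSymbol (ν + μ + 1) n *
      pochhammerSymbol (μ - ν) n * ferrersP ν (-(μ + n)) (Real.cos α) *
        ferrersP ν (-(μ + n)) (-Real.cos β)) hμ hμ0 hα hβ
      (fun φ => abs_cos_mul_cos_add_one_add_lt hβ (hlt hne)) hsin hcos' fun n => ?_
    · simpa using this
    · have h := ferrersP_neg_cos_eq_regularFamily (ν := ν) hμ n (pi_sub_mem_Ioo hβ)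
      rw [Real.cos_pi_sub, Real.sin_pi_sub, Complex.ofReal_neg] at h
      -- The sign of the reflected family cancels the (-1)^n of the addition theorem.
      have h1 : ((-1 : ℂ) ^ n) * (-1) ^ n = 1 := by rw [← mul_pow]; simp
      linear_combination ferrersP ν (-(μ + n)) (Real.cos α) * h
        - ferrersP ν (-(μ + n)) (Real.cos α) * ((Real.sin β : ℂ) ^ (μ + n) *
          regularFamily ν μ n (-(Real.cos β : ℂ))) * h1
  · have hI := hΘI (hΘ0 hne)
    obtain ⟨q, hq, hQ⟩ := exists_taylorFamily_ferrersQ_neg hdef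
    have hQ0 := hQ 0 _ (pi_sub_mem_Ioo hI)
    rw [hcast0, hpoch0, hpoch0, one_mul, one_mul, Real.cos_pi_sub, Real.sin_pi_sub] at hQ0
    rw [one_div_realCpow_mul_eq hI hQ0]
    have hG : IsGegenbauerFamily ν μ ((0 : ℝ) : ℂ) 1
        (fun n z => (-1) ^ n * taylorFamily q n (-z)) := by
      simpa using (isGegenbauerFamily_taylorFamily hq).reflect
    have := hG.hasGegenbauerExpansion (Θ := Θ) (a := fun n => pochhammerSymbol (ν + μ + 1) n *
      pochhammerSymbol (μ - ν) n * ferrersP ν (-(μ + n)) (Real.cos α) *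
        ferrersQ ν (-(μ + n)) (-Real.cos β)) hμ hμ0 hα hβ
      (fun φ => abs_cos_mul_cos_add_lt hπ (hlt hne)) hsin hcos' fun n => ?_
    · simpa using this
    · have h := hQ n _ (pi_sub_mem_Ioo hβ)
      rw [Real.cos_pi_sub, Real.sin_pi_sub, Complex.ofReal_neg] at h
      have h1 : ((-1 : ℂ) ^ n) * (-1) ^ n = 1 := by rw [← mul_pow]; simp
      linear_combination ferrersP ν (-(μ + n)) (Real.cos α) * h
        - ferrersP ν (-(μ + n)) (Real.cos α) * ((Real.sin β : ℂ) ^ (μ + n) *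
          taylorFamily q n (-(Real.cos β : ℂ))) * h1
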